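/- **Setting and notation.** Let $\mathbb C_+=\{\operatorname{Im}z>0\}$. Elements of the Hardy space $H^2=H^2(\mathbb C_+)$ are identified with their boundary values, so $H^2\subset L^2(\mathbb R)$; $\langle f,g\rangle=\int_{\mathbb R} f\overline g\,dx$, and $\mathbb P_+$ is the orthogonal projection of $L^2(\mathbb R)$ onto $H^2$. A *rational symbol* is a rational function $u$ without poles in the closed upper half-plane and with $u(\infty)=0$; its Hankel operator is the anti-linear operator $H_uf=\mathbb P_+(u\overline f)$ on $H^2$. For $\lambda>0$ put $E_{H_u}(\lambda)=\operatorname{Ker}(H_u^2-\lambda^2I)$; $\lambda$ is a *singular value* of $H_u$ if $E_{H_u}(\lambda)\neq\{0\}$. A *finite Blaschke product* of degree $m\ge 0$ is $\theta(x)=c\prod_{j=1}^m\frac{x-a_j}{x-\overline{a_j}}$ with $|c|=1$ and $\operatorname{Im}a_j>0$. Its model space is $K_\theta=H^2\cap(\theta H^2)^\perp$, $P_\theta$ is the orthogonal projection onto $K_\theta$, and $A_\theta$ is the infinitesimal generator of the semigroup $S_\theta(\tau)f=P_\theta(e^{i\tau x}f)$ on $K_\theta$, i.e. $A_\theta f=\lim_{\tau\to0+}\frac1{i\tau}(S_\theta(\tau)f-f)$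 for $f\in K_\theta$. An *isometric multiplier* on $K_\psi$ is a holomorphic function $p$ in $\mathbb C_+$ such that $pf\in H^2$ and $\|pf\|=\|f\|$ for all $f\in K_\psi$. We say that $H_u$ *has spectral data* $(\{\lambda_n\}_{n=1}^N,\{\psi_n\}_{n=1}^N,\{e^{i\varphi_n}\}_{n=1}^N,\{\omega_n\}_{n=1}^N)$ if 1. the singular values of $H_u$ are exactly $\lambda_1,\dots,\lambda_N$; 2. for each $n$ there is an isometric multiplier $p_n$ on $K_{\psi_n}$ with $E_{H_u}(\lambda_n)=p_nK_{\psi_n}$; 3. for each $n$ the orthogonal projection $u_n$ of $u$ onto $E_{H_u}(\lambda_n)$ is non-zero and satisfies $H_uu_n=\lambda_ne^{i\varphi_n}u_n$; 4. $\operatorname{Ran}H_u=K_\theta$ for a finite Blaschke product $\theta$ with $\theta(\infty)=1$, and $\langle A_\theta u_n,u_n\rangle=\omega_n$ for each $n$. **Theorem.** Let $\lambda_1>\dots>\lambda_N>0$ be real, let $\psi_1,\dots,\psi_N$ be non-constant finite Blaschke products, let $e^{i\varphi_1},\dots,e^{i\varphi_N}$ be unimodular ($\varphi_j\in\mathbb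 R$), and let $\omega_1,\dots,\omega_N\in\mathbb C_+$. (a) Assume that $\psi_j(\infty)=1$ for all $j$. Define $\nu_j>0$ by $4\pi\operatorname{Im}\omega_j=\lambda_j^2\nu_j^4$, and for $x\in\mathbb C_+$ put $$b_j(x)=\frac1{\nu_j^2}\left(i\,\frac{\|1-\psi_j\|^2}{4\pi}\,\frac{1+\psi_j(x)}{1-\psi_j(x)}+\frac{\operatorname{Re}\langle A_{\psi_j}(1-\psi_j),1-\psi_j\rangle}{\|1-\psi_j\|^2}-x\right).$$ Let $\mathcal A$ be the $N\times N$ matrix with $$\mathcal A_{kj}=\frac{i}{2\pi}\,\frac{\lambda_j^2-\lambda_j\lambda_ke^{i(\varphi_j-\varphi_k)}}{\lambda_j^2-\lambda_k^2}\quad(j\ne k),\qquad \mathcal A_{jj}=\frac{\omega_j}{4\pi\operatorname{Im}\omega_j},$$ and, writing $D(\alpha)$ for the diagonal matrix with entries $\alpha_1,\dots,\alpha_N$, let $$Q(x)=\mathcal A^*-x\,D(\nu^2)^{-1}-D(b(x)).$$ Then each generator $A_{\psi_j}$ exists on all of $K_{\psi_j}$, the matrix $Q(x)$ is invertible for every $x\in\mathbb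 C_+$, and the function $$u(x)=\frac1{2\pi i}\left\langle Q(x)^{-1}D(\lambda)D(e^{-i\varphi})\mathbf 1,\mathbf 1\right\rangle_{\mathbb C^N},\qquad \mathbf 1=(1,\dots,1)^\top,\quad x\in\mathbb C_+,$$ is (the restriction to $\mathbb C_+$ of) a rational symbol, and $H_u$ has the spectral data $(\{\lambda_n\},\{\psi_n\},\{e^{i\varphi_n}\},\{\omega_n\})$. (b) Consequently the spectral map is surjective: without the normalisation $\psi_j(\infty)=1$ there still is a rational symbol $u$ such that $H_u$ has the spectral data $(\{\lambda_n\},\{\psi_n\},\{e^{i\varphi_n}\},\{\omega_n\})$. -/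

import Mathlib

open MeasureTheory Filter Topology Complex
open scoped ENNReal NNReal Matrix

noncomputable section

namespace SzegoHankel

/-- The Hilbert space `L²(ℝ)`. Mathlib's `inner ℂ f g` is linear in `g`, so the inner product
`⟨f, g⟩ = ∫ f conj(g)` (linear in the first factor) is written `inner ℂ g f`. -/
abbrev L2 : Type := Lp ℂ 2 (volume : Measure ℝ)

/-- The open upper half-plane `ℂ₊`. -/
def upperHalf : Set ℂ := {z | 0 < z.im}

/-- The closed upper half-plane. -/
def closedUpperHalf : Set ℂ := {z | 0 ≤ z.im}

/-- The class in `L²(ℝ)` of a square-integrable function (and `0` for any other function). -/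
def toL2 (f : ℝ → ℂ) : L2 :=
  open Classical in if h : MemLp f 2 volume then h.toLp f else 0

/-- Multiplication by an essentially bounded measurable function `m` on `L²(ℝ)`
(and `0` for any other function `m`). -/
def mulL2 (m : ℝ → ℂ) : L2 →L[ℂ] L2 :=
  open Classical in
  if h : MemLp m ∞ (volume : Measure ℝ) then
    (ContinuousLinearMap.mul ℂ ℂ).holderL volume ∞ 2 2 (h.toLp m)
  else 0

/-- The orthogonal projection of `L²(ℝ)` onto (the closure of) a subspace. It is used below
for closed subspaces only, where the closure changes nothing; taking the closure makes the
projection available without a separate proof of closedness. -/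
def proj (M : Submodule ℂ L2) : L2 →L[ℂ] L2 :=
  M.topologicalClosure.starProjection

/-- `F` is holomorphic in `ℂ₊`, the norms of `F(· + iy)` in `L²(ℝ)` are bounded uniformly in
`y > 0`, and `f` is the boundary value of `F` on the real line. -/
def HasBoundaryValue (F : ℂ → ℂ) (f : L2) : Prop :=
  DifferentiableOn ℂ F upperHalf ∧
  (∃ C : ℝ≥0, ∀ y : ℝ, 0 < y →
    eLpNorm (fun x : ℝ => F (x + y * I)) 2 (volume : Measure ℝ) ≤ C) ∧
  Tendsto (fun y : ℝ => eLpNorm (fun x : ℝ => F (x + y * I) - f x) 2 (volume : Measure ℝ))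
    (𝓝[>] 0) (𝓝 0)

lemma aesm_slice {F : ℂ → ℂ} (hF : DifferentiableOn ℂ F upperHalf) {y : ℝ} (hy : 0 < y) :
    AEStronglyMeasurable (fun x : ℝ => F (x + y * I)) (volume : Measure ℝ) := by
  refine Continuous.aestronglyMeasurable ?_
  refine hF.continuousOn.comp_continuous (by fun_prop) (fun x => ?_)
  simp [upperHalf, hy]

lemma HasBoundaryValue.add {F G : ℂ → ℂ} {f g : L2}
    (hF : HasBoundaryValue F f) (hG : HasBoundaryValue G g) :
    HasBoundaryValue (F + G) (f + g) := by
  obtain ⟨hF1, ⟨C, hC⟩, hF3⟩ := hF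
  obtain ⟨hG1, ⟨D, hD⟩, hG3⟩ := hG
  refine ⟨hF1.add hG1, ⟨C + D, fun y hy => ?_⟩, ?_⟩
  · refine (eLpNorm_add_le (aesm_slice hF1 hy) (aesm_slice hG1 hy) (by norm_num)).trans ?_
    push_cast
    exact add_le_add (hC y hy) (hD y hy)
  · have h0 := hF3.add hG3
    rw [add_zero] at h0
    refine tendsto_of_tendsto_of_tendsto_of_le_of_le' tendsto_const_nhds h0
      (Eventually.of_forall fun _ => zero_le) ?_
    filter_upwards [self_mem_nhdsWithin] with y hy
    have e : (fun x : ℝ => (F + G) (x + y * I) - (f + g : L2) x) =ᵐ[volume]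
        (fun x : ℝ => F (x + y * I) - f x) + (fun x : ℝ => G (x + y * I) - g x) := by
      filter_upwards [Lp.coeFn_add f g] with x hx
      simp only [Pi.add_apply, hx]
      ring
    rw [eLpNorm_congr_ae e]
    exact eLpNorm_add_le ((aesm_slice hF1 hy).sub (Lp.aestronglyMeasurable f))
      ((aesm_slice hG1 hy).sub (Lp.aestronglyMeasurable g)) (by norm_num)

lemma HasBoundaryValue.smul {F : ℂ → ℂ} {f : L2} (c : ℂ) (hF : HasBoundaryValue F f) :
    HasBoundaryValue (c • F) (c • f) := by
  obtain ⟨hF1, ⟨C, hC⟩, hF3⟩ := hF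
  refine ⟨hF1.const_smul c, ⟨‖c‖₊ * C, fun y hy => ?_⟩, ?_⟩
  · have e : (fun x : ℝ => (c • F) (x + y * I)) = c • (fun x : ℝ => F (x + y * I)) := rfl
    rw [e, eLpNorm_const_smul]
    push_cast
    exact mul_le_mul_right (hC y hy) _
  · have h0 := ENNReal.Tendsto.const_mul (a := ‖c‖ₑ) hF3 (Or.inr (by simp))
    rw [mul_zero] at h0
    refine h0.congr (fun y => ?_)
    have e : (fun x : ℝ => (c • F) (x + y * I) - (c • f : L2) x) =ᵐ[volume]
        c • (fun x : ℝ => F (x + y * I) - f x) := by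
      filter_upwards [Lp.coeFn_smul c f] with x hx
      simp only [Pi.smul_apply, hx, smul_eq_mul]
      ring
    rw [eLpNorm_congr_ae e, eLpNorm_const_smul]

lemma HasBoundaryValue.zero : HasBoundaryValue 0 0 := by
  refine ⟨differentiableOn_const 0, ⟨0, fun y _ => by simp⟩, ?_⟩
  have e : (fun y : ℝ => eLpNorm (fun x : ℝ => (0 : ℂ → ℂ) (x + y * I) - (0 : L2) x) 2
      (volume : Measure ℝ)) = fun _ => 0 := by
    funext y
    have e' : (fun x : ℝ => (0 : ℂ → ℂ) (x + y * I) - (0 : L2) x) =ᵐ[volume] 0 := by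
      filter_upwards [Lp.coeFn_zero ℂ 2 (volume : Measure ℝ)] with x hx
      rw [hx]
      simp
    rw [eLpNorm_congr_ae e', eLpNorm_zero]
  rw [e]
  exact tendsto_const_nhds

/-- The Hardy space `H²(ℂ₊)`, identified with the space of boundary values of its elements. -/
def hardy : Submodule ℂ L2 where
  carrier := {f | ∃ F : ℂ → ℂ, HasBoundaryValue F f}
  add_mem' := fun ⟨F, hF⟩ ⟨G, hG⟩ => ⟨F + G, hF.add hG⟩
  zero_mem' := ⟨0, HasBoundaryValue.zero⟩
  smul_mem' := fun c _ ⟨F, hF⟩ => ⟨c • F, hF.smul c⟩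

/-- The anti-linear Hankel operator `H_u f = ℙ₊ (u conj(f))`, where `ℙ₊` is the orthogonal
projection of `L²(ℝ)` onto `H²(ℂ₊)`. -/
def hankel (u : ℝ → ℂ) (f : L2) : L2 :=
  proj hardy (mulL2 u (star f))

lemma hankel_add (u : ℝ → ℂ) (f g : L2) : hankel u (f + g) = hankel u f + hankel u g := by
  have e : star (f + g) = star f + star g := by
    refine Subtype.ext (AEEqFun.ext ?_)
    filter_upwards [Lp.coeFn_star (f + g), Lp.coeFn_star f, Lp.coeFn_star g,
      Lp.coeFn_add f g, Lp.coeFn_add (star f) (star g)] with x h1 h2 h3 h4 h5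
    rw [h1, h5]
    simp only [Pi.star_apply, Pi.add_apply, h2, h3, h4, star_add]
  simp [hankel, e]

lemma hankel_smul (u : ℝ → ℂ) (c : ℂ) (f : L2) : hankel u (c • f) = star c • hankel u f := by
  have e : star (c • f) = star c • star f := by
    refine Subtype.ext (AEEqFun.ext ?_)
    filter_upwards [Lp.coeFn_star (c • f), Lp.coeFn_star f,
      Lp.coeFn_smul c f, Lp.coeFn_smul (star c) (star f)] with x h1 h2 h3 h4
    rw [h1, h4]
    simp only [Pi.star_apply, Pi.smul_apply, h2, h3, star_smul]
  simp [hankel, e]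

/-- The Schmidt subspace `E_{H_u}(s) = Ker (H_u² - s²)` of the Hankel operator on `H²(ℂ₊)`. -/
def schmidt (u : ℝ → ℂ) (s : ℝ) : Submodule ℂ L2 where
  carrier := {f | f ∈ hardy ∧ hankel u (hankel u f) = ((s : ℂ) ^ 2) • f}
  add_mem' := by
    rintro f g ⟨hf, hf'⟩ ⟨hg, hg'⟩
    exact ⟨hardy.add_mem hf hg, by rw [hankel_add, hankel_add, hf', hg', smul_add]⟩
  zero_mem' := ⟨hardy.zero_mem, by
    have h : hankel u 0 = 0 := by simpa using hankel_smul u 0 0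
    rw [h, h, smul_zero]⟩
  smul_mem' := by
    rintro c f ⟨hf, hf'⟩
    exact ⟨hardy.smul_mem c hf, by
      rw [hankel_smul, hankel_smul, star_star, hf', smul_comm]⟩

/-- On the closed upper half-plane `ψ` is a finite Blaschke product of degree `m`. The values
of `ψ` elsewhere are irrelevant. -/
def IsFiniteBlaschke (m : ℕ) (ψ : ℂ → ℂ) : Prop :=
  ∃ (c : ℂ) (a : Fin m → ℂ), ‖c‖ = 1 ∧ (∀ j, 0 < (a j).im) ∧
    ∀ z ∈ closedUpperHalf, ψ z = c * ∏ j, (z - a j) / (z - starRingEnd ℂ (a j))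

/-- The normalisation `ψ(∞) = 1`. -/
def IsNormalised (ψ : ℂ → ℂ) : Prop :=
  Tendsto ψ (cocompact ℂ ⊓ 𝓟 closedUpperHalf) (𝓝 1)

/-- The model space `K_θ = H² ∩ (θ H²)^⊥`. -/
def model (θ : ℂ → ℂ) : Submodule ℂ L2 :=
  hardy ⊓ (hardy.map (mulL2 (fun x : ℝ => θ x)).toLinearMap)ᗮ

/-- The Beurling-Lax semigroup `S_θ(τ) f = P_θ (e^{iτx} f)` on `K_θ`. -/
def semigroup (θ : ℂ → ℂ) (τ : ℝ) (f : L2) : L2 :=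
  proj (model θ) (mulL2 (fun x : ℝ => exp (I * τ * x)) f)

/-- The difference quotient `(S_θ(τ) f - f) / (iτ)`. -/
def diffQuot (θ : ℂ → ℂ) (f : L2) (τ : ℝ) : L2 :=
  (I * (τ : ℂ))⁻¹ • (semigroup θ τ f - f)

/-- `A` maps `K_θ` to itself and is there the infinitesimal generator of the semigroup
`S_θ(τ) = e^{iτA}`: the limit of `(S_θ(τ) f - f) / (iτ)` as `τ → 0+` exists and is `A f`. -/
def IsGenerator (θ : ℂ → ℂ) (A : L2 → L2) : Prop :=
  ∀ f ∈ model θ, A f ∈ model θ ∧ Tendsto (diffQuot θ f) (𝓝[>] 0) (𝓝 (A f))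

/-- The infinitesimal generator `A_θ`, `A_θ f = lim_{τ → 0+} (S_θ(τ) f - f) / (iτ)`. -/
def generator (θ : ℂ → ℂ) (f : L2) : L2 :=
  limUnder (𝓝[>] (0 : ℝ)) (diffQuot θ f)

/-- `p` is an isometric multiplier on `K_ψ`: it is holomorphic in `ℂ₊`, and for every `f ∈ K_ψ`
(with holomorphic extension `F`) one has `p f ∈ H²` and `‖p f‖ = ‖f‖`. -/
def IsIsometricMultiplier (p ψ : ℂ → ℂ) : Prop :=
  DifferentiableOn ℂ p upperHalf ∧
  ∀ f ∈ model ψ, ∀ F : ℂ → ℂ, HasBoundaryValue F f →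
    ∃ g : L2, HasBoundaryValue (fun z => p z * F z) g ∧ ‖g‖ = ‖f‖

/-- The set `p K_ψ = {p f : f ∈ K_ψ}`. -/
def multModel (p ψ : ℂ → ℂ) : Set L2 :=
  {g | ∃ f ∈ model ψ, ∃ F : ℂ → ℂ, HasBoundaryValue F f ∧
    HasBoundaryValue (fun z => p z * F z) g}

/-- On the closed upper half-plane `u` is a rational function without poles there which
vanishes at infinity. The values of `u` elsewhere are irrelevant. -/
def IsRationalSymbol (u : ℂ → ℂ) : Prop :=
  ∃ P R : Polynomial ℂ, P.degree < R.degree ∧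
    ∀ z ∈ closedUpperHalf, R.eval z ≠ 0 ∧ u z = P.eval z / R.eval z

/-- The orthogonal projection `u_n` of `u` onto the Schmidt subspace `E_{H_u}(s)`. -/
def symbolProj (u : ℝ → ℂ) (s : ℝ) : L2 :=
  proj (schmidt u s) (toL2 u)

/-- The Hankel operator `H_u` has the spectral data `({λ_n}, {ψ_n}, {e^{iφ_n}}, {ω_n})`. -/
structure HasSpectralData (u : ℝ → ℂ) {N : ℕ} (lam : Fin N → ℝ) (ψ : Fin N → ℂ → ℂ)
    (φ : Fin N → ℝ) (ω : Fin N → ℂ) : Prop where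
  /-- the singular values of `H_u` are exactly the numbers `λ_n` -/
  singular_values : ∀ s : ℝ, 0 < s → (schmidt u s ≠ ⊥ ↔ ∃ n, lam n = s)
  /-- `E_{H_u}(λ_n) = p_n K_{ψ_n}` for an isometric multiplier `p_n` on `K_{ψ_n}` -/
  schmidt_eq : ∀ n, ∃ p : ℂ → ℂ, IsIsometricMultiplier p (ψ n) ∧
    (schmidt u (lam n) : Set L2) = multModel p (ψ n)
  /-- `u_n ≠ 0` and `H_u u_n = λ_n e^{iφ_n} u_n` -/
  hankel_proj : ∀ n, symbolProj u (lam n) ≠ 0 ∧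
    hankel u (symbolProj u (lam n)) =
      ((lam n : ℂ) * exp (I * φ n)) • symbolProj u (lam n)
  /-- `Ran H_u = K_θ` for a finite Blaschke product `θ` with `θ(∞) = 1`, and
  `⟨A_θ u_n, u_n⟩ = ω_n` -/
  generator_proj : ∃ (m : ℕ) (θ : ℂ → ℂ), IsFiniteBlaschke m θ ∧ IsNormalised θ ∧
    hankel u '' (hardy : Set L2) = (model θ : Set L2) ∧
    IsGenerator θ (generator θ) ∧
    ∀ n, inner ℂ (symbolProj u (lam n)) (generator θ (symbolProj u (lam n))) = ω n

/-- The element `1 - ψ` of `L²(ℝ)`. -/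
def oneSub (ψ : ℂ → ℂ) : L2 := toL2 (fun x : ℝ => 1 - ψ x)

/-- `ν_j²`, where `ν_j > 0` is determined by `4π Im ω_j = λ_j² ν_j⁴`. -/
def nuSq {N : ℕ} (lam : Fin N → ℝ) (ω : Fin N → ℂ) (j : Fin N) : ℝ :=
  Real.sqrt (4 * Real.pi * (ω j).im) / lam j

/-- The function `b_j(x)`, `x ∈ ℂ₊`. -/
def bFun {N : ℕ} (lam : Fin N → ℝ) (ψ : Fin N → ℂ → ℂ) (ω : Fin N → ℂ) (j : Fin N)
    (x : ℂ) : ℂ :=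
  1 / (nuSq lam ω j : ℂ) *
    (I * ((‖oneSub (ψ j)‖ ^ 2 / (4 * Real.pi) : ℝ) : ℂ) * ((1 + ψ j x) / (1 - ψ j x))
      + (((inner ℂ (oneSub (ψ j)) (generator (ψ j) (oneSub (ψ j))) : ℂ).re
          / ‖oneSub (ψ j)‖ ^ 2 : ℝ) : ℂ)
      - x)

/-- The matrix `𝒜`. -/
def matA {N : ℕ} (lam : Fin N → ℝ) (φ : Fin N → ℝ) (ω : Fin N → ℂ) :
    Matrix (Fin N) (Fin N) ℂ :=
  Matrix.of fun k j =>
    if k = j then ω j / (4 * Real.pi * (ω j).im)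
    else I / (2 * Real.pi) *
      (((lam j : ℂ) ^ 2 - lam j * lam k * exp (I * (φ j - φ k))) /
        ((lam j : ℂ) ^ 2 - (lam k : ℂ) ^ 2))

/-- The matrix `Q(x) = 𝒜^* - x D(ν²)⁻¹ - D(b(x))`. -/
def matQ {N : ℕ} (lam : Fin N → ℝ) (ψ : Fin N → ℂ → ℂ) (φ : Fin N → ℝ) (ω : Fin N → ℂ)
    (x : ℂ) : Matrix (Fin N) (Fin N) ℂ :=
  (matA lam φ ω)ᴴ - x • (Matrix.diagonal fun j => (nuSq lam ω j : ℂ)⁻¹)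
    - Matrix.diagonal fun j => bFun lam ψ ω j x

/-- The formula `(2πi)⁻¹ ⟨Q(x)⁻¹ D(λ) D(e^{-iφ}) 𝟙, 𝟙⟩`. -/
def symbolFormula {N : ℕ} (lam : Fin N → ℝ) (ψ : Fin N → ℂ → ℂ) (φ : Fin N → ℝ)
    (ω : Fin N → ℂ) (x : ℂ) : ℂ :=
  1 / (2 * Real.pi * I) *
    ∑ k, ((matQ lam ψ φ ω x)⁻¹ *ᵥ fun j => (lam j : ℂ) * exp (-(I * φ j))) k

end SzegoHankel

end

noncomputable section

namespace SzegoHankel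

/-! ### Elements of `L²(ℝ)` and multiplication operators -/

/-! In `matQ` the two terms in `x` cancel. Multiplying its rows by `1 - ψ_k` gives `M = D(1 - ψ) A*
- D(g / n)` with `g_j = i c_j (1 + ψ_j) + r_j (1 - ψ_j)` and `n_j = ν_j²`, which is rational up to
the real line. Write `s_j = λ_j e^{-iφ_j}`. All that is used of the matrix off its diagonal is a
pair of relations: `A - A*` has all entries `i/2π`, and `A D(s) - D(s) conj(A)` has columns `(i/2π)
s_j 𝟙`.

Invertibility of `M` (`IsLeftKernel.eq_zero`): the first relation makes the kernel equation
dissipative, which settles the open half-plane, where `|ψ_j| < 1`. On the real line dissipativity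
only gives `∑ v_j (1 - ψ_j) = 0`. There the second relation supplies an antilinear map of the kernel
to itself whose square multiplies `v_j` by `|s_j|²`. Since the `|s_j|` are distinct, a Vandermonde
argument separates the terms.

Let `P` be the row vector `-(i/2π) 𝟙ᵀ M⁻¹`, and put `q_j = P_j (1 - ψ_j)`, `u = ∑ s_j q_j`, `θ = 1 -
∑ q_j`. The first relation gives the kernel identity `sum_kernel`, which decomposes `1 - θ(z) conj
θ(w)` into the kernels of the spaces `P_j K_{ψ_j}`. Hence `θ` is unimodular on the line, so a
Blaschke product, and `K_θ` is contained in the sum of these spaces. The second relation gives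
`conj_u_mul_P`: on the line `conj(u) P_j` is a bounded analytic function minus `conj(s_j P_j ψ_j)`.
Therefore `H_u` maps `P_j f` to `-s_j P_j (ψ_j conj f)` (`H_el`), and `H_u² = λ_j²` on `P_j
K_{ψ_j}`. It also makes `conj(u) θ` analytic, whence the range of `H_u` lies in `K_θ`.

So `K_θ` is the orthogonal sum of the `P_j K_{ψ_j}`, and these are exactly the Schmidt subspaces.
Comparing reproducing kernels shows that `P_j`, divided by a constant, is an isometric multiplier
(`inner_el`). The component of `u` in the `j`-th space is `s_j q_j`, and `‖q_j‖² = ν_j²`. Finally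
the row equation reads `x q_j = const + P_j L_j + ν_j² ∑ conj(A_jk) q_k` with `P_j L_j` orthogonal
to `q_j`. It describes the adjoint generator on `K_θ`, and its diagonal part yields `ω_j`
(`inner_generator`).

The rest is the theory of `H²` and of finite-dimensional model spaces: Cauchy's theorem and formula,
closedness of `H²`, model spaces as rational functions with a fixed denominator, and the generator
acting on numerators. -/

lemma toL2_coeFn {f : ℝ → ℂ} (h : MemLp f 2 volume) : toL2 f =ᵐ[volume] f := by
  rw [toL2, dif_pos h]
  exact h.coeFn_toLp

lemma toL2_eq_of_ae {f : ℝ → ℂ} {g : L2} (h : f =ᵐ[volume] g) : toL2 f = g := by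
  have hm : MemLp f 2 volume := (memLp_congr_ae h).2 (Lp.memLp g)
  exact Lp.ext ((toL2_coeFn hm).trans h)

lemma toL2_coe (g : L2) : toL2 g = g := toL2_eq_of_ae (EventuallyEq.refl _ _)

lemma toL2_add {f g : ℝ → ℂ} (hf : MemLp f 2 volume) (hg : MemLp g 2 volume) :
    toL2 (fun x => f x + g x) = toL2 f + toL2 g := by
  refine toL2_eq_of_ae ?_
  filter_upwards [Lp.coeFn_add (toL2 f) (toL2 g), toL2_coeFn hf, toL2_coeFn hg] with x h1 h2 h3
  rw [h1, Pi.add_apply, h2, h3]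

lemma toL2_sub {f g : ℝ → ℂ} (hf : MemLp f 2 volume) (hg : MemLp g 2 volume) :
    toL2 (fun x => f x - g x) = toL2 f - toL2 g := by
  refine toL2_eq_of_ae ?_
  filter_upwards [Lp.coeFn_sub (toL2 f) (toL2 g), toL2_coeFn hf, toL2_coeFn hg] with x h1 h2 h3
  rw [h1, Pi.sub_apply, h2, h3]

lemma toL2_const_mul {f : ℝ → ℂ} (c : ℂ) (hf : MemLp f 2 volume) :
    toL2 (fun x => c * f x) = c • toL2 f := by
  refine toL2_eq_of_ae ?_
  filter_upwards [Lp.coeFn_smul c (toL2 f), toL2_coeFn hf] with x h1 h2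
  rw [h1, Pi.smul_apply, h2, smul_eq_mul]

lemma mulL2_coeFn {m : ℝ → ℂ} (hm : MemLp m ∞ (volume : Measure ℝ)) (f : L2) :
    mulL2 m f =ᵐ[volume] fun x => m x * f x := by
  rw [mulL2, dif_pos hm]
  filter_upwards [(ContinuousLinearMap.mul ℂ ℂ).coeFn_holder (r := 2) (hm.toLp m) f,
    hm.coeFn_toLp] with x h1 h2
  rw [← h2]
  exact h1

lemma memLp_top_of_continuous {m : ℝ → ℂ} (hm : Continuous m) {C : ℝ} (hC : ∀ x, ‖m x‖ ≤ C) :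
    MemLp m ∞ (volume : Measure ℝ) :=
  MeasureTheory.memLp_top_of_bound hm.aestronglyMeasurable C (Eventually.of_forall hC)

lemma mulL2_toL2 {m f : ℝ → ℂ} (hm : MemLp m ∞ (volume : Measure ℝ)) (hf : MemLp f 2 volume) :
    mulL2 m (toL2 f) = toL2 (fun x => m x * f x) := by
  refine (toL2_eq_of_ae ?_).symm
  filter_upwards [mulL2_coeFn hm (toL2 f), toL2_coeFn hf] with x h1 h2
  rw [h1, h2]

lemma norm_mulL2_le {m : ℝ → ℂ} (hm : MemLp m ∞ (volume : Measure ℝ)) {C : ℝ}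
    (hC : ∀ x, ‖m x‖ ≤ C) (f : L2) : ‖mulL2 m f‖ ≤ C * ‖f‖ := by
  refine Lp.norm_le_mul_norm_of_ae_le_mul ?_
  filter_upwards [mulL2_coeFn hm f] with x h
  rw [h, norm_mul]
  exact mul_le_mul_of_nonneg_right (hC x) (norm_nonneg _)

lemma star_coeFn (f : L2) : (star f : L2) =ᵐ[volume] fun x => starRingEnd ℂ (f x) :=
  Lp.coeFn_star f

lemma star_toL2 {f : ℝ → ℂ} (hf : MemLp f 2 volume) :
    star (toL2 f) = toL2 (fun x => starRingEnd ℂ (f x)) := by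
  refine (toL2_eq_of_ae ?_).symm
  filter_upwards [star_coeFn (toL2 f), toL2_coeFn hf] with x h1 h2
  rw [h1, h2]

lemma memLp_conj {f : ℝ → ℂ} (hf : MemLp f 2 volume) :
    MemLp (fun x => starRingEnd ℂ (f x)) 2 volume := hf.star

lemma inner_eq_integral (f g : L2) :
    inner ℂ f g = ∫ x, starRingEnd ℂ (f x) * g x := by
  rw [L2.inner_def]
  refine integral_congr_ae (Eventually.of_forall fun x => ?_)
  simp [mul_comm]

lemma inner_toL2 {f g : ℝ → ℂ} (hf : MemLp f 2 volume) (hg : MemLp g 2 volume) :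
    inner ℂ (toL2 f) (toL2 g) = ∫ x, starRingEnd ℂ (f x) * g x := by
  rw [inner_eq_integral]
  refine integral_congr_ae ?_
  filter_upwards [toL2_coeFn hf, toL2_coeFn hg] with x h1 h2
  rw [h1, h2]

lemma inner_star_eq_integral (f g : L2) :
    inner ℂ (star f) g = ∫ x, f x * g x := by
  rw [inner_eq_integral]
  refine integral_congr_ae ?_
  filter_upwards [star_coeFn f] with x h1
  rw [h1, Complex.conj_conj]

lemma norm_star_eq (f : L2) : ‖(star f : L2)‖ = ‖f‖ := by
  rw [Lp.norm_def, Lp.norm_def]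
  congr 1
  refine eLpNorm_congr_norm_ae ?_
  filter_upwards [star_coeFn f] with x h1
  rw [h1, RCLike.norm_conj]

lemma star_sub_eq (f g : L2) : star (f - g) = star f - star g := by
  refine Lp.ext ?_
  filter_upwards [star_coeFn (f - g), star_coeFn f, star_coeFn g, Lp.coeFn_sub f g,
    Lp.coeFn_sub (star f) (star g)] with x h1 h2 h3 h4 h5
  rw [h1, h4, h5, Pi.sub_apply, Pi.sub_apply, h2, h3, map_sub]

lemma continuous_star_L2 : Continuous (fun f : L2 => (star f : L2)) := by
  refine (LipschitzWith.of_dist_le_mul (K := 1) fun f g => ?_).continuous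
  rw [dist_eq_norm, dist_eq_norm, ← star_sub_eq, norm_star_eq, NNReal.coe_one, one_mul]

lemma inner_star_star (f g : L2) :
    inner ℂ (star f) (star g) = (inner ℂ g f : ℂ) := by
  rw [inner_star_eq_integral, inner_eq_integral]
  refine integral_congr_ae ?_
  filter_upwards [star_coeFn g] with x h1
  rw [h1, mul_comm]

lemma norm_sq_eq_integral (f : L2) : ‖f‖ ^ 2 = ∫ x, ‖f x‖ ^ 2 := by
  have h : ((‖f‖ ^ 2 : ℝ) : ℂ) = ((∫ x, ‖f x‖ ^ 2 : ℝ) : ℂ) := by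
    rw [← integral_complex_ofReal]
    push_cast
    refine (inner_self_eq_norm_sq_to_K (𝕜 := ℂ) f).symm.trans ?_
    rw [inner_eq_integral]
    refine integral_congr_ae (Eventually.of_forall fun x => ?_)
    simp only [RCLike.conj_mul]
    rfl
  exact_mod_cast h

/-- Dominated convergence in `L²(ℝ)`. -/
lemma tendsto_toL2 {ι : Type*} {l : Filter ι} [l.IsCountablyGenerated] [l.NeBot]
    {F : ι → ℝ → ℂ} {f : ℝ → ℂ} {B : ℝ → ℝ} (hB : MemLp B 2 volume)
    (hF : ∀ᶠ i in l, AEStronglyMeasurable (F i) volume)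
    (hb : ∀ᶠ i in l, ∀ᵐ x, ‖F i x‖ ≤ B x)
    (hlim : ∀ᵐ x, Tendsto (fun i => F i x) l (𝓝 (f x))) :
    MemLp f 2 volume ∧ Tendsto (fun i => toL2 (F i)) l (𝓝 (toL2 f)) := by
  -- A sequence along the filter is needed only for measurability of the limit and its bound, which
  -- are countable statements.
  obtain ⟨v, hv⟩ := l.exists_seq_tendsto
  have hvb : ∀ᶠ n in atTop, AEStronglyMeasurable (F (v n)) volume ∧
      ∀ᵐ x, ‖F (v n) x‖ ≤ B x := hv.eventually (hF.and hb)
  obtain ⟨n0, hn0⟩ := eventually_atTop.1 hvb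
  have hfm : AEStronglyMeasurable f volume := by
    refine aestronglyMeasurable_of_tendsto_ae atTop (f := fun n => F (v (n + n0)))
      (fun n => (hn0 _ (Nat.le_add_left _ _)).1) ?_
    filter_upwards [hlim] with x hx
    exact (hx.comp hv).comp (tendsto_add_atTop_nat n0)
  have hfb : ∀ᵐ x, ‖f x‖ ≤ B x := by
    have h1 : ∀ᵐ x, ∀ n, ‖F (v (n + n0)) x‖ ≤ B x :=
      ae_all_iff.2 fun n => (hn0 _ (Nat.le_add_left _ _)).2
    filter_upwards [hlim, h1] with x hx h1
    exact le_of_tendsto ((hx.comp hv).comp (tendsto_add_atTop_nat n0)).norm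
      (Eventually.of_forall h1)
  have hf : MemLp f 2 volume := hB.mono hfm (by
    filter_upwards [hfb] with x hx
    exact hx.trans (le_abs_self _))
  have hFi : ∀ᶠ i in l, MemLp (F i) 2 volume := by
    filter_upwards [hF, hb] with i h1 h2
    refine hB.mono h1 ?_
    filter_upwards [h2] with x hx
    exact hx.trans (le_abs_self _)
  refine ⟨hf, ?_⟩
  rw [tendsto_iff_norm_sub_tendsto_zero]
  have hsq : Tendsto (fun i => ‖toL2 (F i) - toL2 f‖ ^ 2) l (𝓝 0) := by
    have h0 : Tendsto (fun i => ∫ x, ‖F i x - f x‖ ^ 2) l (𝓝 (∫ _ : ℝ, (0 : ℝ))) := by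
      refine tendsto_integral_filter_of_dominated_convergence (fun x => (2 * B x) ^ 2) ?_ ?_ ?_ ?_
      · filter_upwards [hF] with i hi
        exact ((hi.sub hfm).norm.pow 2)
      · filter_upwards [hb] with i hi
        filter_upwards [hi, hfb] with x h1 h2
        rw [norm_pow, norm_norm]
        have := norm_sub_le (F i x) (f x)
        gcongr
        linarith
      · exact (hB.const_mul 2).integrable_sq
      · filter_upwards [hlim] with x hx
        have := ((hx.sub_const (f x)).norm).pow 2
        simpa using this
    rw [integral_zero] at h0
    refine h0.congr' ?_
    filter_upwards [hFi] with i hi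
    rw [← toL2_sub hi hf, norm_sq_eq_integral]
    refine integral_congr_ae ?_
    filter_upwards [toL2_coeFn (hi.sub hf)] with x hx
    have hx' : toL2 (fun x => F i x - f x) x = F i x - f x := hx
    rw [hx']
  have := hsq.sqrt
  simpa using this

/-! ### Slices of functions in the upper half-plane and Cauchy's theorem -/

lemma isOpen_upperHalf : IsOpen upperHalf := isOpen_lt continuous_const Complex.continuous_im

lemma upperHalf_subset_closed : upperHalf ⊆ closedUpperHalf := fun z (h : 0 < z.im) => h.le

/-- The restriction of `F` to the line `Im z = y`, as an element of `L²(ℝ)`. -/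
def slice (F : ℂ → ℂ) (y : ℝ) : L2 := toL2 (fun x : ℝ => F (x + y * I))

lemma mem_upperHalf_slice {x y : ℝ} (hy : 0 < y) : (x + y * I : ℂ) ∈ upperHalf := by
  simp [upperHalf, hy]

lemma HasBoundaryValue.memLp_slice {F : ℂ → ℂ} {f : L2} (h : HasBoundaryValue F f) {y : ℝ}
    (hy : 0 < y) : MemLp (fun x : ℝ => F (x + y * I)) 2 volume := by
  obtain ⟨C, hC⟩ := h.2.1
  exact ⟨aesm_slice h.1 hy, (hC y hy).trans_lt ENNReal.coe_lt_top⟩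

lemma norm_slice {F : ℂ → ℂ} {y : ℝ} (h : MemLp (fun x : ℝ => F (x + y * I)) 2 volume) :
    ‖slice F y‖ = (eLpNorm (fun x : ℝ => F (x + y * I)) 2 volume).toReal := by
  rw [Lp.norm_def, slice, eLpNorm_congr_ae (toL2_coeFn h)]

lemma HasBoundaryValue.exists_norm_slice_le {F : ℂ → ℂ} {f : L2} (h : HasBoundaryValue F f) :
    ∃ C : ℝ, 0 ≤ C ∧ ∀ y : ℝ, 0 < y → ‖slice F y‖ ≤ C := by
  obtain ⟨C, hC⟩ := h.2.1
  refine ⟨C, C.2, fun y hy => ?_⟩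
  rw [norm_slice (h.memLp_slice hy)]
  exact ENNReal.toReal_mono ENNReal.coe_ne_top (hC y hy)

lemma HasBoundaryValue.tendsto_slice {F : ℂ → ℂ} {f : L2} (h : HasBoundaryValue F f) :
    Tendsto (slice F) (𝓝[>] 0) (𝓝 f) := by
  rw [Lp.tendsto_Lp_iff_tendsto_eLpNorm']
  refine h.2.2.congr' ?_
  filter_upwards [self_mem_nhdsWithin] with y hy
  refine eLpNorm_congr_ae ?_
  filter_upwards [toL2_coeFn (h.memLp_slice hy)] with x hx
  rw [Pi.sub_apply, slice, hx]

lemma hasBoundaryValue_of_slice {F : ℂ → ℂ} {f : L2} (hF : DifferentiableOn ℂ F upperHalf)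
    (hm : ∀ y : ℝ, 0 < y → MemLp (fun x : ℝ => F (x + y * I)) 2 volume)
    {C : ℝ} (hC : ∀ y : ℝ, 0 < y → ‖slice F y‖ ≤ C)
    (ht : Tendsto (slice F) (𝓝[>] 0) (𝓝 f)) : HasBoundaryValue F f := by
  refine ⟨hF, ⟨C.toNNReal, fun y hy => ?_⟩, ?_⟩
  · have h := hC y hy
    rw [norm_slice (hm y hy)] at h
    exact (ENNReal.le_ofReal_iff_toReal_le (hm y hy).2.ne
      (ENNReal.toReal_nonneg.trans h)).2 h
  · rw [Lp.tendsto_Lp_iff_tendsto_eLpNorm'] at ht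
    refine ht.congr' ?_
    filter_upwards [self_mem_nhdsWithin] with y hy
    refine eLpNorm_congr_ae ?_
    filter_upwards [toL2_coeFn (hm y hy)] with x hx
    rw [Pi.sub_apply, slice, hx]

lemma lintegral_slice {F : ℂ → ℂ} {y : ℝ} (h : MemLp (fun x : ℝ => F (x + y * I)) 2 volume) :
    ∫⁻ x : ℝ, ENNReal.ofReal (‖F (x + y * I)‖ ^ 2) = ENNReal.ofReal (‖slice F y‖ ^ 2) := by
  rw [norm_sq_eq_integral, ofReal_integral_eq_lintegral_ofReal]
  · refine lintegral_congr_ae ?_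
    filter_upwards [toL2_coeFn h] with x hx
    rw [slice, hx]
  · exact (Lp.memLp (slice F y)).norm.integrable_sq
  · exact Eventually.of_forall fun x => by positivity

/-- The integral of a holomorphic function over horizontal lines does not depend on the line,
provided the function is integrable over the ends of the strip. -/
lemma integral_line_eq {H : ℂ → ℂ} {Φ : ℂ → ℝ} (hH : DifferentiableOn ℂ H upperHalf)
    (hΦ : ContinuousOn Φ upperHalf) {C : ℝ≥0∞} (hC : C ≠ ∞) {y₁ y₂ R₀ : ℝ} (hy₁ : 0 < y₁)
    (hy : y₁ < y₂)
    (hΦC : ∀ y, y₁ ≤ y → y ≤ y₂ → ∫⁻ x : ℝ, ENNReal.ofReal (Φ (x + y * I)) ≤ C)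
    (hb : ∀ x y : ℝ, R₀ ≤ |x| → y₁ ≤ y → y ≤ y₂ → ‖H (x + y * I)‖ ≤ Φ (x + y * I))
    (h₁ : Integrable (fun x : ℝ => H (x + y₁ * I)))
    (h₂ : Integrable (fun x : ℝ => H (x + y₂ * I))) :
    ∫ x : ℝ, H (x + y₁ * I) = ∫ x : ℝ, H (x + y₂ * I) := by
  set ν : Measure ℝ := volume.restrict (Set.Icc y₁ y₂) with hν
  set f : ℝ → ℝ → ℝ≥0∞ := fun x y => ENNReal.ofReal (Φ (x + y * I)) with hf
  have hmeas : AEMeasurable (Function.uncurry f) ((volume : Measure ℝ).prod ν) := by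
    have h0 : ContinuousOn (fun p : ℝ × ℝ => Φ (p.1 + p.2 * I)) (Set.univ ×ˢ Set.Icc y₁ y₂) := by
      refine hΦ.comp (by fun_prop) fun p hp => ?_
      exact mem_upperHalf_slice (hy₁.trans_le hp.2.1)
    have h1 := h0.aemeasurable (μ := (volume : Measure ℝ).prod volume)
      (MeasurableSet.univ.prod measurableSet_Icc)
    rw [← Measure.prod_restrict, Measure.restrict_univ] at h1
    exact h1.ennreal_ofReal
  -- `Ψ R` bounds the integral of `H` over the vertical side at abscissa `R`. By Tonelli `Ψ` is
  -- integrable over the whole line.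
  set Ψ : ℝ → ℝ≥0∞ := fun x => ∫⁻ y, f x y ∂ν with hΨ
  have hΨm : AEMeasurable Ψ volume := hmeas.lintegral_prod_right'
  have hΨi : ∫⁻ x, Ψ x ≠ ∞ := by
    have e : ∫⁻ x, Ψ x = ∫⁻ y, (∫⁻ x, f x y) ∂ν := lintegral_lintegral_swap hmeas
    have e2 : ∫⁻ y, (∫⁻ x, f x y) ∂ν ≤ ∫⁻ _, C ∂ν := by
      refine lintegral_mono_ae ?_
      rw [hν]
      refine (ae_restrict_iff' measurableSet_Icc).2 (Eventually.of_forall fun y hy => ?_)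
      exact hΦC y hy.1 hy.2
    rw [e]
    refine (e2.trans_lt ?_).ne
    rw [lintegral_const, hν, Measure.restrict_apply_univ, Real.volume_Icc]
    exact ENNReal.mul_lt_top hC.lt_top ENNReal.ofReal_lt_top
  set V : ℝ → ℂ := fun R => (∫ t in y₁..y₂, H (R + t * I)) - ∫ t in y₁..y₂, H ((-R : ℝ) + t * I)
    with hV
  have hVb1 : ∀ R : ℝ, R₀ ≤ |R| → ‖∫ t in y₁..y₂, H (R + t * I)‖ₑ ≤ Ψ R := by
    intro R hR
    rw [intervalIntegral.integral_of_le hy.le]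
    refine (enorm_integral_le_lintegral_enorm _).trans ?_
    refine (lintegral_mono_set Set.Ioc_subset_Icc_self).trans ?_
    refine setLIntegral_mono' measurableSet_Icc fun t ht => ?_
    rw [← ofReal_norm]
    exact ENNReal.ofReal_le_ofReal (hb R t hR ht.1 ht.2)
  have hVb : ∀ R : ℝ, R₀ ≤ |R| → ‖V R‖ₑ ≤ Ψ R + Ψ (-R) := by
    intro R hR
    refine (enorm_sub_le).trans (add_le_add (hVb1 R hR) (hVb1 (-R) (by rwa [abs_neg])))
  have hrect : ∀ R : ℝ, V R = I * ((∫ x in (-R)..R, H (x + y₁ * I))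
      - ∫ x in (-R)..R, H (x + y₂ * I)) := by
    intro R
    have h := integral_boundary_rect_eq_zero_of_differentiableOn H ((-R : ℝ) + y₁ * I)
      (R + y₂ * I) (hH.mono ?_)
    · simp only [add_re, ofReal_re, mul_re, I_re, mul_zero, ofReal_im, I_im, mul_one, sub_self,
        add_zero, add_im, mul_im, zero_add, smul_eq_mul] at h
      rw [hV]
      linear_combination (-I) * h + ((∫ t in y₁..y₂, H (R + t * I))
        - ∫ t in y₁..y₂, H ((-R : ℝ) + t * I)) * I_mul_I
    · intro z hz
      have := hz.2
      simp only [add_im, ofReal_im, mul_im, ofReal_re, I_im, mul_one, I_re, mul_zero, add_zero,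
        zero_add, Set.mem_preimage, Set.uIcc_of_le hy.le] at this
      exact hy₁.trans_le this.1
  have hlim : Tendsto V atTop (𝓝 (I * ((∫ x : ℝ, H (x + y₁ * I)) - ∫ x : ℝ, H (x + y₂ * I)))) := by
    refine (((intervalIntegral_tendsto_integral h₁ tendsto_neg_atTop_atBot tendsto_id).sub
      (intervalIntegral_tendsto_integral h₂ tendsto_neg_atTop_atBot tendsto_id)).const_mul
        I).congr fun R => ?_
    rw [hrect R]
    simp
  -- Up to a factor `i`, the vertical sides converge to the difference of the two line integrals. If
  -- this were non-zero, the integrable function `Ψ(R) + Ψ(-R)` would stay above a positive constant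
  -- for all large `R`.
  by_contra hne
  set L := I * ((∫ x : ℝ, H (x + y₁ * I)) - ∫ x : ℝ, H (x + y₂ * I)) with hL
  have hLpos : 0 < ‖L‖ := by
    rw [norm_pos_iff, hL]
    exact mul_ne_zero I_ne_zero (sub_ne_zero.2 hne)
  have hev : ∀ᶠ R in atTop, ENNReal.ofReal (‖L‖ / 2) ≤ Ψ R + Ψ (-R) := by
    filter_upwards [hlim.norm.eventually (lt_mem_nhds (half_lt_self hLpos)),
      eventually_ge_atTop (max R₀ 0)] with R h1 h2
    refine le_trans ?_ (hVb R ?_)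
    · rw [← ofReal_norm]
      exact ENNReal.ofReal_le_ofReal h1.le
    · exact (le_max_left _ _).trans (h2.trans (le_abs_self R))
  obtain ⟨R₁, hR₁⟩ := eventually_atTop.1 hev
  have hneg : ∫⁻ x, Ψ (-x) = ∫⁻ x, Ψ x := by
    exact lintegral_neg_eq_self Ψ
  have htop : ∫⁻ x, (Ψ x + Ψ (-x)) = ∞ := by
    refine top_le_iff.1 ?_
    calc (∞ : ℝ≥0∞) = ∫⁻ _ in Set.Ici R₁, ENNReal.ofReal (‖L‖ / 2) := by
          rw [lintegral_const, Measure.restrict_apply_univ, Real.volume_Ici,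
            ENNReal.mul_top]
          simpa using hLpos
      _ ≤ ∫⁻ x in Set.Ici R₁, (Ψ x + Ψ (-x)) :=
          setLIntegral_mono' measurableSet_Ici fun x hx => hR₁ x hx
      _ ≤ ∫⁻ x, (Ψ x + Ψ (-x)) := setLIntegral_le_lintegral _ _
  rw [lintegral_add_left' hΨm, hneg] at htop
  exact (ENNReal.add_ne_top.2 ⟨hΨi, hΨi⟩) htop

lemma inner_star_toL2 {a b : ℝ → ℂ} (ha : MemLp a 2 volume) (hb : MemLp b 2 volume) :
    inner ℂ (star (toL2 a)) (toL2 b) = ∫ x, a x * b x := by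
  rw [inner_star_eq_integral]
  refine integral_congr_ae ?_
  filter_upwards [toL2_coeFn ha, toL2_coeFn hb] with x h1 h2
  rw [h1, h2]

/-- Cauchy's theorem for the product of a function in `H²` and a function `G` which is
square-integrable on low and on high horizontal lines, where the product continues
holomorphically across the remaining strip. -/
lemma inner_star_eq_zero_of_slices {F G G' H : ℂ → ℂ} {f g : L2} (hF : HasBoundaryValue F f)
    (hH : DifferentiableOn ℂ H upperHalf) {δ Y R₀ C : ℝ} (hδ : 0 < δ) (hδY : δ ≤ Y)
    (hG : ∀ y : ℝ, 0 < y → y < δ ∨ Y < y → MemLp (fun x : ℝ => G (x + y * I)) 2 volume)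
    (hG0 : Tendsto (slice G) (𝓝[>] 0) (𝓝 g))
    (hGt : Tendsto (fun y => ‖slice G y‖) atTop (𝓝 0))
    (hHG : ∀ x y : ℝ, 0 < y → y < δ ∨ Y < y → H (x + y * I) = F (x + y * I) * G (x + y * I))
    (hG'c : ContinuousOn G' upperHalf)
    (hG'm : ∀ y : ℝ, 0 < y → MemLp (fun x : ℝ => G' (x + y * I)) 2 volume)
    (hG'C : ∀ y : ℝ, 0 < y → ‖slice G' y‖ ≤ C)
    (hHb : ∀ x y : ℝ, R₀ ≤ |x| → 0 < y →
      ‖H (x + y * I)‖ ≤ ‖F (x + y * I)‖ * ‖G' (x + y * I)‖) :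
    inner ℂ (star f) g = 0 := by
  obtain ⟨D, hD0, hD⟩ := hF.exists_norm_slice_le
  set φ : ℝ → ℂ := fun y => inner ℂ (star (slice F y)) (slice G y) with hφ
  have hφH : ∀ y : ℝ, 0 < y → y < δ ∨ Y < y → φ y = ∫ x : ℝ, H (x + y * I) := by
    intro y hy hy'
    rw [hφ]
    simp only
    rw [slice, slice, inner_star_toL2 (hF.memLp_slice hy) (hG y hy hy')]
    exact integral_congr_ae (Eventually.of_forall fun x => (hHG x y hy hy').symm)
  have hHi : ∀ y : ℝ, 0 < y → y < δ ∨ Y < y → Integrable (fun x : ℝ => H (x + y * I)) := by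
    intro y hy hy'
    refine ((hF.memLp_slice hy).integrable_mul (hG y hy hy')).congr ?_
    exact Eventually.of_forall fun x => (hHG x y hy hy').symm
  -- Only a low line and a high line are compared, because the slices of `G` need not be
  -- square-integrable in between. There `G'` takes over, and only for large `|x|`.
  have hconst : ∀ y₁ y₂ : ℝ, 0 < y₁ → y₁ < δ → Y < y₂ → φ y₁ = φ y₂ := by
    intro y₁ y₂ h1 h2 h3
    have h4 : y₁ < y₂ := h2.trans_le (hδY.trans h3.le)
    rw [hφH y₁ h1 (Or.inl h2), hφH y₂ (h1.trans h4) (Or.inr h3)]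
    refine integral_line_eq (Φ := fun z => ‖F z‖ ^ 2 + ‖G' z‖ ^ 2)
      (C := ENNReal.ofReal (D ^ 2) + ENNReal.ofReal (C ^ 2)) (R₀ := R₀) hH
      ((hF.1.continuousOn.norm.pow 2).add (hG'c.norm.pow 2))
      (by simp) h1 h4 ?_ ?_ (hHi y₁ h1 (Or.inl h2)) (hHi y₂ (h1.trans h4) (Or.inr h3))
    · intro y hy1 _
      have hy : 0 < y := h1.trans_le hy1
      have e : ∀ x : ℝ, ENNReal.ofReal (‖F (x + y * I)‖ ^ 2 + ‖G' (x + y * I)‖ ^ 2)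
          = ENNReal.ofReal (‖F (x + y * I)‖ ^ 2) + ENNReal.ofReal (‖G' (x + y * I)‖ ^ 2) :=
        fun x => ENNReal.ofReal_add (by positivity) (by positivity)
      simp only [e]
      have hm : AEMeasurable (fun x : ℝ => ENNReal.ofReal (‖F (x + y * I)‖ ^ 2)) volume :=
        ((hF.memLp_slice hy).1.norm.pow 2).aemeasurable.ennreal_ofReal
      rw [lintegral_add_left' hm, lintegral_slice (hF.memLp_slice hy), lintegral_slice (hG'm y hy)]
      refine add_le_add (ENNReal.ofReal_le_ofReal ?_) (ENNReal.ofReal_le_ofReal ?_)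
      · have := hD y hy
        gcongr
      · have := hG'C y hy
        gcongr
    · intro x y hx hy1 _
      refine (hHb x y hx (h1.trans_le hy1)).trans ?_
      nlinarith [sq_nonneg (‖F (x + y * I)‖ - ‖G' (x + y * I)‖), norm_nonneg (F (x + y * I)),
        norm_nonneg (G' (x + y * I)), sq_nonneg (‖F (x + y * I)‖), sq_nonneg (‖G' (x + y * I)‖)]
  have htop : Tendsto φ atTop (𝓝 0) := by
    refine squeeze_zero_norm' (a := fun y => D * ‖slice G y‖) ?_ (by simpa using hGt.const_mul D)
    filter_upwards [eventually_gt_atTop 0] with y hy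
    refine (norm_inner_le_norm _ _).trans ?_
    rw [norm_star_eq]
    exact mul_le_mul_of_nonneg_right (hD y hy) (norm_nonneg _)
  have hzero : ∀ y : ℝ, 0 < y → y < δ → φ y = 0 := by
    intro y h1 h2
    refine tendsto_nhds_unique (f := fun _ : ℝ => φ y) (l := atTop) tendsto_const_nhds ?_
    refine htop.congr' ?_
    filter_upwards [eventually_gt_atTop Y] with y₂ h3
    exact (hconst y y₂ h1 h2 h3).symm
  have hlim : Tendsto φ (𝓝[>] 0) (𝓝 (inner ℂ (star f) g)) :=
    ((continuous_star_L2.tendsto f).comp hF.tendsto_slice).inner hG0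
  refine tendsto_nhds_unique hlim ?_
  refine tendsto_const_nhds.congr' ?_
  filter_upwards [Ioo_mem_nhdsGT hδ] with y hy
  exact (hzero y hy.1 hy.2).symm

/-! ### Bounded holomorphic functions as multipliers of the Hardy space -/

/-- Functions that are bounded and continuous in the closed upper half-plane and holomorphic
in its interior. -/
structure BddHol (p : ℂ → ℂ) : Prop where
  cont : ContinuousOn p closedUpperHalf
  diff : DifferentiableOn ℂ p upperHalf
  bdd : ∃ C : ℝ, ∀ z ∈ closedUpperHalf, ‖p z‖ ≤ C

lemma ofReal_mem_closed (x : ℝ) : (x : ℂ) ∈ closedUpperHalf := by simp [closedUpperHalf]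

lemma continuous_slice_of_continuousOn {p : ℂ → ℂ} (hp : ContinuousOn p closedUpperHalf) {y : ℝ}
    (hy : 0 ≤ y) : Continuous (fun x : ℝ => p (x + y * I)) :=
  hp.comp_continuous (by fun_prop) fun x => by simp [closedUpperHalf, hy]

lemma continuous_real_of_continuousOn {p : ℂ → ℂ} (hp : ContinuousOn p closedUpperHalf) :
    Continuous (fun x : ℝ => p x) :=
  hp.comp_continuous (by fun_prop) ofReal_mem_closed

lemma tendsto_slice_apply {p : ℂ → ℂ} (hp : ContinuousOn p closedUpperHalf) (x : ℝ) :
    Tendsto (fun y : ℝ => p (x + y * I)) (𝓝[>] 0) (𝓝 (p x)) := by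
  have h1 : Tendsto (fun y : ℝ => (x + y * I : ℂ)) (𝓝[>] 0) (𝓝[closedUpperHalf] (x : ℂ)) := by
    refine tendsto_nhdsWithin_iff.2 ⟨?_, ?_⟩
    · have h : Continuous (fun y : ℝ => (x + y * I : ℂ)) := by fun_prop
      have := (h.tendsto 0).mono_left (nhdsWithin_le_nhds (s := Set.Ioi 0))
      simpa using this
    · filter_upwards [self_mem_nhdsWithin] with y hy
      exact upperHalf_subset_closed (mem_upperHalf_slice hy)
  exact (hp x (ofReal_mem_closed x)).tendsto.comp h1

lemma BddHol.memLp_real {p : ℂ → ℂ} (hp : BddHol p) :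
    MemLp (fun x : ℝ => p x) ∞ (volume : Measure ℝ) := by
  obtain ⟨C, hC⟩ := hp.bdd
  exact memLp_top_of_continuous (continuous_real_of_continuousOn hp.cont)
    fun x => hC x (ofReal_mem_closed x)

lemma HasBoundaryValue.congr {F G : ℂ → ℂ} {f : L2} (hF : HasBoundaryValue F f)
    (h : ∀ z ∈ upperHalf, F z = G z) : HasBoundaryValue G f := by
  obtain ⟨h1, ⟨C, hC⟩, h3⟩ := hF
  have e : ∀ y : ℝ, 0 < y → ∀ x : ℝ, F (x + y * I) = G (x + y * I) :=
    fun y hy x => h _ (mem_upperHalf_slice hy)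
  refine ⟨h1.congr fun z hz => (h z hz).symm, ⟨C, fun y hy => ?_⟩, ?_⟩
  · simpa only [e y hy] using hC y hy
  · refine h3.congr' ?_
    filter_upwards [self_mem_nhdsWithin] with y hy
    simp only [e y hy]

/-- With subscripts for slices, `p_y F_y - p f = p_y (F_y - f) + (p_y - p) f`. The first term is
small because `p` is bounded, the second by dominated convergence. -/
lemma HasBoundaryValue.bddHol_mul {p F : ℂ → ℂ} {f : L2} (hF : HasBoundaryValue F f)
    (hp : BddHol p) :
    HasBoundaryValue (fun z => p z * F z) (mulL2 (fun x : ℝ => p x) f) := by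
  obtain ⟨C, hC⟩ := hp.bdd
  obtain ⟨D, hD0, hD⟩ := hF.exists_norm_slice_le
  have hpm : ∀ y : ℝ, 0 < y → MemLp (fun x : ℝ => p (x + y * I)) ∞ (volume : Measure ℝ) :=
    fun y hy => memLp_top_of_continuous (continuous_slice_of_continuousOn hp.cont hy.le)
      fun x => hC _ (upperHalf_subset_closed (mem_upperHalf_slice hy))
  have hpC : ∀ y : ℝ, 0 < y → ∀ x : ℝ, ‖p (x + y * I)‖ ≤ C :=
    fun y hy x => hC _ (upperHalf_subset_closed (mem_upperHalf_slice hy))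
  have hsl : ∀ y : ℝ, 0 < y →
      slice (fun z => p z * F z) y = mulL2 (fun x : ℝ => p (x + y * I)) (slice F y) :=
    fun y hy => (mulL2_toL2 (hpm y hy) (hF.memLp_slice hy)).symm
  have hC0 : 0 ≤ C := (norm_nonneg _).trans (hC 0 (by simp [closedUpperHalf]))
  refine hasBoundaryValue_of_slice (hp.diff.mul hF.1)
    (fun y hy => (hF.memLp_slice hy).mul (hpm y hy)) (C := C * D) (fun y hy => ?_) ?_
  · rw [hsl y hy]
    refine (norm_mulL2_le (hpm y hy) (hpC y hy) _).trans ?_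
    exact mul_le_mul_of_nonneg_left (hD y hy) hC0
  · have h1 : Tendsto (fun y : ℝ => mulL2 (fun x : ℝ => p (x + y * I)) (slice F y - f)) (𝓝[>] 0)
        (𝓝 0) := by
      refine squeeze_zero_norm' (a := fun y => C * ‖slice F y - f‖) ?_ ?_
      · filter_upwards [self_mem_nhdsWithin] with y hy
        exact norm_mulL2_le (hpm y hy) (hpC y hy) _
      · have := (tendsto_iff_norm_sub_tendsto_zero.1 hF.tendsto_slice).const_mul C
        simpa using this
    have h2 : Tendsto (fun y : ℝ => mulL2 (fun x : ℝ => p (x + y * I)) f) (𝓝[>] 0)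
        (𝓝 (mulL2 (fun x : ℝ => p x) f)) := by
      have h3 := (tendsto_toL2 (l := 𝓝[>] (0 : ℝ)) (F := fun y x => p (x + y * I) * f x)
        (f := fun x => p x * f x) (B := fun x => C * ‖f x‖)
        ((Lp.memLp f).norm.const_mul C) ?_ ?_ ?_).2
      · have e : toL2 (fun x : ℝ => p x * f x) = mulL2 (fun x : ℝ => p x) f :=
          toL2_eq_of_ae (mulL2_coeFn hp.memLp_real f).symm
        rw [e] at h3
        refine h3.congr' ?_
        filter_upwards [self_mem_nhdsWithin] with y hy
        exact toL2_eq_of_ae (mulL2_coeFn (hpm y hy) f).symm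
      · filter_upwards [self_mem_nhdsWithin] with y hy
        exact (hpm y hy).1.mul (Lp.aestronglyMeasurable f)
      · filter_upwards [self_mem_nhdsWithin] with y hy
        refine Eventually.of_forall fun x => ?_
        rw [norm_mul]
        exact mul_le_mul_of_nonneg_right (hpC y hy x) (norm_nonneg _)
      · exact Eventually.of_forall fun x => (tendsto_slice_apply hp.cont x).mul_const _
    have h4 := h1.add h2
    rw [zero_add] at h4
    refine h4.congr' ?_
    filter_upwards [self_mem_nhdsWithin] with y hy
    rw [hsl y hy, map_sub, sub_add_cancel]

lemma bddHol_mul_mem_hardy {p : ℂ → ℂ} (hp : BddHol p) {f : L2} (hf : f ∈ hardy) :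
    mulL2 (fun x : ℝ => p x) f ∈ hardy := by
  obtain ⟨F, hF⟩ := hf
  exact ⟨_, hF.bddHol_mul hp⟩

/-! ### The Cauchy kernel, uniqueness of extensions and closedness of `H²` -/

lemma integrable_inv_sq_add_sq (a : ℝ) {b : ℝ} (hb : b ≠ 0) :
    Integrable (fun x : ℝ => ((x - a) ^ 2 + b ^ 2)⁻¹) := by
  have h := ((integrable_inv_one_add_sq.comp_div hb).comp_sub_right a).const_mul ((b ^ 2)⁻¹)
  refine h.congr (Eventually.of_forall fun x => ?_)
  simp only
  rw [← mul_inv]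
  congr 1
  field_simp
  ring

lemma integral_inv_sq_add_sq (a : ℝ) {b : ℝ} (hb : b ≠ 0) :
    ∫ x : ℝ, ((x - a) ^ 2 + b ^ 2)⁻¹ = Real.pi / |b| := by
  have e : ∀ x : ℝ, ((x - a) ^ 2 + b ^ 2)⁻¹ = (b ^ 2)⁻¹ * (1 + ((x - a) / b) ^ 2)⁻¹ := by
    intro x
    rw [← mul_inv]
    congr 1
    field_simp
    ring
  simp only [e]
  rw [integral_const_mul, integral_sub_right_eq_self (fun x => (1 + (x / b) ^ 2)⁻¹) a,
    Measure.integral_comp_div (fun x => (1 + x ^ 2)⁻¹) b, integral_univ_inv_one_add_sq,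
    ← sq_abs b, smul_eq_mul]
  have : |b| ≠ 0 := abs_ne_zero.2 hb
  field_simp

lemma norm_inv_sub_sq (c : ℂ) (x : ℝ) :
    ‖((x : ℂ) - c)⁻¹‖ ^ 2 = ((x - c.re) ^ 2 + c.im ^ 2)⁻¹ := by
  rw [norm_inv, inv_pow, ← Complex.normSq_eq_norm_sq, Complex.normSq_apply]
  congr 1
  simp
  ring

lemma ofReal_sub_ne_zero {c : ℂ} (hc : c.im ≠ 0) (x : ℝ) : (x : ℂ) - c ≠ 0 := by
  intro h
  apply hc
  have := congrArg Complex.im h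
  simpa using this

lemma continuous_inv_sub {c : ℂ} (hc : c.im ≠ 0) : Continuous (fun x : ℝ => ((x : ℂ) - c)⁻¹) :=
  Continuous.inv₀ (by fun_prop) (ofReal_sub_ne_zero hc)

lemma memLp_inv_sub {c : ℂ} (hc : c.im ≠ 0) :
    MemLp (fun x : ℝ => ((x : ℂ) - c)⁻¹) 2 volume := by
  refine (memLp_two_iff_integrable_sq_norm (continuous_inv_sub hc).aestronglyMeasurable).2 ?_
  simp only [norm_inv_sub_sq]
  exact integrable_inv_sq_add_sq _ hc

lemma norm_toL2_sq {f : ℝ → ℂ} (hf : MemLp f 2 volume) : ‖toL2 f‖ ^ 2 = ∫ x, ‖f x‖ ^ 2 := by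
  rw [norm_sq_eq_integral]
  refine integral_congr_ae ?_
  filter_upwards [toL2_coeFn hf] with x hx
  rw [hx]

lemma norm_inv_sub {c : ℂ} (hc : c.im ≠ 0) :
    ‖toL2 (fun x : ℝ => ((x : ℂ) - c)⁻¹)‖ ^ 2 = Real.pi / |c.im| := by
  rw [norm_toL2_sq (memLp_inv_sub hc)]
  simp only [norm_inv_sub_sq]
  exact integral_inv_sq_add_sq _ hc

/-! ### Functions decaying like 1/|z| and their boundary values -/

/-- Continuous functions in the closed upper half-plane, holomorphic in its interior, that are
`O(1/|z|)` at infinity. -/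
structure Decaying (p : ℂ → ℂ) : Prop where
  cont : ContinuousOn p closedUpperHalf
  diff : DifferentiableOn ℂ p upperHalf
  bdd : ∃ C : ℝ, ∀ z ∈ closedUpperHalf, ‖p z‖ * ‖z + I‖ ≤ C

lemma one_le_norm_add_I {z : ℂ} (hz : z ∈ closedUpperHalf) : 1 ≤ ‖z + I‖ := by
  have hz' : 0 ≤ z.im := hz
  have h := Complex.abs_im_le_norm (z + I)
  rw [add_im, I_im, abs_of_nonneg (by linarith)] at h
  linarith

lemma add_I_ne_zero {z : ℂ} (hz : z ∈ closedUpperHalf) : z + I ≠ 0 := by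
  intro h
  have := one_le_norm_add_I hz
  rw [h, norm_zero] at this
  linarith

lemma Decaying.bddHol {p : ℂ → ℂ} (hp : Decaying p) : BddHol p := by
  obtain ⟨C, hC⟩ := hp.bdd
  refine ⟨hp.cont, hp.diff, C, fun z hz => ?_⟩
  exact (le_mul_of_one_le_right (norm_nonneg _) (one_le_norm_add_I hz)).trans (hC z hz)

lemma Decaying.mul_add_I {p : ℂ → ℂ} (hp : Decaying p) : BddHol (fun z => p z * (z + I)) := by
  obtain ⟨C, hC⟩ := hp.bdd
  refine ⟨hp.cont.mul (by fun_prop), hp.diff.mul (by fun_prop), C, fun z hz => ?_⟩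
  rw [norm_mul]
  exact hC z hz

lemma decaying_inv_sub {c : ℂ} (hc : c.im < 0) : Decaying (fun z => (z - c)⁻¹) := by
  have hne : ∀ z ∈ closedUpperHalf, z - c ≠ 0 := by
    intro z hz h
    have hz' : 0 ≤ z.im := hz
    have := congrArg Complex.im h
    rw [sub_im, zero_im] at this
    linarith
  refine ⟨ContinuousOn.inv₀ (by fun_prop) hne, DifferentiableOn.inv (by fun_prop)
    fun z hz => hne z (upperHalf_subset_closed hz), 1 + ‖c + I‖ / (-c.im), fun z hz => ?_⟩
  have hz' : 0 ≤ z.im := hz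
  have h1 : -c.im ≤ ‖z - c‖ := by
    have h := Complex.abs_im_le_norm (z - c)
    rw [sub_im, abs_of_nonneg (by linarith)] at h
    linarith
  have h2 : ‖z + I‖ ≤ ‖z - c‖ + ‖c + I‖ := by
    have := norm_add_le (z - c) (c + I)
    rwa [show z - c + (c + I) = z + I by ring] at this
  have h3 : 0 < ‖z - c‖ := norm_pos_iff.2 (hne z hz)
  rw [norm_inv, inv_mul_le_iff₀ h3]
  have h4 : ‖c + I‖ ≤ ‖z - c‖ * (‖c + I‖ / (-c.im)) := by
    rw [mul_div_assoc', le_div_iff₀ (by linarith), mul_comm]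
    exact mul_le_mul_of_nonneg_right h1 (norm_nonneg _)
  nlinarith

/-- The model case: every decaying `p` is the bounded holomorphic function `p(z) (z + i)` times this
one. -/
lemma hasBoundaryValue_inv_add_I :
    HasBoundaryValue (fun z => (z + I)⁻¹) (toL2 fun x : ℝ => ((x : ℂ) + I)⁻¹) := by
  have hd := decaying_inv_sub (c := -I) (by simp)
  simp only [sub_neg_eq_add] at hd
  have hm0 : MemLp (fun x : ℝ => ((x : ℂ) + I)⁻¹) 2 volume := by
    have := memLp_inv_sub (c := -I) (by simp)
    simpa only [sub_neg_eq_add] using this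
  have e : ∀ x y : ℝ, ((x : ℂ) + y * I + I)⁻¹ = ((x : ℂ) - (-((1 + y : ℝ) * I)))⁻¹ := by
    intro x y
    push_cast
    congr 1
    ring
  have him : ∀ y : ℝ, (-((1 + y : ℝ) * I) : ℂ).im = -(1 + y) := by
    intro y
    simp
  refine hasBoundaryValue_of_slice (C := Real.sqrt Real.pi) hd.diff (fun y hy => ?_)
    (fun y hy => ?_) ?_
  · simp only [e]
    exact memLp_inv_sub (by rw [him]; linarith)
  · refine Real.le_sqrt_of_sq_le ?_
    rw [slice]
    simp only [e]
    rw [norm_inv_sub (by rw [him]; linarith), him, abs_neg, abs_of_pos (by linarith)]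
    exact div_le_self Real.pi_pos.le (by linarith)
  · refine (tendsto_toL2 (l := 𝓝[>] (0 : ℝ)) (F := fun y x => ((x : ℂ) + y * I + I)⁻¹)
      hm0.norm ?_ ?_ ?_).2
    · filter_upwards [self_mem_nhdsWithin] with y hy
      have hy' : (0 : ℝ) < y := hy
      simp only [e]
      exact (memLp_inv_sub (by rw [him]; linarith)).1
    · filter_upwards [self_mem_nhdsWithin] with y hy
      have hy' : (0 : ℝ) < y := hy
      refine Eventually.of_forall fun x => ?_
      have hsq : ‖((x : ℂ) + y * I + I)⁻¹‖ ^ 2 ≤ ‖((x : ℂ) + I)⁻¹‖ ^ 2 := by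
        have h2 := norm_inv_sub_sq (-I) x
        rw [sub_neg_eq_add] at h2
        rw [e, norm_inv_sub_sq, h2, him]
        simp only [neg_re, mul_re, ofReal_re, I_re, mul_zero, ofReal_im, I_im, mul_one, sub_self,
          neg_zero, sub_zero, neg_im, even_two, Even.neg_pow, one_pow]
        gcongr
        nlinarith
      exact le_of_sq_le_sq hsq (norm_nonneg _)
    · exact Eventually.of_forall fun x => tendsto_slice_apply hd.cont x

lemma Decaying.memLp {p : ℂ → ℂ} (hp : Decaying p) : MemLp (fun x : ℝ => p x) 2 volume := by
  have hm0 : MemLp (fun x : ℝ => ((x : ℂ) + I)⁻¹) 2 volume := by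
    have := memLp_inv_sub (c := -I) (by simp)
    simpa only [sub_neg_eq_add] using this
  have h := hm0.mul (r := 2) hp.mul_add_I.memLp_real
  refine h.ae_eq (Eventually.of_forall fun x => ?_)
  have := add_I_ne_zero (ofReal_mem_closed x)
  simp only [Pi.mul_apply]
  field_simp

/-- The boundary value in `L²(ℝ)` of a function on the closed upper half-plane. -/
def bv (F : ℂ → ℂ) : L2 := toL2 (fun x : ℝ => F x)

lemma Decaying.hasBoundaryValue {p : ℂ → ℂ} (hp : Decaying p) : HasBoundaryValue p (bv p) := by
  have hm0 : MemLp (fun x : ℝ => ((x : ℂ) + I)⁻¹) 2 volume := by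
    have := memLp_inv_sub (c := -I) (by simp)
    simpa only [sub_neg_eq_add] using this
  have h := hasBoundaryValue_inv_add_I.bddHol_mul hp.mul_add_I
  rw [mulL2_toL2 hp.mul_add_I.memLp_real hm0] at h
  have e : (fun x : ℝ => p x * ((x : ℂ) + I) * ((x : ℂ) + I)⁻¹) = fun x : ℝ => p x := by
    funext x
    have := add_I_ne_zero (ofReal_mem_closed x)
    field_simp
  rw [e] at h
  refine h.congr fun z hz => ?_
  have := add_I_ne_zero (upperHalf_subset_closed hz)
  field_simp

lemma Decaying.bv_mem {p : ℂ → ℂ} (hp : Decaying p) : bv p ∈ hardy := ⟨p, hp.hasBoundaryValue⟩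

/-- The factor `n / (n - iz)` regularises elements of `H²`. It is bounded by `1`, tends to `1` as `n
→ ∞`, and decays as `Im z → ∞`, which lets Cauchy's theorem push the line of integration to
infinity. -/
lemma bddHol_div_sub {n : ℝ} (hn : 0 < n) :
    BddHol (fun z => (n : ℂ) / (n - I * z)) ∧
      ∀ z ∈ closedUpperHalf, ‖(n : ℂ) / (n - I * z)‖ ≤ n / (n + z.im) := by
  have hre : ∀ z : ℂ, ((n : ℂ) - I * z).re = n + z.im := by
    intro z
    simp
  have hpos : ∀ z ∈ closedUpperHalf, 0 < n + z.im := fun z hz =>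
    add_pos_of_pos_of_nonneg hn hz
  have hb : ∀ z ∈ closedUpperHalf, n + z.im ≤ ‖(n : ℂ) - I * z‖ := by
    intro z hz
    rw [← hre]
    exact Complex.re_le_norm _
  have hne : ∀ z ∈ closedUpperHalf, (n : ℂ) - I * z ≠ 0 := fun z hz =>
    norm_pos_iff.1 ((hpos z hz).trans_le (hb z hz))
  have hle : ∀ z ∈ closedUpperHalf, ‖(n : ℂ) / (n - I * z)‖ ≤ n / (n + z.im) := by
    intro z hz
    rw [norm_div, Complex.norm_real, Real.norm_of_nonneg hn.le]
    exact div_le_div_of_nonneg_left hn.le (hpos z hz) (hb z hz)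
  refine ⟨⟨ContinuousOn.div (by fun_prop) (by fun_prop) hne, DifferentiableOn.div (by fun_prop)
    (by fun_prop) fun z hz => hne z (upperHalf_subset_closed hz), 1, fun z hz => ?_⟩, hle⟩
  refine (hle z hz).trans ?_
  rw [div_le_one (hpos z hz)]
  exact le_add_of_nonneg_right hz

lemma slice_bddHol_mul_le {p F : ℂ → ℂ} {f : L2} (hF : HasBoundaryValue F f) (hp : BddHol p)
    {y K : ℝ} (hy : 0 < y) (hK : ∀ x : ℝ, ‖p (x + y * I)‖ ≤ K) :
    ‖slice (fun z => p z * F z) y‖ ≤ K * ‖slice F y‖ := by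
  have hpm : MemLp (fun x : ℝ => p (x + y * I)) ∞ (volume : Measure ℝ) :=
    memLp_top_of_continuous (continuous_slice_of_continuousOn hp.cont hy.le) hK
  have e : slice (fun z => p z * F z) y = mulL2 (fun x : ℝ => p (x + y * I)) (slice F y) :=
    (mulL2_toL2 hpm (hF.memLp_slice hy)).symm
  rw [e]
  exact norm_mulL2_le hpm hK _

/-- `∫ f g = 0` for `f, g ∈ H²`. -/
lemma inner_star_eq_zero {f g : L2} (hf : f ∈ hardy) (hg : g ∈ hardy) :
    inner ℂ (star f) g = 0 := by
  obtain ⟨F, hF⟩ := hf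
  obtain ⟨G, hG⟩ := hg
  obtain ⟨D, hD0, hD⟩ := hG.exists_norm_slice_le
  have key : ∀ n : ℝ, 0 < n →
      inner ℂ (star f) (mulL2 (fun x : ℝ => (n : ℂ) / (n - I * x)) g) = 0 := by
    intro n hn
    obtain ⟨hp, hpn⟩ := bddHol_div_sub hn
    have hGn := hG.bddHol_mul hp
    obtain ⟨E, hE0, hE⟩ := hGn.exists_norm_slice_le
    refine inner_star_eq_zero_of_slices (δ := 1) (Y := 1) (R₀ := 0) (C := E)
      (H := fun z => F z * ((n : ℂ) / (n - I * z) * G z)) (G' := fun z => (n : ℂ) / (n - I * z) * G z)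
      hF (hF.1.mul hGn.1) one_pos le_rfl (fun y hy _ => hGn.memLp_slice hy) hGn.tendsto_slice ?_
      (fun x y _ _ => rfl) hGn.1.continuousOn (fun y hy => hGn.memLp_slice hy) hE
      (fun x y _ _ => (norm_mul _ _).le)
    refine squeeze_zero_norm' (a := fun y => n / (n + y) * D) ?_ ?_
    · filter_upwards [eventually_gt_atTop 0] with y hy
      rw [norm_norm]
      refine (slice_bddHol_mul_le hG hp hy (K := n / (n + y)) fun x => ?_).trans ?_
      · have := hpn (x + y * I) (upperHalf_subset_closed (mem_upperHalf_slice hy))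
        simpa using this
      · exact mul_le_mul_of_nonneg_left (hD y hy) (by positivity)
    · have h : Tendsto (fun y : ℝ => n / (n + y)) atTop (𝓝 0) :=
        tendsto_const_nhds.div_atTop (tendsto_atTop_add_const_left _ _ tendsto_id)
      simpa using h.mul_const D
  have hlim : Tendsto (fun n : ℝ => mulL2 (fun x : ℝ => (n : ℂ) / (n - I * x)) g) atTop (𝓝 g) := by
    have h := (tendsto_toL2 (l := (atTop : Filter ℝ))
      (F := fun n x => (n : ℂ) / (n - I * x) * g x) (f := g)
      (B := fun x => ‖g x‖) (Lp.memLp g).norm ?_ ?_ ?_).2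
    · rw [toL2_coe] at h
      refine h.congr' ?_
      filter_upwards [eventually_gt_atTop 0] with n hn
      exact toL2_eq_of_ae (mulL2_coeFn (bddHol_div_sub hn).1.memLp_real g).symm
    · filter_upwards [eventually_gt_atTop 0] with n hn
      exact (bddHol_div_sub hn).1.memLp_real.1.mul (Lp.aestronglyMeasurable g)
    · filter_upwards [eventually_gt_atTop 0] with n hn
      refine Eventually.of_forall fun x => ?_
      rw [norm_mul]
      refine mul_le_of_le_one_left (norm_nonneg _) ?_
      have := (bddHol_div_sub hn).2 x (ofReal_mem_closed x)
      simpa [hn.ne'] using this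
    · refine Eventually.of_forall fun x => ?_
      have h1 : Tendsto (fun n : ℝ => (1 : ℂ) - I * x * ((n : ℂ))⁻¹) atTop (𝓝 (1 - I * x * 0)) := by
        refine tendsto_const_nhds.sub (tendsto_const_nhds.mul ?_)
        have := (Complex.continuous_ofReal.tendsto 0).comp (tendsto_inv_atTop_zero (𝕜 := ℝ))
        simpa [Function.comp_def] using this
      have h2 := (h1.inv₀ (by simp)).mul_const (g x)
      simp only [mul_zero, sub_zero, inv_one, one_mul] at h2
      refine h2.congr' ?_
      filter_upwards [eventually_gt_atTop 0] with n hn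
      congr 1
      have hn' : (n : ℂ) ≠ 0 := by exact_mod_cast hn.ne'
      rw [show (1 : ℂ) - I * x * (n : ℂ)⁻¹ = (n - I * x) / n by field_simp, inv_div]
  have h3 : Tendsto (fun n : ℝ => (inner ℂ (star f)
      (mulL2 (fun x : ℝ => (n : ℂ) / (n - I * x)) g) : ℂ)) atTop (𝓝 (inner ℂ (star f) g)) :=
    tendsto_const_nhds.inner hlim
  refine tendsto_nhds_unique h3 ?_
  refine tendsto_const_nhds.congr' ?_
  filter_upwards [eventually_gt_atTop 0] with n hn
  exact (key n hn).symm

/-- The Cauchy kernel `1/(x - conj w)`. -/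
def cauchyKernel (w : ℂ) : L2 := bv (fun z => (z - starRingEnd ℂ w)⁻¹)

lemma decaying_cauchyKernel {w : ℂ} (hw : w ∈ upperHalf) :
    Decaying (fun z => (z - starRingEnd ℂ w)⁻¹) := by
  refine decaying_inv_sub ?_
  rw [conj_im]
  exact neg_neg_of_pos hw

lemma norm_cauchyKernel {w : ℂ} (hw : w ∈ upperHalf) : ‖cauchyKernel w‖ ^ 2 = Real.pi / w.im := by
  have hw' : 0 < w.im := hw
  rw [cauchyKernel, bv, norm_inv_sub (by rw [conj_im]; linarith), conj_im, abs_neg,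
    abs_of_pos hw']

lemma star_cauchyKernel {w : ℂ} (hw : w ∈ upperHalf) :
    star (cauchyKernel w) = toL2 (fun x : ℝ => ((x : ℂ) - w)⁻¹) := by
  rw [cauchyKernel, bv, star_toL2 (decaying_cauchyKernel hw).memLp]
  congr 1
  funext x
  simp

/-- Cauchy's integral formula in `H²`. -/
lemma inner_cauchyKernel {F : ℂ → ℂ} {f : L2} (hF : HasBoundaryValue F f) {w : ℂ}
    (hw : w ∈ upperHalf) : inner ℂ (cauchyKernel w) f = 2 * Real.pi * I * F w := by
  have hw' : 0 < w.im := hw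
  -- With this constant `F - c / (z - conj w)` vanishes at `w`. Dividing by `z - w` then leaves a
  -- holomorphic function (`dslope`), to which Cauchy's theorem applies although `1 / (x - w)` is
  -- not in `H²`.
  set c : ℂ := F w * (w - starRingEnd ℂ w) with hc
  have hwne : w - starRingEnd ℂ w ≠ 0 := by
    rw [Complex.sub_conj]
    simp [hw'.ne']
  have hF₁ : HasBoundaryValue (F + (-c) • fun z => (z - starRingEnd ℂ w)⁻¹)
      (f + (-c) • cauchyKernel w) :=
    hF.add (((decaying_cauchyKernel hw).hasBoundaryValue).smul (-c))
  set F₁ : ℂ → ℂ := F + (-c) • fun z => (z - starRingEnd ℂ w)⁻¹ with hF₁def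
  have hF₁w : F₁ w = 0 := by
    simp only [hF₁def, Pi.add_apply, Pi.smul_apply, smul_eq_mul, hc]
    field_simp
    ring
  have hds : ∀ z, z ≠ w → dslope F₁ w z = F₁ z * (z - w)⁻¹ := by
    intro z hz
    rw [dslope_of_ne _ hz, slope_def_field, hF₁w, sub_zero, div_eq_mul_inv]
  have him : ∀ x y : ℝ, ((x : ℂ) + y * I - w).im = y - w.im := by
    intro x y
    simp
  have hne : ∀ x y : ℝ, (y < w.im / 2 ∨ 2 * w.im < y) → (x + y * I : ℂ) ≠ w := by
    intro x y hy h
    have := him x y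
    rw [h, sub_self, zero_im] at this
    rcases hy with hy | hy <;> linarith
  have hsl : ∀ x y : ℝ, ((x : ℂ) + y * I - w)⁻¹ = ((x : ℂ) - (w - y * I))⁻¹ := by
    intro x y
    congr 1
    ring
  have hsim : ∀ y : ℝ, (w - y * I : ℂ).im = w.im - y := by
    intro y
    simp
  have hsre : ∀ y : ℝ, (w - y * I : ℂ).re = w.re := by
    intro y
    simp
  have hGm : ∀ y : ℝ, (y < w.im / 2 ∨ 2 * w.im < y) →
      MemLp (fun x : ℝ => ((x : ℂ) + y * I - w)⁻¹) 2 volume := by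
    intro y hy
    simp only [hsl]
    refine memLp_inv_sub ?_
    rw [hsim]
    rcases hy with hy | hy
    · linarith
    · intro h
      linarith
  have hI := (decaying_inv_sub (c := -I) (by simp)).hasBoundaryValue
  simp only [sub_neg_eq_add] at hI
  -- This constant gives `|z - w|⁻¹ ≤ K |z + i|⁻¹` as soon as `|z - w| ≥ 1`.
  set K : ℂ := ((1 + ‖w + I‖ : ℝ) : ℂ) with hK
  have hG' := hI.smul K
  obtain ⟨C, hC0, hC⟩ := hG'.exists_norm_slice_le
  have hzero : inner ℂ (star (f + (-c) • cauchyKernel w)) (star (cauchyKernel w)) = 0 := by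
    refine inner_star_eq_zero_of_slices (δ := w.im / 2) (Y := 2 * w.im) (R₀ := |w.re| + 1) (C := C)
      (G := fun z => (z - w)⁻¹) (H := dslope F₁ w) hF₁
      ((differentiableOn_dslope (isOpen_upperHalf.mem_nhds hw)).2 hF₁.1) (by linarith)
      (by linarith) (fun y _ hy => hGm y hy) ?_ ?_ (fun x y _ hy => hds _ (hne x y hy))
      hG'.1.continuousOn (fun y hy => hG'.memLp_slice hy) hC ?_
    · rw [star_cauchyKernel hw]
      refine (tendsto_toL2 (l := 𝓝[>] (0 : ℝ)) (F := fun y x => ((x : ℂ) + y * I - w)⁻¹)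
        (B := fun x => ‖((x : ℂ) - (w - (w.im / 2 : ℝ) * I))⁻¹‖)
        (memLp_inv_sub (by rw [hsim]; linarith)).norm ?_ ?_ ?_).2
      · filter_upwards [Ioo_mem_nhdsGT (show 0 < w.im / 2 by linarith)] with y hy
        exact (hGm y (Or.inl hy.2)).1
      · filter_upwards [Ioo_mem_nhdsGT (show 0 < w.im / 2 by linarith)] with y hy
        refine Eventually.of_forall fun x => ?_
        refine le_of_sq_le_sq ?_ (norm_nonneg _)
        rw [hsl, norm_inv_sub_sq, norm_inv_sub_sq, hsim, hsim, hsre, hsre]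
        have h1 : 0 < (w.im - w.im / 2) ^ 2 := by
          have : 0 < w.im - w.im / 2 := by linarith
          positivity
        have h2 : (w.im - w.im / 2) ^ 2 ≤ (w.im - y) ^ 2 := by
          have := hy.2
          gcongr
          linarith
        gcongr
      · refine Eventually.of_forall fun x => ?_
        have h1 : Continuous (fun y : ℝ => (x : ℂ) + y * I - w) := by fun_prop
        have h2 := ((h1.tendsto 0).inv₀ ?_).mono_left (nhdsWithin_le_nhds (s := Set.Ioi (0:ℝ)))
        · simpa using h2
        · simpa using ofReal_sub_ne_zero hw'.ne' x
    · have h : Tendsto (fun y : ℝ => Real.sqrt (Real.pi / (y - w.im))) atTop (𝓝 0) := by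
        have h1 : Tendsto (fun y : ℝ => Real.pi / (y - w.im)) atTop (𝓝 0) :=
          tendsto_const_nhds.div_atTop (tendsto_atTop_add_const_right _ _ tendsto_id)
        simpa using h1.sqrt
      refine h.congr' ?_
      filter_upwards [eventually_gt_atTop (2 * w.im)] with y hy
      rw [Real.sqrt_eq_iff_mul_self_eq (div_nonneg Real.pi_pos.le (by linarith)) (norm_nonneg _),
        ← sq, slice]
      simp only [hsl]
      rw [norm_inv_sub (by rw [hsim]; intro h; linarith), hsim, abs_sub_comm,
        abs_of_pos (by linarith)]
    · intro x y hx hy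
      have hre : 1 ≤ |x - w.re| := by
        have := abs_sub_abs_le_abs_sub x w.re
        linarith
      have h1 : 1 ≤ ‖(x : ℂ) + y * I - w‖ := by
        refine hre.trans ?_
        have := Complex.abs_re_le_norm ((x : ℂ) + y * I - w)
        simpa using this
      have hne' : (x + y * I : ℂ) ≠ w := by
        intro h
        rw [h, sub_self, norm_zero] at h1
        linarith
      rw [hds _ hne', norm_mul]
      refine mul_le_mul_of_nonneg_left ?_ (norm_nonneg _)
      simp only [Pi.smul_apply, smul_eq_mul, norm_mul, norm_inv, hK, Complex.norm_real]
      rw [Real.norm_of_nonneg (by positivity)]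
      have h2 : 0 < ‖(x : ℂ) + y * I + I‖ :=
        one_pos.trans_le (one_le_norm_add_I (upperHalf_subset_closed (mem_upperHalf_slice hy)))
      have h3 : ‖(x : ℂ) + y * I + I‖ ≤ ‖(x : ℂ) + y * I - w‖ + ‖w + I‖ := by
        have := norm_add_le ((x : ℂ) + y * I - w) (w + I)
        rwa [show (x : ℂ) + y * I - w + (w + I) = x + y * I + I by ring] at this
      rw [← div_eq_mul_inv, le_div_iff₀ h2, inv_mul_le_iff₀ (by linarith)]
      nlinarith [norm_nonneg (w + I)]
  rw [inner_star_star, inner_add_right, inner_smul_right, inner_self_eq_norm_sq_to_K] at hzero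
  have hn : ((‖cauchyKernel w‖ : ℝ) : ℂ) ^ 2 = Real.pi / w.im := by
    exact_mod_cast congrArg (fun t : ℝ => (t : ℂ)) (norm_cauchyKernel hw)
  have hzero' : inner ℂ (cauchyKernel w) f + -c * ((‖cauchyKernel w‖ : ℝ) : ℂ) ^ 2 = 0 := hzero
  rw [hn, hc, Complex.sub_conj] at hzero'
  have hwi : (w.im : ℂ) ≠ 0 := by exact_mod_cast hw'.ne'
  field_simp at hzero'
  push_cast at hzero'
  refine mul_right_cancel₀ hwi ?_
  linear_combination hzero'

lemma HasBoundaryValue.eq_of_same {F G : ℂ → ℂ} {f : L2} (hF : HasBoundaryValue F f)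
    (hG : HasBoundaryValue G f) {w : ℂ} (hw : w ∈ upperHalf) : F w = G w := by
  have h := (inner_cauchyKernel hF hw).symm.trans (inner_cauchyKernel hG hw)
  have : (2 * Real.pi * I : ℂ) ≠ 0 := by simp [Real.pi_ne_zero]
  exact mul_left_cancel₀ this h

lemma HasBoundaryValue.unique {F G : ℂ → ℂ} {f g : L2} (hF : HasBoundaryValue F f)
    (hG : HasBoundaryValue G g) (h : ∀ z ∈ upperHalf, F z = G z) : f = g := by
  exact tendsto_nhds_unique (hF.congr h).tendsto_slice hG.tendsto_slice

/-- The norms on horizontal lines are at most the norm of the boundary value. -/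
lemma HasBoundaryValue.norm_slice_le {F : ℂ → ℂ} {f : L2} (hF : HasBoundaryValue F f) {y : ℝ}
    (hy : 0 < y) : ‖slice F y‖ ≤ ‖f‖ := by
  have hπ := Real.pi_pos
  have key : ∀ x : ℝ, ENNReal.ofReal (‖F (x + y * I)‖ ^ 2) ≤
      ENNReal.ofReal (y / Real.pi) *
        ∫⁻ t : ℝ, ENNReal.ofReal (‖f t‖ ^ 2) * ENNReal.ofReal (((x - t) ^ 2 + y ^ 2)⁻¹) := by
    intro x
    set w : ℂ := x + y * I with hw
    have hwU : w ∈ upperHalf := mem_upperHalf_slice hy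
    have hwim : w.im = y := by simp [hw]
    have hwre : w.re = x := by simp [hw]
    have hk := decaying_cauchyKernel hwU
    set g : L2 := mulL2 (fun t : ℝ => ((t : ℂ) - starRingEnd ℂ w)⁻¹) f with hg
    have hgc := mulL2_coeFn hk.bddHol.memLp_real f
    -- The conjugate Cauchy kernel integrates to zero against `f`. Subtracting it turns the Cauchy
    -- kernel into the Poisson kernel `2iy / |t - w|²`. Cauchy–Schwarz and integration over the line
    -- `Im w = y` then give the contraction.
    have hF1 : (2 * Real.pi * I : ℂ) * F w = 2 * I * y * inner ℂ (cauchyKernel w) g := by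
      rw [← inner_cauchyKernel hF hwU]
      have h0 := inner_star_eq_zero hk.bv_mem ⟨F, hF⟩
      have h1 : inner ℂ (cauchyKernel w) f
          = inner ℂ (cauchyKernel w) f - inner ℂ (star (cauchyKernel w)) f := by
        rw [cauchyKernel, h0, sub_zero]
      rw [h1, ← inner_sub_left, inner_eq_integral, inner_eq_integral, ← integral_const_mul]
      refine integral_congr_ae ?_
      filter_upwards [hgc, Lp.coeFn_sub (cauchyKernel w) (star (cauchyKernel w)),
        star_coeFn (cauchyKernel w), toL2_coeFn hk.memLp] with t h1 h2 h3 h4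
      have h4' : cauchyKernel w t = ((t : ℂ) - starRingEnd ℂ w)⁻¹ := h4
      rw [h1, h2, Pi.sub_apply, h3, h4']
      have e1 : (t : ℂ) - w ≠ 0 := ofReal_sub_ne_zero (by rw [hwim]; exact hy.ne') t
      have e2 : (t : ℂ) - starRingEnd ℂ w ≠ 0 :=
        ofReal_sub_ne_zero (by rw [conj_im, hwim]; linarith) t
      have e3 : w - starRingEnd ℂ w = 2 * I * y := by
        rw [Complex.sub_conj, hwim]
        push_cast
        ring
      simp only [map_sub, map_inv₀, Complex.conj_ofReal, Complex.conj_conj]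
      field_simp
      linear_combination (f t) * e3
    have hF2 : Real.pi * ‖F w‖ = y * ‖(inner ℂ (cauchyKernel w) g : ℂ)‖ := by
      have := congrArg norm hF1
      simp only [norm_mul, Complex.norm_real, Complex.norm_I, Real.norm_of_nonneg hπ.le,
        Real.norm_of_nonneg hy.le, Complex.norm_ofNat, mul_one] at this
      linarith
    have hF3 : ‖F w‖ ^ 2 ≤ y / Real.pi * ‖g‖ ^ 2 := by
      have h1 : ‖F w‖ = y / Real.pi * ‖(inner ℂ (cauchyKernel w) g : ℂ)‖ := by
        field_simp
        linarith
      have h2 := norm_inner_le_norm (𝕜 := ℂ) (cauchyKernel w) g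
      have h3 : ‖(inner ℂ (cauchyKernel w) g : ℂ)‖ ^ 2 ≤ Real.pi / y * ‖g‖ ^ 2 := by
        rw [← hwim, ← norm_cauchyKernel hwU, ← mul_pow]
        gcongr
      rw [h1, mul_pow]
      calc (y / Real.pi) ^ 2 * ‖(inner ℂ (cauchyKernel w) g : ℂ)‖ ^ 2
          ≤ (y / Real.pi) ^ 2 * (Real.pi / y * ‖g‖ ^ 2) := by gcongr
        _ = y / Real.pi * ‖g‖ ^ 2 := by field_simp
    refine (ENNReal.ofReal_le_ofReal hF3).trans ?_
    rw [ENNReal.ofReal_mul (by positivity)]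
    gcongr
    rw [norm_sq_eq_integral, ofReal_integral_eq_lintegral_ofReal
      (Lp.memLp g).norm.integrable_sq (Eventually.of_forall fun x => by positivity)]
    refine le_of_eq (lintegral_congr_ae ?_)
    filter_upwards [hgc] with t ht
    rw [ht, norm_mul, mul_pow, norm_inv_sub_sq, conj_re, conj_im, hwim, hwre, mul_comm,
      ENNReal.ofReal_mul (by positivity)]
    congr 3
    ring
  have hfm : AEMeasurable (fun t : ℝ => ENNReal.ofReal (‖f t‖ ^ 2)) volume :=
    ((Lp.memLp f).1.norm.pow 2).aemeasurable.ennreal_ofReal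
  have hkm : Measurable (fun p : ℝ × ℝ => ENNReal.ofReal (((p.1 - p.2) ^ 2 + y ^ 2)⁻¹)) := by
    fun_prop
  have hfin : ENNReal.ofReal (‖slice F y‖ ^ 2) ≤ ENNReal.ofReal (‖f‖ ^ 2) := by
    rw [← lintegral_slice (hF.memLp_slice hy)]
    refine (lintegral_mono key).trans ?_
    rw [lintegral_const_mul' _ _ ENNReal.ofReal_ne_top, lintegral_lintegral_swap]
    · have e : ∀ t : ℝ, ∫⁻ x : ℝ, ENNReal.ofReal (‖f t‖ ^ 2) *
          ENNReal.ofReal (((x - t) ^ 2 + y ^ 2)⁻¹) =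
          ENNReal.ofReal (‖f t‖ ^ 2) * ENNReal.ofReal (Real.pi / y) := by
        intro t
        rw [lintegral_const_mul' _ _ ENNReal.ofReal_ne_top,
          ← ofReal_integral_eq_lintegral_ofReal (integrable_inv_sq_add_sq t hy.ne')
            (Eventually.of_forall fun x => by positivity), integral_inv_sq_add_sq t hy.ne',
          abs_of_pos hy]
      simp only [e]
      rw [lintegral_mul_const' _ _ ENNReal.ofReal_ne_top, norm_sq_eq_integral f,
        ofReal_integral_eq_lintegral_ofReal (Lp.memLp f).norm.integrable_sq
          (Eventually.of_forall fun x => by positivity), mul_left_comm,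
        ← ENNReal.ofReal_mul (by positivity)]
      have : y / Real.pi * (Real.pi / y) = 1 := by field_simp
      rw [this, ENNReal.ofReal_one, mul_one]
    · exact (hfm.comp_snd).mul hkm.aemeasurable
  have h := (ENNReal.ofReal_le_ofReal_iff (by positivity)).1 hfin
  exact le_of_sq_le_sq h (norm_nonneg _)

lemma HasBoundaryValue.sub {F G : ℂ → ℂ} {f g : L2} (hF : HasBoundaryValue F f)
    (hG : HasBoundaryValue G g) : HasBoundaryValue (fun z => F z - G z) (f - g) := by
  have h := hF.add (hG.smul (-1))
  have e : f - g = f + (-1 : ℂ) • g := by rw [neg_one_smul, sub_eq_add_neg]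
  rw [e]
  exact h.congr fun z _ => by simp [sub_eq_add_neg]

lemma HasBoundaryValue.slice_sub {F G : ℂ → ℂ} {f g : L2} (hF : HasBoundaryValue F f)
    (hG : HasBoundaryValue G g) {y : ℝ} (hy : 0 < y) :
    slice (fun z => F z - G z) y = slice F y - slice G y :=
  toL2_sub (hF.memLp_slice hy) (hG.memLp_slice hy)

/-- `H²` is closed in `L²(ℝ)`. -/
lemma hardy_closure : hardy.topologicalClosure = hardy := by
  refine le_antisymm (fun f hf => ?_) hardy.le_topologicalClosure
  have hf' : f ∈ closure (hardy : Set L2) := hf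
  obtain ⟨fs, hfs, hlim⟩ := mem_closure_iff_seq_limit.1 hf'
  choose Fs hFs using hfs
  have hpi : (2 * Real.pi * I : ℂ) ≠ 0 := by simp [Real.pi_ne_zero]
  obtain ⟨P, hP⟩ : ∃ P : ℂ, P = (2 * Real.pi * I)⁻¹ := ⟨_, rfl⟩
  -- The Cauchy integral of the limit is the only candidate for its extension. On each `Im z > ε >
  -- 0` it is a uniform limit of the `Fs n`, hence holomorphic.
  set F : ℂ → ℂ := fun w => P * inner ℂ (cauchyKernel w) f with hF
  have hFn : ∀ n, ∀ w ∈ upperHalf,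
      Fs n w = P * inner ℂ (cauchyKernel w) (fs n) := by
    intro n w hw
    rw [inner_cauchyKernel (hFs n) hw, hP, inv_mul_cancel_left₀ hpi]
  have hnorm : Tendsto (fun n => ‖f - fs n‖) atTop (𝓝 0) := by
    have := tendsto_iff_norm_sub_tendsto_zero.1 hlim
    refine this.congr fun n => norm_sub_rev _ _
  have hpt : ∀ w ∈ upperHalf, Tendsto (fun n => Fs n w) atTop (𝓝 (F w)) := by
    intro w hw
    have h1 : Tendsto (fun n => P * inner ℂ (cauchyKernel w) (fs n)) atTop
        (𝓝 (F w)) := (tendsto_const_nhds.inner hlim).const_mul _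
    exact h1.congr fun n => (hFn n w hw).symm
  have hdiff : DifferentiableOn ℂ F upperHalf := by
    have hloc : TendstoLocallyUniformlyOn Fs F atTop upperHalf := by
      rw [Metric.tendstoLocallyUniformlyOn_iff]
      intro ε hε w hw
      have hw' : 0 < w.im := hw
      have hnhds : {z : ℂ | w.im / 2 < z.im} ∈ 𝓝[upperHalf] w :=
        mem_nhdsWithin_of_mem_nhds ((isOpen_lt continuous_const Complex.continuous_im).mem_nhds
          (by simp [hw']))
      refine ⟨{z : ℂ | w.im / 2 < z.im}, hnhds, ?_⟩
      set K : ℝ := ‖P‖ * Real.sqrt (Real.pi / (w.im / 2)) with hK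
      have h1 : Tendsto (fun n => K * ‖f - fs n‖) atTop (𝓝 0) := by
        simpa using hnorm.const_mul K
      filter_upwards [h1.eventually (gt_mem_nhds hε)] with n hn z hz
      have hzw : w.im / 2 < z.im := hz
      have hz' : z ∈ upperHalf := lt_trans (half_pos hw') hzw
      refine lt_of_le_of_lt ?_ hn
      have h2 : ‖(inner ℂ (cauchyKernel z) (f - fs n) : ℂ)‖
          ≤ Real.sqrt (Real.pi / (w.im / 2)) * ‖f - fs n‖ := by
        refine (norm_inner_le_norm (𝕜 := ℂ) (cauchyKernel z) (f - fs n)).trans ?_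
        refine mul_le_mul_of_nonneg_right (Real.le_sqrt_of_sq_le ?_) (norm_nonneg _)
        rw [norm_cauchyKernel hz']
        exact div_le_div_of_nonneg_left Real.pi_pos.le (half_pos hw') hzw.le
      have h3 : F z - Fs n z
          = P * inner ℂ (cauchyKernel z) (f - fs n) := by
        rw [hFn n z hz', inner_sub_right, mul_sub]
      rw [dist_eq_norm, h3, norm_mul, hK, mul_assoc]
      gcongr
    exact hloc.differentiableOn (Eventually.of_forall fun n => (hFs n).1) isOpen_upperHalf
  -- The slices at a fixed height are Cauchy by `norm_slice_le`. An almost everywhere convergent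
  -- subsequence identifies their limit with the slice of `F`, at a distance controlled uniformly in
  -- `y`.
  have hsl : ∀ y : ℝ, 0 < y → MemLp (fun x : ℝ => F (x + y * I)) 2 volume ∧
      ∀ n, ‖slice F y - slice (Fs n) y‖ ≤ ‖f - fs n‖ := by
    intro y hy
    have hd : ∀ n k, ‖slice (Fs n) y - slice (Fs k) y‖ ≤ ‖fs n - fs k‖ := by
      intro n k
      rw [← (hFs n).slice_sub (hFs k) hy]
      exact ((hFs n).sub (hFs k)).norm_slice_le hy
    have hcs : CauchySeq (fun n => slice (Fs n) y) := by
      rw [Metric.cauchySeq_iff]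
      intro ε hε
      obtain ⟨N, hN⟩ := Metric.cauchySeq_iff.1 hlim.cauchySeq ε hε
      refine ⟨N, fun m hm n hn => ?_⟩
      have := hN m hm n hn
      rw [dist_eq_norm] at this ⊢
      exact (hd m n).trans_lt this
    obtain ⟨g, hg⟩ := cauchySeq_tendsto_of_complete hcs
    obtain ⟨ns, _, hns⟩ := (tendstoInMeasure_of_tendsto_Lp hg).exists_seq_tendsto_ae
    have hae : ∀ᵐ x : ℝ, ∀ n, slice (Fs n) y x = Fs n (x + y * I) :=
      ae_all_iff.2 fun n => toL2_coeFn ((hFs n).memLp_slice hy)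
    have hgF : (fun x : ℝ => F (x + y * I)) =ᵐ[volume] g := by
      filter_upwards [hns, hae] with x h1 h2
      have h3 : Tendsto (fun i => Fs (ns i) (x + y * I)) atTop (𝓝 (g x)) := by
        refine h1.congr fun i => h2 _
      refine tendsto_nhds_unique ?_ h3
      exact (hpt _ (mem_upperHalf_slice hy)).comp (StrictMono.tendsto_atTop ‹_›)
    refine ⟨(memLp_congr_ae hgF).2 (Lp.memLp g), fun n => ?_⟩
    have e : slice F y = g := toL2_eq_of_ae hgF
    rw [e]
    refine le_of_tendsto_of_tendsto ((hg.sub_const (slice (Fs n) y)).norm)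
      ((hlim.sub_const (fs n)).norm) (Eventually.of_forall fun k => hd k n)
  refine ⟨F, hasBoundaryValue_of_slice hdiff (fun y hy => (hsl y hy).1)
    (C := ‖f - fs 0‖ + ‖fs 0‖) (fun y hy => ?_) ?_⟩
  · have h1 := (hsl y hy).2 0
    have h2 := (hFs 0).norm_slice_le hy
    calc ‖slice F y‖ = ‖(slice F y - slice (Fs 0) y) + slice (Fs 0) y‖ := by rw [sub_add_cancel]
      _ ≤ _ := (norm_add_le _ _).trans (add_le_add h1 h2)
  · rw [Metric.tendsto_nhds]
    intro ε hε
    obtain ⟨n, hn⟩ := (hnorm.eventually (gt_mem_nhds (show 0 < ε / 3 by positivity))).exists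
    filter_upwards [self_mem_nhdsWithin,
      Metric.tendsto_nhds.1 (hFs n).tendsto_slice (ε / 3) (by positivity)] with y hy h2
    have h1 := (hsl y hy).2 n
    rw [dist_eq_norm] at h2 ⊢
    calc ‖slice F y - f‖ = ‖(slice F y - slice (Fs n) y) + (slice (Fs n) y - fs n)
          - (f - fs n)‖ := by congr 1; abel
      _ ≤ ‖slice F y - slice (Fs n) y‖ + ‖slice (Fs n) y - fs n‖ + ‖f - fs n‖ :=
          (norm_sub_le _ _).trans (add_le_add (norm_add_le _ _) le_rfl)
      _ < ε := by linarith

/-! ### Projections and Hankel operators -/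

lemma proj_eq_of_mem {M : Submodule ℂ L2} {x g : L2} (hg : g ∈ M)
    (hk : ∀ h ∈ M, inner ℂ h (x - g) = 0) : proj M x = g := by
  refine Submodule.eq_starProjection_of_mem_orthogonal (M.le_topologicalClosure hg) ?_
  rw [Submodule.orthogonal_closure]
  exact (Submodule.mem_orthogonal _ _).2 hk

lemma inner_proj {M : Submodule ℂ L2} (x : L2) {g : L2} (hg : g ∈ M) :
    inner ℂ g (proj M x) = (inner ℂ g x : ℂ) := by
  rw [proj, ← Submodule.inner_starProjection_left_eq_right,
    Submodule.starProjection_eq_self_iff.2 (M.le_topologicalClosure hg)]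

lemma proj_eq_self {M : Submodule ℂ L2} {x : L2} (hx : x ∈ M) : proj M x = x :=
  proj_eq_of_mem hx fun h _ => by rw [sub_self, inner_zero_right]

lemma hankel_mem_hardy (u : ℝ → ℂ) (f : L2) : hankel u f ∈ hardy := by
  have h : hankel u f ∈ hardy.topologicalClosure := Submodule.starProjection_apply_mem _ _
  rwa [hardy_closure] at h

/-- Conjugates of elements of `H²` are orthogonal to `H²`, so splitting `u conj f` into an analytic
and a co-analytic part reads off the projection. -/
lemma hankel_eq_of_mem {u : ℝ → ℂ} {f g k : L2} (hg : g ∈ hardy) (hk : k ∈ hardy)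
    (h : mulL2 u (star f) = g + star k) : hankel u f = g := by
  refine proj_eq_of_mem hg fun h' hh' => ?_
  rw [h, add_sub_cancel_left, ← inner_conj_symm, inner_star_eq_zero hk hh', map_zero]

lemma hankel_sum (u : ℝ → ℂ) {ι : Type*} (s : Finset ι) (f : ι → L2) :
    hankel u (∑ i ∈ s, f i) = ∑ i ∈ s, hankel u (f i) := by
  classical
  induction s using Finset.induction_on with
  | empty => simpa using hankel_smul u 0 0
  | insert i s hi ih => rw [Finset.sum_insert hi, Finset.sum_insert hi, hankel_add, ih]

/-- Symmetry of Hankel operators. -/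
lemma inner_hankel_comm {u : ℝ → ℂ} (hu : MemLp u ∞ (volume : Measure ℝ)) {f g : L2}
    (hf : f ∈ hardy) (hg : g ∈ hardy) :
    (inner ℂ f (hankel u g) : ℂ) = inner ℂ g (hankel u f) := by
  rw [hankel, hankel, inner_proj _ hf, inner_proj _ hg, inner_eq_integral, inner_eq_integral]
  refine integral_congr_ae ?_
  filter_upwards [mulL2_coeFn hu (star f), mulL2_coeFn hu (star g), star_coeFn f,
    star_coeFn g] with x h1 h2 h3 h4
  rw [h1, h2, h3, h4]
  ring

/-! ### Rational functions in the closed upper half-plane -/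

/-- The filter of neighbourhoods of infinity in the closed upper half-plane. -/
def atInfty : Filter ℂ := cocompact ℂ ⊓ 𝓟 closedUpperHalf

lemma tendsto_mul_I_atInfty : Tendsto (fun y : ℝ => (y * I : ℂ)) atTop atInfty := by
  refine tendsto_inf.2 ⟨?_, tendsto_principal.2 ?_⟩
  · rw [← Metric.cobounded_eq_cocompact, ← tendsto_norm_atTop_iff_cobounded]
    refine tendsto_id.congr' ?_
    filter_upwards [eventually_ge_atTop 0] with y hy
    simp [abs_of_nonneg hy]
  · filter_upwards [eventually_ge_atTop 0] with y hy
    simpa [closedUpperHalf] using hy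

instance atInfty_neBot : atInfty.NeBot := tendsto_mul_I_atInfty.neBot

lemma atInfty_le_cobounded : atInfty ≤ Bornology.cobounded ℂ := by
  rw [Metric.cobounded_eq_cocompact]
  exact inf_le_left

lemma eventually_atInfty_mem : ∀ᶠ z in atInfty, z ∈ closedUpperHalf :=
  mem_inf_of_right (mem_principal_self _)

lemma isClosed_closedUpperHalf : IsClosed closedUpperHalf :=
  isClosed_le continuous_const Complex.continuous_im

/-- `F` is a rational function without poles in the closed upper half-plane. -/
def IsRat (F : ℂ → ℂ) : Prop :=
  ∃ P R : Polynomial ℂ, ∀ z ∈ closedUpperHalf, R.eval z ≠ 0 ∧ F z = P.eval z / R.eval z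

lemma isRat_const (c : ℂ) : IsRat fun _ => c :=
  ⟨Polynomial.C c, 1, fun z _ => by simp⟩

lemma isRat_div {P R : Polynomial ℂ} (hR : ∀ z ∈ closedUpperHalf, R.eval z ≠ 0) :
    IsRat fun z => P.eval z / R.eval z := ⟨P, R, fun z hz => ⟨hR z hz, rfl⟩⟩

lemma IsRat.congr {F G : ℂ → ℂ} (hF : IsRat F) (h : ∀ z ∈ closedUpperHalf, G z = F z) :
    IsRat G := by
  obtain ⟨P, R, hPR⟩ := hF
  exact ⟨P, R, fun z hz => ⟨(hPR z hz).1, (h z hz).trans (hPR z hz).2⟩⟩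

lemma IsRat.add {F G : ℂ → ℂ} (hF : IsRat F) (hG : IsRat G) : IsRat fun z => F z + G z := by
  obtain ⟨P, R, hPR⟩ := hF
  obtain ⟨P', R', hPR'⟩ := hG
  refine ⟨P * R' + R * P', R * R', fun z hz => ?_⟩
  obtain ⟨h1, h2⟩ := hPR z hz
  obtain ⟨h3, h4⟩ := hPR' z hz
  simp only [Polynomial.eval_mul, Polynomial.eval_add]
  exact ⟨mul_ne_zero h1 h3, by rw [h2, h4, div_add_div _ _ h1 h3]⟩

lemma IsRat.mul {F G : ℂ → ℂ} (hF : IsRat F) (hG : IsRat G) : IsRat fun z => F z * G z := by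
  obtain ⟨P, R, hPR⟩ := hF
  obtain ⟨P', R', hPR'⟩ := hG
  refine ⟨P * P', R * R', fun z hz => ?_⟩
  obtain ⟨h1, h2⟩ := hPR z hz
  obtain ⟨h3, h4⟩ := hPR' z hz
  simp only [Polynomial.eval_mul]
  exact ⟨mul_ne_zero h1 h3, by rw [h2, h4, div_mul_div_comm]⟩

lemma IsRat.const_mul {F : ℂ → ℂ} (c : ℂ) (hF : IsRat F) : IsRat fun z => c * F z :=
  (isRat_const c).mul hF

lemma IsRat.sub {F G : ℂ → ℂ} (hF : IsRat F) (hG : IsRat G) : IsRat fun z => F z - G z :=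
  (hF.add (hG.const_mul (-1))).congr fun z _ => by ring

lemma IsRat.inv {F : ℂ → ℂ} (hF : IsRat F) (h : ∀ z ∈ closedUpperHalf, F z ≠ 0) :
    IsRat fun z => (F z)⁻¹ := by
  obtain ⟨P, R, hPR⟩ := hF
  refine ⟨R, P, fun z hz => ?_⟩
  obtain ⟨h1, h2⟩ := hPR z hz
  refine ⟨fun h0 => h z hz (by rw [h2, h0, zero_div]), by simp only [h2, inv_div]⟩

lemma IsRat.sum {ι : Type*} {s : Finset ι} {F : ι → ℂ → ℂ} (hF : ∀ i ∈ s, IsRat (F i)) :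
    IsRat fun z => ∑ i ∈ s, F i z := by
  classical
  induction s using Finset.induction_on with
  | empty => simpa using isRat_const 0
  | insert i s hi ih =>
    simp only [Finset.sum_insert hi]
    exact (hF i (Finset.mem_insert_self _ _)).add
      (ih fun j hj => hF j (Finset.mem_insert_of_mem hj))

lemma IsRat.prod {ι : Type*} {s : Finset ι} {F : ι → ℂ → ℂ} (hF : ∀ i ∈ s, IsRat (F i)) :
    IsRat fun z => ∏ i ∈ s, F i z := by
  classical
  induction s using Finset.induction_on with
  | empty => simpa using isRat_const 1
  | insert i s hi ih =>
    simp only [Finset.prod_insert hi]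
    exact (hF i (Finset.mem_insert_self _ _)).mul
      (ih fun j hj => hF j (Finset.mem_insert_of_mem hj))

lemma IsRat.det {n : Type*} [Fintype n] [DecidableEq n] {M : ℂ → Matrix n n ℂ}
    (hM : ∀ i j, IsRat fun z => M z i j) : IsRat fun z => (M z).det := by
  simp only [Matrix.det_apply']
  exact IsRat.sum fun σ _ => (IsRat.prod fun i _ => hM _ _).const_mul _

lemma IsRat.adjugate {n : Type*} [Fintype n] [DecidableEq n] {M : ℂ → Matrix n n ℂ}
    (hM : ∀ i j, IsRat fun z => M z i j) (i j : n) : IsRat fun z => (M z).adjugate i j := by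
  simp only [Matrix.adjugate_apply]
  refine IsRat.det fun k l => ?_
  by_cases hk : k = j
  · subst hk
    simpa only [Matrix.updateRow_self] using isRat_const _
  · simpa only [Matrix.updateRow_ne hk] using hM k l

lemma IsRat.inv_matrix {n : Type*} [Fintype n] [DecidableEq n] {M : ℂ → Matrix n n ℂ}
    (hM : ∀ i j, IsRat fun z => M z i j) (h : ∀ z ∈ closedUpperHalf, (M z).det ≠ 0) (i j : n) :
    IsRat fun z => (M z)⁻¹ i j := by
  refine (((IsRat.det hM).inv h).mul (IsRat.adjugate hM i j)).congr fun z _ => ?_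
  rw [Matrix.inv_def, Matrix.smul_apply, Ring.inverse_eq_inv', smul_eq_mul]

/-- The degree comparison bounds the quotient near infinity, continuity bounds it on the remaining
compact part. -/
lemma bddHol_div {P R : Polynomial ℂ} (hR : ∀ z ∈ closedUpperHalf, R.eval z ≠ 0)
    (hd : P.degree ≤ R.degree) : BddHol fun z => P.eval z / R.eval z := by
  have hc : ContinuousOn (fun z => P.eval z / R.eval z) closedUpperHalf :=
    P.continuous.continuousOn.div R.continuous.continuousOn hR
  refine ⟨hc, P.differentiable.differentiableOn.div R.differentiable.differentiableOn
    fun z hz => hR z (upperHalf_subset_closed hz), ?_⟩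
  obtain ⟨C, hC⟩ := (Polynomial.isBigO_cobounded_of_degree_le hd).bound
  rw [Metric.cobounded_eq_cocompact] at hC
  obtain ⟨K, hK, hKC⟩ := mem_cocompact.1 hC
  have hK' : IsCompact (K ∩ closedUpperHalf) := hK.inter_right isClosed_closedUpperHalf
  obtain ⟨C', hC'⟩ := hK'.exists_bound_of_continuousOn (hc.mono Set.inter_subset_right)
  refine ⟨max C C', fun z hz => ?_⟩
  by_cases hzK : z ∈ K
  · exact (hC' z ⟨hzK, hz⟩).trans (le_max_right _ _)
  · refine le_trans ?_ (le_max_left _ _)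
    rw [norm_div, div_le_iff₀ (norm_pos_iff.2 (hR z hz))]
    exact hKC hzK

lemma degree_mul_X_add_C_le {P R : Polynomial ℂ} (c : ℂ) (hd : P.degree < R.degree) :
    (P * (Polynomial.X + Polynomial.C c)).degree ≤ R.degree := by
  rw [Polynomial.degree_mul, Polynomial.degree_X_add_C]
  have hR : R ≠ 0 := fun h => by simp [h] at hd
  by_cases hP : P = 0
  · simp [hP]
  · rw [Polynomial.degree_eq_natDegree hP, Polynomial.degree_eq_natDegree hR] at *
    exact_mod_cast hd

lemma BddHol.congr {F G : ℂ → ℂ} (hF : BddHol F) (h : ∀ z ∈ closedUpperHalf, G z = F z) :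
    BddHol G := by
  obtain ⟨h1, h2, C, hC⟩ := hF
  exact ⟨h1.congr h, h2.congr fun z hz => h z (upperHalf_subset_closed hz), C,
    fun z hz => by rw [h z hz]; exact hC z hz⟩

lemma Decaying.congr {F G : ℂ → ℂ} (hF : Decaying F) (h : ∀ z ∈ closedUpperHalf, G z = F z) :
    Decaying G := by
  obtain ⟨h1, h2, C, hC⟩ := hF
  exact ⟨h1.congr h, h2.congr fun z hz => h z (upperHalf_subset_closed hz), C,
    fun z hz => by rw [h z hz]; exact hC z hz⟩

lemma decaying_of_mul_add_I {F : ℂ → ℂ} (hF : BddHol fun z => F z * (z + I)) : Decaying F := by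
  have hne : ∀ z ∈ closedUpperHalf, z + I ≠ 0 := fun z hz => add_I_ne_zero hz
  have e : ∀ z ∈ closedUpperHalf, F z = F z * (z + I) * (z + I)⁻¹ := fun z hz => by
    have := hne z hz
    field_simp
  obtain ⟨h1, h2, C, hC⟩ := hF
  refine ⟨(h1.mul (ContinuousOn.inv₀ (by fun_prop) hne)).congr e,
    (h2.mul (DifferentiableOn.inv (by fun_prop)
      fun z hz => hne z (upperHalf_subset_closed hz))).congr
      fun z hz => e z (upperHalf_subset_closed hz), C, fun z hz => ?_⟩
  rw [← norm_mul]
  exact hC z hz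

lemma decaying_div {P R : Polynomial ℂ} (hR : ∀ z ∈ closedUpperHalf, R.eval z ≠ 0)
    (hd : P.degree < R.degree) : Decaying fun z => P.eval z / R.eval z := by
  refine decaying_of_mul_add_I ((bddHol_div hR (degree_mul_X_add_C_le I hd)).congr fun z _ => ?_)
  simp only [Polynomial.eval_mul, Polynomial.eval_add, Polynomial.eval_X, Polynomial.eval_C]
  ring

lemma BddHol.add {F G : ℂ → ℂ} (hF : BddHol F) (hG : BddHol G) :
    BddHol fun z => F z + G z := by
  obtain ⟨h1, h2, C, hC⟩ := hF
  obtain ⟨h1', h2', C', hC'⟩ := hG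
  exact ⟨h1.add h1', h2.add h2', C + C',
    fun z hz => (norm_add_le _ _).trans (add_le_add (hC z hz) (hC' z hz))⟩

lemma BddHol.mul {F G : ℂ → ℂ} (hF : BddHol F) (hG : BddHol G) :
    BddHol fun z => F z * G z := by
  obtain ⟨h1, h2, C, hC⟩ := hF
  obtain ⟨h1', h2', C', hC'⟩ := hG
  refine ⟨h1.mul h1', h2.mul h2', C * C', fun z hz => ?_⟩
  rw [norm_mul]
  exact mul_le_mul (hC z hz) (hC' z hz) (norm_nonneg _) ((norm_nonneg _).trans (hC z hz))

lemma bddHol_const (c : ℂ) : BddHol fun _ => c :=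
  ⟨continuousOn_const, differentiableOn_const c, ‖c‖, fun _ _ => le_rfl⟩

lemma Decaying.add {F G : ℂ → ℂ} (hF : Decaying F) (hG : Decaying G) :
    Decaying fun z => F z + G z :=
  decaying_of_mul_add_I ((hF.mul_add_I.add hG.mul_add_I).congr fun z _ => by ring)

lemma BddHol.mul_decaying {F G : ℂ → ℂ} (hF : BddHol F) (hG : Decaying G) :
    Decaying fun z => F z * G z :=
  decaying_of_mul_add_I ((hF.mul hG.mul_add_I).congr fun z _ => by ring)

lemma Decaying.const_mul {F : ℂ → ℂ} (c : ℂ) (hF : Decaying F) : Decaying fun z => c * F z :=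
  (bddHol_const c).mul_decaying hF

lemma Decaying.sub {F G : ℂ → ℂ} (hF : Decaying F) (hG : Decaying G) :
    Decaying fun z => F z - G z :=
  (hF.add (hG.const_mul (-1))).congr fun z _ => by ring

lemma decaying_zero : Decaying fun _ => 0 :=
  ⟨continuousOn_const, differentiableOn_const 0, 0, fun z _ => by simp⟩

lemma Decaying.sum {ι : Type*} {s : Finset ι} {F : ι → ℂ → ℂ} (hF : ∀ i ∈ s, Decaying (F i)) :
    Decaying fun z => ∑ i ∈ s, F i z := by
  classical
  induction s using Finset.induction_on with
  | empty => simpa using decaying_zero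
  | insert i s hi ih =>
    simp only [Finset.sum_insert hi]
    exact (hF i (Finset.mem_insert_self _ _)).add
      (ih fun j hj => hF j (Finset.mem_insert_of_mem hj))

lemma tendsto_norm_add_I : Tendsto (fun z : ℂ => ‖z + I‖) atInfty atTop := by
  have h : Tendsto (fun z : ℂ => ‖z‖ - 1) atInfty atTop :=
    tendsto_atTop_add_const_right _ _ (tendsto_norm_cobounded_atTop.mono_left atInfty_le_cobounded)
  refine tendsto_atTop_mono (fun z => ?_) h
  have := norm_sub_le (z + I) I
  rw [add_sub_cancel_right, norm_I] at this
  linarith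

lemma Decaying.tendsto_zero {F : ℂ → ℂ} (hF : Decaying F) : Tendsto F atInfty (𝓝 0) := by
  obtain ⟨C, hC⟩ := hF.bdd
  refine squeeze_zero_norm' (a := fun z => C / ‖z + I‖) ?_
    (tendsto_const_nhds.div_atTop tendsto_norm_add_I)
  filter_upwards [eventually_atInfty_mem] with z hz
  rw [le_div_iff₀ (one_pos.trans_le (one_le_norm_add_I hz))]
  exact hC z hz

lemma not_isLittleO_self {R : Polynomial ℂ} (hR : ∀ z ∈ closedUpperHalf, R.eval z ≠ 0) :
    ¬ (fun z => R.eval z) =o[atInfty] fun z => R.eval z := by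
  intro h
  have h1 := (h.bound (half_pos one_pos)).and eventually_atInfty_mem
  obtain ⟨z, h1, hz⟩ := h1.exists
  have := norm_pos_iff.2 (hR z hz)
  linarith

/-- Degrees are recovered from limits at infinity. Functions built from determinants and inverse
matrices thus never need their degrees tracked: being rational with a known limit suffices. -/
lemma degree_le_of_tendsto {P R : Polynomial ℂ} (hR : ∀ z ∈ closedUpperHalf, R.eval z ≠ 0)
    {l : ℂ} (h : Tendsto (fun z => P.eval z / R.eval z) atInfty (𝓝 l)) : P.degree ≤ R.degree := by
  by_contra hlt
  have h1 := (Polynomial.isLittleO_cobounded_of_degree_lt (not_le.1 hlt)).mono atInfty_le_cobounded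
  have h2 : (fun z => P.eval z) =O[atInfty] fun z => R.eval z :=
    Asymptotics.isBigO_of_div_tendsto_nhds
      (eventually_atInfty_mem.mono fun z hz h0 => absurd h0 (hR z hz)) l h
  exact not_isLittleO_self hR (h1.trans_isBigO h2)

lemma degree_lt_of_tendsto_zero {P R : Polynomial ℂ}
    (hR : ∀ z ∈ closedUpperHalf, R.eval z ≠ 0)
    (h : Tendsto (fun z => P.eval z / R.eval z) atInfty (𝓝 0)) : P.degree < R.degree := by
  by_contra hlt
  have h1 := (Polynomial.isBigO_cobounded_of_degree_le (not_lt.1 hlt)).mono atInfty_le_cobounded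
  have h2 : (fun z => P.eval z) =o[atInfty] fun z => R.eval z :=
    (Asymptotics.isLittleO_iff_tendsto'
      (eventually_atInfty_mem.mono fun z hz h0 => absurd h0 (hR z hz))).2 h
  exact not_isLittleO_self hR (h1.trans_isLittleO h2)

lemma IsRat.bddHol {F : ℂ → ℂ} (hF : IsRat F) {l : ℂ} (h : Tendsto F atInfty (𝓝 l)) :
    BddHol F := by
  obtain ⟨P, R, hPR⟩ := hF
  refine (bddHol_div (fun z hz => (hPR z hz).1) (degree_le_of_tendsto (l := l)
    (fun z hz => (hPR z hz).1) (h.congr' ?_))).congr fun z hz => (hPR z hz).2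
  exact eventually_atInfty_mem.mono fun z hz => (hPR z hz).2

lemma IsRat.isRationalSymbol {F : ℂ → ℂ} (hF : IsRat F) (h : Tendsto F atInfty (𝓝 0)) :
    IsRationalSymbol F := by
  obtain ⟨P, R, hPR⟩ := hF
  exact ⟨P, R, degree_lt_of_tendsto_zero (fun z hz => (hPR z hz).1)
    (h.congr' (eventually_atInfty_mem.mono fun z hz => (hPR z hz).2)), hPR⟩

lemma bv_congr {F G : ℂ → ℂ} (h : ∀ x : ℝ, F x = G x) : bv F = bv G := by
  simp only [bv, h]

lemma bv_add {F G : ℂ → ℂ} (hF : Decaying F) (hG : Decaying G) :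
    bv (fun z => F z + G z) = bv F + bv G := toL2_add hF.memLp hG.memLp

lemma bv_sub {F G : ℂ → ℂ} (hF : Decaying F) (hG : Decaying G) :
    bv (fun z => F z - G z) = bv F - bv G := toL2_sub hF.memLp hG.memLp

lemma bv_const_mul {F : ℂ → ℂ} (c : ℂ) (hF : Decaying F) :
    bv (fun z => c * F z) = c • bv F := toL2_const_mul c hF.memLp

lemma bv_sum {ι : Type*} {s : Finset ι} {F : ι → ℂ → ℂ} (hF : ∀ i ∈ s, Decaying (F i)) :
    bv (fun z => ∑ i ∈ s, F i z) = ∑ i ∈ s, bv (F i) := by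
  classical
  induction s using Finset.induction_on with
  | empty =>
    simp only [Finset.sum_empty]
    have := bv_const_mul 0 decaying_zero
    simpa using this
  | insert i s hi ih =>
    simp only [Finset.sum_insert hi]
    rw [bv_add (hF i (Finset.mem_insert_self _ _))
      (Decaying.sum fun j hj => hF j (Finset.mem_insert_of_mem hj)),
      ih fun j hj => hF j (Finset.mem_insert_of_mem hj)]

lemma mulL2_bv {m F : ℂ → ℂ} (hm : BddHol m) (hF : Decaying F) :
    mulL2 (fun x : ℝ => m x) (bv F) = bv (fun z => m z * F z) :=
  mulL2_toL2 hm.memLp_real hF.memLp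

lemma inner_bv {F G : ℂ → ℂ} (hF : Decaying F) (hG : Decaying G) :
    inner ℂ (bv F) (bv G) = ∫ x : ℝ, starRingEnd ℂ (F x) * G x :=
  inner_toL2 hF.memLp hG.memLp

lemma integral_mul_eq_zero {F G : ℂ → ℂ} (hF : Decaying F) (hG : Decaying G) :
    ∫ x : ℝ, F x * G x = 0 := by
  rw [← inner_star_eq_zero hF.bv_mem hG.bv_mem]
  exact (inner_star_toL2 hF.memLp hG.memLp).symm

lemma eqOn_of_bv_eq {F G : ℂ → ℂ} (hF : Decaying F) (hG : Decaying G) (h : bv F = bv G) :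
    ∀ z ∈ upperHalf, F z = G z := fun _ hz =>
  hF.hasBoundaryValue.eq_of_same (h ▸ hG.hasBoundaryValue) hz

lemma eqOn_closed_of_eqOn {F G : ℂ → ℂ} (hF : ContinuousOn F closedUpperHalf)
    (hG : ContinuousOn G closedUpperHalf) (h : ∀ z ∈ upperHalf, F z = G z) :
    ∀ z ∈ closedUpperHalf, F z = G z := by
  intro z hz
  rcases lt_or_eq_of_le (show 0 ≤ z.im from hz) with hz' | hz'
  · exact h z hz'
  · have hzx : z = (z.re : ℂ) := Complex.ext (by simp) (by simp [← hz'])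
    rw [hzx]
    refine tendsto_nhds_unique (tendsto_slice_apply hF z.re) ?_
    refine (tendsto_slice_apply hG z.re).congr' ?_
    filter_upwards [self_mem_nhdsWithin] with y hy
    exact (h _ (mem_upperHalf_slice hy)).symm

/-! ### Blaschke products and their model spaces -/

/-- The polynomial with conjugate coefficients. -/
def conjPoly (P : Polynomial ℂ) : Polynomial ℂ := P.map (starRingEnd ℂ)

lemma conjPoly_eval (P : Polynomial ℂ) (z : ℂ) :
    (conjPoly P).eval (starRingEnd ℂ z) = starRingEnd ℂ (P.eval z) :=
  Polynomial.eval_map_apply _ _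

lemma conjPoly_eval_real (P : Polynomial ℂ) (x : ℝ) :
    (conjPoly P).eval (x : ℂ) = starRingEnd ℂ (P.eval (x : ℂ)) := by
  rw [← conjPoly_eval, Complex.conj_ofReal]

lemma conjPoly_conjPoly (P : Polynomial ℂ) : conjPoly (conjPoly P) = P := by
  rw [conjPoly, conjPoly, Polynomial.map_map]
  have : (starRingEnd ℂ).comp (starRingEnd ℂ) = RingHom.id ℂ := by
    ext x
    simp
  rw [this, Polynomial.map_id]

lemma conjPoly_degree (P : Polynomial ℂ) : (conjPoly P).degree = P.degree :=
  Polynomial.degree_map _ _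

/-- The monic polynomial with roots `a j`. -/
def rootPoly {m : ℕ} (a : Fin m → ℂ) : Polynomial ℂ :=
  ∏ j, (Polynomial.X - Polynomial.C (a j))

/-- The monic polynomial with roots `conj (a j)`. -/
def polePoly {m : ℕ} (a : Fin m → ℂ) : Polynomial ℂ :=
  ∏ j, (Polynomial.X - Polynomial.C (starRingEnd ℂ (a j)))

section Blaschke

variable {m : ℕ} {a : Fin m → ℂ} {ψ : ℂ → ℂ}

lemma conjPoly_polePoly : conjPoly (polePoly a) = rootPoly a := by
  simp [conjPoly, polePoly, rootPoly, Polynomial.map_prod]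

lemma conjPoly_rootPoly : conjPoly (rootPoly a) = polePoly a := by
  simp [conjPoly, polePoly, rootPoly, Polynomial.map_prod]

lemma rootPoly_monic : (rootPoly a).Monic :=
  Polynomial.monic_prod_of_monic _ _ fun _ _ => Polynomial.monic_X_sub_C _

lemma polePoly_monic : (polePoly a).Monic :=
  Polynomial.monic_prod_of_monic _ _ fun _ _ => Polynomial.monic_X_sub_C _

lemma rootPoly_degree : (rootPoly a).degree = m := by
  simp [rootPoly, Polynomial.degree_prod]

lemma polePoly_degree : (polePoly a).degree = m := by
  simp [polePoly, Polynomial.degree_prod]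

lemma rootPoly_coeff : (rootPoly a).coeff m = 1 := by
  have h := rootPoly_monic (a := a).coeff_natDegree
  rwa [Polynomial.natDegree_eq_of_degree_eq_some rootPoly_degree] at h

lemma polePoly_coeff : (polePoly a).coeff m = 1 := by
  have h := polePoly_monic (a := a).coeff_natDegree
  rwa [Polynomial.natDegree_eq_of_degree_eq_some polePoly_degree] at h

/-- `ψ` is the Blaschke product with zeros `a j`, normalised by `ψ(∞) = 1`. -/
structure IsBlaschke {m : ℕ} (a : Fin m → ℂ) (ψ : ℂ → ℂ) : Prop where
  im_pos : ∀ j, 0 < (a j).im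
  eq_div : ∀ z ∈ closedUpperHalf, ψ z = (rootPoly a).eval z / (polePoly a).eval z

namespace IsBlaschke

lemma eval_pole_ne (h : IsBlaschke a ψ) {z : ℂ} (hz : z ∈ closedUpperHalf) : (polePoly a).eval z ≠ 0 := by
  rw [polePoly, Polynomial.eval_prod]
  refine Finset.prod_ne_zero_iff.2 fun j _ h0 => ?_
  have h1 := congrArg Complex.im h0
  simp only [Polynomial.eval_sub, Polynomial.eval_X, Polynomial.eval_C, sub_im, conj_im,
    sub_neg_eq_add, zero_im] at h1
  have := h.im_pos j
  have hz' : 0 ≤ z.im := hz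
  linarith

lemma bddHol (h : IsBlaschke a ψ) : BddHol ψ :=
  (bddHol_div (fun _ hz => h.eval_pole_ne hz)
    (by rw [rootPoly_degree, polePoly_degree])).congr h.eq_div

lemma isRat (h : IsBlaschke a ψ) : IsRat ψ := (isRat_div fun _ hz => h.eval_pole_ne hz).congr h.eq_div

lemma _root_.SzegoHankel.rootPoly_eval_real (x : ℝ) :
    (rootPoly a).eval (x : ℂ) = starRingEnd ℂ ((polePoly a).eval (x : ℂ)) := by
  rw [← conjPoly_polePoly, conjPoly_eval_real]

lemma eval_pole_real_ne (h : IsBlaschke a ψ) (x : ℝ) : (polePoly a).eval (x : ℂ) ≠ 0 :=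
  h.eval_pole_ne (ofReal_mem_closed x)

lemma conj_mul_self_real (h : IsBlaschke a ψ) (x : ℝ) : starRingEnd ℂ (ψ x) * ψ x = 1 := by
  have h1 := h.eval_pole_real_ne x
  have h2 : starRingEnd ℂ ((polePoly a).eval (x : ℂ)) ≠ 0 := (map_ne_zero _).2 h1
  rw [h.eq_div _ (ofReal_mem_closed x), rootPoly_eval_real, map_div₀, Complex.conj_conj]
  field_simp

lemma eq_prod (h : IsBlaschke a ψ) {z : ℂ} (hz : z ∈ closedUpperHalf) :
    ψ z = ∏ j, (z - a j) / (z - starRingEnd ℂ (a j)) := by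
  rw [h.eq_div z hz, rootPoly, polePoly, Polynomial.eval_prod, Polynomial.eval_prod,
    Finset.prod_div_distrib]
  simp

lemma sub_conj_ne (h : IsBlaschke a ψ) {z : ℂ} (hz : z ∈ closedUpperHalf) (j : Fin m) :
    z - starRingEnd ℂ (a j) ≠ 0 := by
  intro h0
  have h1 := congrArg Complex.im h0
  simp only [sub_im, conj_im, sub_neg_eq_add, zero_im] at h1
  have := h.im_pos j
  have hz' : 0 ≤ z.im := hz
  linarith

lemma _root_.SzegoHankel.norm_sub_conj_sq (z : ℂ) (j : Fin m) :
    ‖z - starRingEnd ℂ (a j)‖ ^ 2 - ‖z - a j‖ ^ 2 = 4 * z.im * (a j).im := by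
  rw [← Complex.normSq_eq_norm_sq, ← Complex.normSq_eq_norm_sq, Complex.normSq_apply,
    Complex.normSq_apply]
  simp only [sub_re, sub_im, conj_re, conj_im]
  ring

lemma norm_factor_le (h : IsBlaschke a ψ) {z : ℂ} (hz : z ∈ closedUpperHalf) (j : Fin m) :
    ‖(z - a j) / (z - starRingEnd ℂ (a j))‖ ≤ 1 := by
  have hz' : 0 ≤ z.im := hz
  rw [norm_div, div_le_one (norm_pos_iff.2 (h.sub_conj_ne hz j))]
  refine le_of_sq_le_sq ?_ (norm_nonneg _)
  have h1 := norm_sub_conj_sq (a := a) z j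
  have := mul_nonneg hz' (h.im_pos j).le
  linarith

lemma norm_lt_one (h : IsBlaschke a ψ) (hm : 0 < m) {z : ℂ} (hz : z ∈ upperHalf) : ‖ψ z‖ < 1 := by
  have hz' : 0 < z.im := hz
  have hzc := upperHalf_subset_closed hz
  rw [h.eq_prod hzc, norm_prod, ← Finset.mul_prod_erase _ _ (Finset.mem_univ (⟨0, hm⟩ : Fin m))]
  refine mul_lt_one_of_nonneg_of_lt_one_left (norm_nonneg _) ?_
    (Finset.prod_le_one (fun _ _ => norm_nonneg _) fun j _ => h.norm_factor_le hzc j)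
  rw [norm_div, div_lt_one (norm_pos_iff.2 (h.sub_conj_ne hzc _))]
  refine lt_of_pow_lt_pow_left₀ 2 (norm_nonneg _) ?_
  have h1 := norm_sub_conj_sq (a := a) z ⟨0, hm⟩
  have := mul_pos hz' (h.im_pos ⟨0, hm⟩)
  linarith

/-- The rational function with denominator `polePoly a`. -/
def _root_.SzegoHankel.modelFun {m : ℕ} (a : Fin m → ℂ) (S : Polynomial ℂ) (z : ℂ) : ℂ :=
  S.eval z / (polePoly a).eval z

end IsBlaschke

end Blaschke

namespace IsBlaschke

variable {m : ℕ} {a : Fin m → ℂ} {ψ : ℂ → ℂ}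

lemma decaying_modelFun (h : IsBlaschke a ψ) {S : Polynomial ℂ} (hS : S.degree < m) :
    Decaying (modelFun a S) :=
  decaying_div (fun _ hz => h.eval_pole_ne hz) (by rwa [polePoly_degree])

lemma bv_modelFun_add (h : IsBlaschke a ψ) {S T : Polynomial ℂ} (hS : S.degree < m)
    (hT : T.degree < m) :
    bv (modelFun a (S + T)) = bv (modelFun a S) + bv (modelFun a T) := by
  rw [← bv_add (h.decaying_modelFun hS) (h.decaying_modelFun hT)]
  exact bv_congr fun x => by simp [modelFun, add_div]

lemma bv_modelFun_smul (h : IsBlaschke a ψ) {S : Polynomial ℂ} (c : ℂ) (hS : S.degree < m) :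
    bv (modelFun a (c • S)) = c • bv (modelFun a S) := by
  rw [← bv_const_mul c (h.decaying_modelFun hS)]
  exact bv_congr fun x => by simp [modelFun, mul_div_assoc]

/-- On the real line `ψ` is the conjugate of `polePoly a` over `polePoly a`. So the antilinear
conjugation `f ↦ ψ conj f` of the model space just conjugates the coefficients of the numerator. -/
lemma modelFun_conjPoly (h : IsBlaschke a ψ) (S : Polynomial ℂ) (x : ℝ) :
    modelFun a (conjPoly S) x = ψ x * starRingEnd ℂ (modelFun a S x) := by
  have h1 := h.eval_pole_real_ne x
  have h2 : starRingEnd ℂ ((polePoly a).eval (x : ℂ)) ≠ 0 := (map_ne_zero _).2 h1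
  rw [modelFun, modelFun, h.eq_div _ (ofReal_mem_closed x), rootPoly_eval_real, map_div₀,
    conjPoly_eval_real]
  field_simp

lemma _root_.SzegoHankel.mem_model_iff {ψ : ℂ → ℂ} (f : L2) : f ∈ model ψ ↔
    f ∈ hardy ∧ ∀ g ∈ hardy, inner ℂ (mulL2 (fun x : ℝ => ψ x) g) f = 0 := by
  rw [model, Submodule.mem_inf, Submodule.mem_orthogonal]
  refine and_congr_right fun _ => ⟨fun H g hg => H _ ⟨g, hg, rfl⟩, ?_⟩
  rintro H _ ⟨g, hg, rfl⟩
  exact H g hg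

/-- Pairing `f` with `ψ g` gives, up to conjugation, `∫ (ψ conj f) g`. This vanishes because `ψ conj
f` is again a decaying function of the same kind. -/
lemma bv_modelFun_mem (h : IsBlaschke a ψ) {S : Polynomial ℂ} (hS : S.degree < m) :
    bv (modelFun a S) ∈ model ψ := by
  have hS' : (conjPoly S).degree < m := by rwa [conjPoly_degree]
  refine (mem_model_iff _).2 ⟨(h.decaying_modelFun hS).bv_mem, fun g hg => ?_⟩
  have h0 := inner_star_eq_zero (h.decaying_modelFun hS').bv_mem hg
  rw [← inner_conj_symm, map_eq_zero, ← h0, inner_eq_integral, inner_star_eq_integral]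
  refine integral_congr_ae ?_
  filter_upwards [mulL2_coeFn h.bddHol.memLp_real g, toL2_coeFn (h.decaying_modelFun hS).memLp,
    toL2_coeFn (h.decaying_modelFun hS').memLp] with x h1 h2 h3
  have h2' : bv (modelFun a S) x = modelFun a S x := h2
  have h3' : bv (modelFun a (conjPoly S)) x = modelFun a (conjPoly S) x := h3
  rw [h1, h2', h3', h.modelFun_conjPoly]
  ring

/-- The numerator `polePoly a - conj(ψ w) rootPoly a` vanishes at `conj w`. Dividing out this root
lowers the degree below `m`. -/
lemma exists_kernelPoly (h : IsBlaschke a ψ) {w : ℂ} (hw : w ∈ upperHalf) :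
    ∃ S : Polynomial ℂ, S.degree < m ∧ ∀ z ∈ closedUpperHalf,
      modelFun a S z = (1 - ψ z * starRingEnd ℂ (ψ w)) * (z - starRingEnd ℂ w)⁻¹ := by
  set N : Polynomial ℂ := polePoly a - Polynomial.C (starRingEnd ℂ (ψ w)) * rootPoly a with hN
  have hwc := upperHalf_subset_closed hw
  have hroot : N.IsRoot (starRingEnd ℂ w) := by
    have h1 : (rootPoly a).eval (starRingEnd ℂ w) = starRingEnd ℂ ((polePoly a).eval w) := by
      rw [← conjPoly_polePoly, conjPoly_eval]
    have h2 : (polePoly a).eval (starRingEnd ℂ w) = starRingEnd ℂ ((rootPoly a).eval w) := by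
      rw [← conjPoly_rootPoly, conjPoly_eval]
    have h3 : starRingEnd ℂ ((polePoly a).eval w) ≠ 0 := (map_ne_zero _).2 (h.eval_pole_ne hwc)
    rw [Polynomial.IsRoot, hN, Polynomial.eval_sub, Polynomial.eval_mul, Polynomial.eval_C, h1, h2,
      h.eq_div w hwc, map_div₀]
    field_simp
    simp
  obtain ⟨S, hS⟩ := Polynomial.dvd_iff_isRoot.2 hroot
  have hNd : N.degree ≤ m := by
    refine (Polynomial.degree_sub_le _ _).trans (max_le polePoly_degree.le ?_)
    refine (Polynomial.degree_mul_le _ _).trans ?_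
    rw [rootPoly_degree]
    calc (Polynomial.C (starRingEnd ℂ (ψ w))).degree + (m : WithBot ℕ) ≤ 0 + m :=
          add_le_add_left Polynomial.degree_C_le _
      _ = m := zero_add _
  refine ⟨S, ?_, fun z hz => ?_⟩
  · by_cases hS0 : S = 0
    · rw [hS0, Polynomial.degree_zero]
      exact WithBot.bot_lt_coe m
    · rw [hS, Polynomial.degree_mul, Polynomial.degree_X_sub_C,
        Polynomial.degree_eq_natDegree hS0] at hNd
      rw [Polynomial.degree_eq_natDegree hS0]
      have : 1 + S.natDegree ≤ m := by exact_mod_cast hNd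
      exact_mod_cast (show S.natDegree < m by omega)
  · have hne : z - starRingEnd ℂ w ≠ 0 := by
      intro h0
      have h1 := congrArg Complex.im h0
      simp only [sub_im, conj_im, sub_neg_eq_add, zero_im] at h1
      have hz' : 0 ≤ z.im := hz
      have hw' : 0 < w.im := hw
      linarith
    have h1 := congrArg (Polynomial.eval z) hS
    rw [hN] at h1
    simp only [Polynomial.eval_sub, Polynomial.eval_mul, Polynomial.eval_C,
      Polynomial.eval_X] at h1
    have h2 := h.eval_pole_ne hz
    rw [modelFun, h.eq_div z hz]
    field_simp
    linear_combination -h1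

/-- The reproducing kernel of the model space at `w`, up to the factor `i / 2π`. -/
def _root_.SzegoHankel.modelKernel (ψ : ℂ → ℂ) (w z : ℂ) : ℂ :=
  (1 - ψ z * starRingEnd ℂ (ψ w)) * (z - starRingEnd ℂ w)⁻¹

lemma decaying_modelKernel (h : IsBlaschke a ψ) {w : ℂ} (hw : w ∈ upperHalf) :
    Decaying (modelKernel ψ w) := by
  obtain ⟨S, hS, hS'⟩ := h.exists_kernelPoly hw
  exact (h.decaying_modelFun hS).congr fun z hz => (hS' z hz).symm

lemma inner_modelKernel (h : IsBlaschke a ψ) {f : L2} (hf : f ∈ model ψ) {F : ℂ → ℂ}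
    (hF : HasBoundaryValue F f) {w : ℂ} (hw : w ∈ upperHalf) :
    inner ℂ (bv (modelKernel ψ w)) f = 2 * Real.pi * I * F w := by
  have hk := decaying_cauchyKernel hw
  have e : bv (modelKernel ψ w) = cauchyKernel w
      - starRingEnd ℂ (ψ w) • mulL2 (fun x : ℝ => ψ x) (cauchyKernel w) := by
    rw [cauchyKernel, mulL2_bv h.bddHol hk, ← bv_const_mul _ (h.bddHol.mul_decaying hk),
      ← bv_sub hk ((h.bddHol.mul_decaying hk).const_mul _)]
    exact bv_congr fun x => by
      rw [modelKernel]
      ring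
  have h0 : inner ℂ (mulL2 (fun x : ℝ => ψ x) (cauchyKernel w)) f = 0 :=
    ((mem_model_iff f).1 hf).2 _ hk.bv_mem
  rw [e, inner_sub_left, inner_smul_left, h0, mul_zero, sub_zero, inner_cauchyKernel hF hw]

lemma eq_zero_of_inner_modelKernel (h : IsBlaschke a ψ) {f : L2} (hf : f ∈ model ψ)
    (h0 : ∀ w ∈ upperHalf, inner ℂ (bv (modelKernel ψ w)) f = 0) : f = 0 := by
  obtain ⟨F, hF⟩ := ((mem_model_iff f).1 hf).1
  refine hF.unique HasBoundaryValue.zero fun w hw => ?_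
  have h1 := h0 w hw
  rw [h.inner_modelKernel hf hF hw] at h1
  have : (2 * Real.pi * I : ℂ) ≠ 0 := by simp [Real.pi_ne_zero]
  exact (mul_eq_zero.1 h1).resolve_left this

/-- The parametrization of the model space by numerators. -/
def modelMap (h : IsBlaschke a ψ) : Polynomial.degreeLT ℂ m →ₗ[ℂ] L2 where
  toFun := fun S => bv (modelFun a S)
  map_add' := fun S T => h.bv_modelFun_add (Polynomial.mem_degreeLT.1 S.2)
    (Polynomial.mem_degreeLT.1 T.2)
  map_smul' := fun c S => h.bv_modelFun_smul c (Polynomial.mem_degreeLT.1 S.2)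

instance finiteDimensional_degreeLT (m : ℕ) : Module.Finite ℂ (Polynomial.degreeLT ℂ m) :=
  Module.Finite.equiv (Polynomial.degreeLTEquiv ℂ m).symm

/-- Every element of the model space is a rational function with denominator `polePoly a`. -/
lemma exists_modelFun (h : IsBlaschke a ψ) {f : L2} (hf : f ∈ model ψ) :
    ∃ S : Polynomial ℂ, S.degree < m ∧ f = bv (modelFun a S) := by
  set V := LinearMap.range h.modelMap with hV
  have hVK : V ≤ model ψ := by
    rintro _ ⟨S, rfl⟩
    exact h.bv_modelFun_mem (Polynomial.mem_degreeLT.1 S.2)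
  have hPV : V.starProjection f ∈ V := Submodule.starProjection_apply_mem _ _
  have hg : f - V.starProjection f ∈ model ψ := sub_mem hf (hVK hPV)
  -- The part of `f` orthogonal to the finite-dimensional space of such quotients is orthogonal to
  -- all reproducing kernels, so its extension vanishes throughout the upper half-plane.
  have h0 := h.eq_zero_of_inner_modelKernel hg fun w hw => by
    obtain ⟨S, hS, hS'⟩ := h.exists_kernelPoly hw
    have hmem : bv (modelKernel ψ w) ∈ V :=
      ⟨⟨S, Polynomial.mem_degreeLT.2 hS⟩, bv_congr fun x => hS' x (ofReal_mem_closed x)⟩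
    exact (Submodule.mem_orthogonal _ _).1 (V.sub_starProjection_mem_orthogonal f) _ hmem
  rw [sub_eq_zero.1 h0] 
  obtain ⟨S, hS⟩ := hPV
  exact ⟨S, Polynomial.mem_degreeLT.1 S.2, hS.symm⟩

lemma modelKernel_mem (h : IsBlaschke a ψ) {w : ℂ} (hw : w ∈ upperHalf) :
    bv (modelKernel ψ w) ∈ model ψ := by
  obtain ⟨S, hS, hS'⟩ := h.exists_kernelPoly hw
  have e : bv (modelKernel ψ w) = bv (modelFun a S) :=
    bv_congr fun x => (hS' x (ofReal_mem_closed x)).symm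
  rw [e]
  exact h.bv_modelFun_mem hS

/-- A closed-under-projection subspace containing all reproducing kernels contains the model
space. -/
lemma model_le_of_kernels (h : IsBlaschke a ψ) {V : Submodule ℂ L2} [FiniteDimensional ℂ V]
    (hV : ∀ w ∈ upperHalf, bv (modelKernel ψ w) ∈ V) : model ψ ≤ V := by
  intro f hf
  have hfin : FiniteDimensional ℂ ↥(V ⊓ model ψ) :=
    Submodule.finiteDimensional_of_le inf_le_left
  -- Intersecting with the model space keeps the remainder of `f` in the model space, where the
  -- kernels reproduce values.
  set W : Submodule ℂ L2 := V ⊓ model ψ with hW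
  have hPV : W.starProjection f ∈ W := Submodule.starProjection_apply_mem _ _
  have h0 := h.eq_zero_of_inner_modelKernel (sub_mem hf hPV.2) fun w hw =>
    (Submodule.mem_orthogonal _ _).1 (W.sub_starProjection_mem_orthogonal f) _
      ⟨hV w hw, h.modelKernel_mem hw⟩
  rw [sub_eq_zero.1 h0]
  exact hPV.1

lemma finiteDimensional_model (h : IsBlaschke a ψ) : FiniteDimensional ℂ (model ψ) := by
  refine Submodule.finiteDimensional_of_le (S₂ := LinearMap.range h.modelMap) fun f hf => ?_
  obtain ⟨S, hS, rfl⟩ := h.exists_modelFun hf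
  exact ⟨⟨S, Polynomial.mem_degreeLT.2 hS⟩, rfl⟩

end IsBlaschke

/-! ### The infinitesimal generator on a model space -/

/-- The numerator of `A f`, where `f` has numerator `S` and `A` is the generator. -/
def genPoly {m : ℕ} (a : Fin m → ℂ) (S : Polynomial ℂ) : Polynomial ℂ :=
  Polynomial.X * S - Polynomial.C (S.coeff (m - 1)) * rootPoly a

/-- The numerator of `A* f`, where `f` has numerator `S` and `A` is the generator. -/
def adjPoly {m : ℕ} (a : Fin m → ℂ) (S : Polynomial ℂ) : Polynomial ℂ :=
  Polynomial.X * S - Polynomial.C (S.coeff (m - 1)) * polePoly a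

lemma degree_X_mul_sub_lt {m : ℕ} {S T : Polynomial ℂ} (hS : S.degree < m)
    (hT : T.degree = m) (hT1 : T.coeff m = 1) :
    (Polynomial.X * S - Polynomial.C (S.coeff (m - 1)) * T).degree < (m : WithBot ℕ) := by
  rw [Polynomial.degree_lt_iff_coeff_zero] at hS ⊢
  intro k hk
  -- For `m = 0` the truncated index `m - 1` is `0`, but then `S = 0`. Otherwise the coefficient
  -- `S.coeff (m - 1)` is exactly what cancels the term of degree `m`.
  rcases Nat.eq_zero_or_pos m with hm | hm
  · have hS0 : S = 0 := by
      ext n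
      exact hS n (hm ▸ Nat.zero_le n)
    simp [hS0]
  · obtain ⟨k', rfl⟩ : ∃ k', k = k' + 1 := ⟨k - 1, by omega⟩
    rw [Polynomial.coeff_sub, Polynomial.coeff_X_mul, Polynomial.coeff_C_mul]
    rcases eq_or_lt_of_le hk with hk' | hk'
    · rw [← hk', hT1, mul_one, hk', Nat.add_sub_cancel, sub_self]
    · have hTk : T.coeff (k' + 1) = 0 :=
        Polynomial.coeff_eq_zero_of_degree_lt (by rw [hT]; exact_mod_cast hk')
      rw [hS k' (by omega), hTk, mul_zero, sub_self]

lemma integrable_mul_of_decaying {F G : ℂ → ℂ} (hF : Decaying F) (hG : Decaying G) :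
    Integrable fun x : ℝ => F x * G x := hF.memLp.integrable_mul hG.memLp

lemma bddHol_exp {τ : ℝ} (hτ : 0 ≤ τ) : BddHol fun z => exp (I * τ * z) := by
  refine ⟨by fun_prop, by fun_prop, 1, fun z hz => ?_⟩
  have hz' : 0 ≤ z.im := hz
  rw [Complex.norm_exp, Real.exp_le_one_iff]
  simp only [mul_re, I_re, ofReal_re, I_im, ofReal_im, zero_mul, mul_zero, sub_self, mul_im,
    one_mul, zero_add]
  nlinarith [mul_nonneg hτ hz']

namespace IsBlaschke

variable {m : ℕ} {a : Fin m → ℂ} {ψ : ℂ → ℂ}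

lemma _root_.SzegoHankel.degree_genPoly_lt {S : Polynomial ℂ} (hS : S.degree < m) :
    (genPoly a S).degree < m := degree_X_mul_sub_lt hS rootPoly_degree rootPoly_coeff

lemma _root_.SzegoHankel.degree_adjPoly_lt {S : Polynomial ℂ} (hS : S.degree < m) :
    (adjPoly a S).degree < m := degree_X_mul_sub_lt hS polePoly_degree polePoly_coeff

lemma modelFun_genPoly (h : IsBlaschke a ψ) (S : Polynomial ℂ) {z : ℂ}
    (hz : z ∈ closedUpperHalf) :
    modelFun a (genPoly a S) z = z * modelFun a S z - S.coeff (m - 1) * ψ z := by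
  rw [modelFun, modelFun, h.eq_div z hz, genPoly]
  simp only [Polynomial.eval_sub, Polynomial.eval_mul, Polynomial.eval_X, Polynomial.eval_C]
  ring

lemma modelFun_adjPoly (h : IsBlaschke a ψ) (S : Polynomial ℂ) {z : ℂ}
    (hz : z ∈ closedUpperHalf) :
    modelFun a (adjPoly a S) z = z * modelFun a S z - S.coeff (m - 1) := by
  have := h.eval_pole_ne hz
  rw [modelFun, modelFun, adjPoly]
  simp only [Polynomial.eval_sub, Polynomial.eval_mul, Polynomial.eval_X, Polynomial.eval_C]
  field_simp

lemma proj_model_mul (h : IsBlaschke a ψ) {F : ℂ → ℂ} (hF : Decaying F) :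
    proj (model ψ) (bv fun z => ψ z * F z) = 0 := by
  refine proj_eq_of_mem (zero_mem _) fun g hg => ?_
  rw [sub_zero, ← mulL2_bv h.bddHol hF, ← inner_conj_symm,
    ((mem_model_iff g).1 hg).2 _ hF.bv_mem, map_zero]

/-- The limit should be the projection of `x f`, but `x f` need not be square-integrable. Writing `f
= c ψ / (z + i) + ρ` repairs this. After multiplication by `e^{iτx} - 1` the first term lies in `ψ
H²` and is projected to zero, while `x ρ` is square-integrable and dominated convergence applies.
Modulo `ψ H²` the function `x ρ` equals `x f - c ψ`. -/
lemma tendsto_diffQuot (h : IsBlaschke a ψ) {S : Polynomial ℂ} (hS : S.degree < m) :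
    Tendsto (diffQuot ψ (bv (modelFun a S))) (𝓝[>] 0) (𝓝 (bv (modelFun a (genPoly a S)))) := by
  set c := S.coeff (m - 1) with hc
  set f := modelFun a S with hf
  set g := modelFun a (genPoly a S) with hg
  have hfd : Decaying f := h.decaying_modelFun hS
  have hgd : Decaying g := h.decaying_modelFun (degree_genPoly_lt hS)
  have hId : Decaying fun z => (z + I)⁻¹ := by
    simpa only [sub_neg_eq_add] using decaying_inv_sub (c := -I) (by simp)
  have hgf : ∀ z ∈ closedUpperHalf, g z = z * f z - c * ψ z := fun z hz => h.modelFun_genPoly S hz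
  set ρ : ℂ → ℂ := fun z => (g z + I * f z) * (z + I)⁻¹ with hρ
  have hρd : Decaying ρ := (hgd.add (hfd.const_mul I)).bddHol.mul_decaying hId
  have hfρ : ∀ z ∈ closedUpperHalf, f z = c * ψ z * (z + I)⁻¹ + ρ z := by
    intro z hz
    have := add_I_ne_zero hz
    rw [hρ]
    simp only
    rw [hgf z hz]
    field_simp
    ring
  have hm1 : ∀ τ : ℝ, 0 ≤ τ → BddHol fun z => exp (I * τ * z) - 1 := fun τ hτ =>
    ((bddHol_exp hτ).add (bddHol_const (-1))).congr fun z _ => sub_eq_add_neg _ _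
  have hquot : ∀ τ : ℝ, 0 < τ → diffQuot ψ (bv f) τ
      = proj (model ψ) (toL2 fun x : ℝ => (I * (τ : ℂ))⁻¹ * (exp (I * τ * x) - 1) * ρ x) := by
    intro τ hτ
    have hk : Decaying fun z => c * (exp (I * τ * z) - 1) * (z + I)⁻¹ :=
      ((bddHol_const c).mul (hm1 τ hτ.le)).mul_decaying hId
    have hr : Decaying fun z => (exp (I * τ * z) - 1) * ρ z := (hm1 τ hτ.le).mul_decaying hρd
    have e1 : mulL2 (fun x : ℝ => exp (I * τ * x)) (bv f)
        = bv f + (bv (fun z => ψ z * (c * (exp (I * τ * z) - 1) * (z + I)⁻¹))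
          + bv (fun z => (exp (I * τ * z) - 1) * ρ z)) := by
      rw [mulL2_bv (bddHol_exp hτ.le) hfd, ← bv_add (h.bddHol.mul_decaying hk) hr,
        ← bv_add hfd ((h.bddHol.mul_decaying hk).add hr)]
      refine bv_congr fun x => ?_
      have := hfρ x (ofReal_mem_closed x)
      linear_combination (exp (I * τ * x) - 1) * this
    have e2 : bv (fun z => (I * (τ : ℂ))⁻¹ * ((exp (I * τ * z) - 1) * ρ z))
        = toL2 fun x : ℝ => (I * (τ : ℂ))⁻¹ * (exp (I * τ * x) - 1) * ρ x := by
      rw [bv]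
      congr 1
      funext x
      ring
    rw [diffQuot, semigroup, e1, map_add, map_add, h.proj_model_mul hk,
      proj_eq_self (h.bv_modelFun_mem hS), zero_add, add_sub_cancel_left, ← e2,
      bv_const_mul _ hr, map_smul]
  have hlim := tendsto_toL2 (l := 𝓝[>] (0 : ℝ))
    (F := fun τ x => (I * (τ : ℂ))⁻¹ * (exp (I * τ * x) - 1) * ρ x) (f := fun x => x * ρ x)
    (B := fun x => ‖g x + I * f x‖) (hgd.add (hfd.const_mul I)).memLp.norm ?_ ?_ ?_
  · have e3 : toL2 (fun x : ℝ => (x : ℂ) * ρ x)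
        = bv g + bv (fun z => ψ z * ((I * c) * (z + I)⁻¹)) := by
      rw [← bv_add hgd (h.bddHol.mul_decaying (hId.const_mul _)), bv]
      congr 1
      funext x
      have h1 := hfρ x (ofReal_mem_closed x)
      have h2 : ρ x * (x + I) = g x + I * f x := by
        have := add_I_ne_zero (ofReal_mem_closed x)
        rw [hρ]
        field_simp
      linear_combination h2 + I * h1
    have h4 := ((proj (model ψ)).continuous.tendsto _).comp hlim.2
    rw [e3, map_add, h.proj_model_mul (hId.const_mul _), add_zero,
      proj_eq_self (h.bv_modelFun_mem (degree_genPoly_lt hS))] at h4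
    refine h4.congr' ?_
    filter_upwards [self_mem_nhdsWithin] with τ hτ
    exact (hquot τ hτ).symm
  · filter_upwards [self_mem_nhdsWithin] with τ hτ
    have hτ' : (0 : ℝ) < τ := hτ
    exact (((bddHol_const (I * (τ : ℂ))⁻¹).mul (hm1 τ hτ'.le)).mul_decaying hρd).memLp.1
  · filter_upwards [self_mem_nhdsWithin] with τ hτ
    have hτ' : (0 : ℝ) < τ := hτ
    refine Eventually.of_forall fun x => ?_
    have h1 : ‖exp (I * τ * x) - 1‖ ≤ τ * |x| := by
      have := Real.norm_exp_I_mul_ofReal_sub_one_le (x := τ * x)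
      rw [norm_mul, Real.norm_of_nonneg hτ'.le, Real.norm_eq_abs] at this
      rwa [show I * (τ : ℂ) * x = I * ((τ * x : ℝ) : ℂ) by push_cast; ring]
    have h2 : |x| ≤ ‖(x : ℂ) + I‖ := by
      have := Complex.abs_re_le_norm ((x : ℂ) + I)
      simpa using this
    have h3 : 0 < ‖(x : ℂ) + I‖ := one_pos.trans_le (one_le_norm_add_I (ofReal_mem_closed x))
    rw [norm_mul, norm_mul, norm_inv, norm_mul, norm_I, one_mul, Complex.norm_real,
      Real.norm_of_nonneg hτ'.le, hρ]
    simp only [norm_mul, norm_inv]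
    have h4 : τ⁻¹ * ‖exp (I * τ * x) - 1‖ ≤ ‖(x : ℂ) + I‖ := by
      rw [inv_mul_le_iff₀ hτ']
      exact h1.trans (mul_le_mul_of_nonneg_left h2 hτ'.le)
    calc τ⁻¹ * ‖exp (I * τ * x) - 1‖ * (‖g x + I * f x‖ * ‖(x : ℂ) + I‖⁻¹)
        ≤ ‖(x : ℂ) + I‖ * (‖g x + I * f x‖ * ‖(x : ℂ) + I‖⁻¹) := by gcongr
      _ = ‖g x + I * f x‖ := by field_simp
  · refine Eventually.of_forall fun x => Tendsto.mul_const _ ?_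
    have hd : HasDerivAt (fun t : ℝ => exp (I * t * x)) (I * x) 0 := by
      have h1 : HasDerivAt (fun t : ℝ => I * (t : ℂ) * x) (I * x) 0 := by
        simpa using ((Complex.ofRealCLM.hasDerivAt (x := (0 : ℝ))).const_mul I).mul_const (x : ℂ)
      simpa using h1.cexp
    have h2 := (hd.tendsto_slope_zero_right).const_mul (I⁻¹)
    simp only [ofReal_zero, mul_zero, zero_mul, exp_zero, zero_add, Complex.real_smul,
      ofReal_inv] at h2
    rw [inv_mul_cancel_left₀ I_ne_zero] at h2
    refine h2.congr fun τ => ?_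
    rw [mul_inv]
    ring_nf

lemma generator_modelFun (h : IsBlaschke a ψ) {S : Polynomial ℂ} (hS : S.degree < m) :
    generator ψ (bv (modelFun a S)) = bv (modelFun a (genPoly a S)) :=
  (h.tendsto_diffQuot hS).limUnder_eq

lemma isGenerator (h : IsBlaschke a ψ) : IsGenerator ψ (generator ψ) := by
  intro f hf
  obtain ⟨S, hS, rfl⟩ := h.exists_modelFun hf
  rw [h.generator_modelFun hS]
  exact ⟨h.bv_modelFun_mem (degree_genPoly_lt hS), h.tendsto_diffQuot hS⟩

/-- This isolates the leading term at infinity. The remainder is a product of two decaying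
functions, so its integral over the line is zero. -/
lemma modelFun_eq_inv_add_I (h : IsBlaschke a ψ) (S : Polynomial ℂ) {z : ℂ}
    (hz : z ∈ closedUpperHalf) :
    modelFun a S z = S.coeff (m - 1) * (z + I)⁻¹
      + (modelFun a (adjPoly a S) z + I * modelFun a S z) * (z + I)⁻¹ := by
  have := add_I_ne_zero hz
  rw [h.modelFun_adjPoly S hz]
  field_simp
  ring

lemma _root_.SzegoHankel.decaying_inv_add_I : Decaying fun z => (z + I)⁻¹ := by
  simpa only [sub_neg_eq_add] using decaying_inv_sub (c := -I) (by simp)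

lemma integral_modelFun_eq_zero (h : IsBlaschke a ψ) {S : Polynomial ℂ} (hS : S.degree < m)
    (hc : S.coeff (m - 1) = 0) : ∫ x : ℝ, modelFun a S x = 0 := by
  rw [← integral_mul_eq_zero ((h.decaying_modelFun (degree_adjPoly_lt hS)).add
    ((h.decaying_modelFun hS).const_mul I)) decaying_inv_add_I]
  refine integral_congr_ae (Eventually.of_forall fun x => ?_)
  have := h.modelFun_eq_inv_add_I S (ofReal_mem_closed x)
  rwa [hc, zero_mul, zero_add] at this

/-- The operator with numerators `adjPoly` is adjoint to the generator. -/
lemma inner_adjPoly (h : IsBlaschke a ψ) {S T : Polynomial ℂ} (hS : S.degree < m)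
    (hT : T.degree < m) : (inner ℂ (bv (modelFun a (adjPoly a T))) (bv (modelFun a S)) : ℂ)
      = inner ℂ (bv (modelFun a T)) (bv (modelFun a (genPoly a S))) := by
  have hS' := h.decaying_modelFun hS
  have hT' := h.decaying_modelFun hT
  have hA := h.decaying_modelFun (degree_genPoly_lt (a := a) hS)
  have hB := h.decaying_modelFun (degree_adjPoly_lt (a := a) hT)
  have hi1 : Integrable fun x : ℝ => starRingEnd ℂ (modelFun a (adjPoly a T) x) * modelFun a S x :=
    hB.memLp.star.integrable_mul hS'.memLp
  have hi2 : Integrable fun x : ℝ => starRingEnd ℂ (modelFun a T x) * modelFun a (genPoly a S) x :=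
    hT'.memLp.star.integrable_mul hA.memLp
  rw [← sub_eq_zero, inner_bv hB hS', inner_bv hT' hA, ← integral_sub hi1 hi2]
  set cS := S.coeff (m - 1) with hcS
  set cT := T.coeff (m - 1) with hcT
  -- The terms with a factor `x` cancel in the difference of the two integrands, leaving the
  -- quotient with numerator `N`. The leading coefficients cancel in `N`, so its integral vanishes.
  set N : Polynomial ℂ := cS • conjPoly T - starRingEnd ℂ cT • S with hN
  have hNd : N.degree < m := by
    refine (Polynomial.degree_sub_le _ _).trans_lt (max_lt ?_ ?_)
    · refine (Polynomial.degree_smul_le _ _).trans_lt ?_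
      rwa [conjPoly_degree]
    · exact (Polynomial.degree_smul_le _ _).trans_lt hS
  have hNc : N.coeff (m - 1) = 0 := by
    rw [hN, Polynomial.coeff_sub, Polynomial.coeff_smul, Polynomial.coeff_smul, conjPoly,
      Polynomial.coeff_map, ← hcS, ← hcT, smul_eq_mul, smul_eq_mul]
    ring
  rw [← h.integral_modelFun_eq_zero hNd hNc]
  refine integral_congr_ae (Eventually.of_forall fun x => ?_)
  have hx := ofReal_mem_closed x
  have e : modelFun a N x = cS * modelFun a (conjPoly T) x - starRingEnd ℂ cT * modelFun a S x := by
    rw [hN]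
    simp only [modelFun, Polynomial.eval_sub, Polynomial.eval_smul, smul_eq_mul]
    ring
  simp only
  rw [e, h.modelFun_conjPoly, h.modelFun_genPoly S hx, h.modelFun_adjPoly T hx, map_sub, map_mul,
    Complex.conj_ofReal]
  ring

/-! ### The element 1 - ψ of the model space -/

lemma degree_oneSub_lt : (polePoly a - rootPoly a).degree < m := by
  rw [← polePoly_degree (a := a)]
  refine Polynomial.degree_sub_lt_left (by rw [polePoly_degree, rootPoly_degree])
    polePoly_monic.ne_zero ?_
  rw [polePoly_monic.leadingCoeff, rootPoly_monic.leadingCoeff]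

lemma modelFun_oneSub (h : IsBlaschke a ψ) {z : ℂ} (hz : z ∈ closedUpperHalf) :
    modelFun a (polePoly a - rootPoly a) z = 1 - ψ z := by
  have := h.eval_pole_ne hz
  rw [modelFun, h.eq_div z hz, Polynomial.eval_sub]
  field_simp

lemma decaying_oneSub (h : IsBlaschke a ψ) : Decaying fun z => 1 - ψ z :=
  (h.decaying_modelFun degree_oneSub_lt).congr fun _ hz => (h.modelFun_oneSub hz).symm

lemma oneSub_eq (h : IsBlaschke a ψ) : oneSub ψ = bv (modelFun a (polePoly a - rootPoly a)) :=
  bv_congr (F := fun z => 1 - ψ z) fun x => (h.modelFun_oneSub (ofReal_mem_closed x)).symm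

/-- On the real line `conj(1 - ψ) f = f - conj(ψ conj f)`. The leading terms combine to `c / (x + i)
- c / (x - i) = -2ic / (1 + x²)`, with integral `-2πic`, and all remainders integrate to zero. Thus
`1 - ψ` represents the functional that takes the leading coefficient. -/
lemma inner_oneSub (h : IsBlaschke a ψ) {S : Polynomial ℂ} (hS : S.degree < m) :
    inner ℂ (oneSub ψ) (bv (modelFun a S)) = -(2 * Real.pi * I) * S.coeff (m - 1) := by
  set c := S.coeff (m - 1) with hc
  have hS' : (conjPoly S).degree < m := by rwa [conjPoly_degree]
  set n₁ : ℂ → ℂ := fun z => (modelFun a (adjPoly a S) z + I * modelFun a S z) with hn₁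
  set n₂ : ℂ → ℂ := fun z =>
    (modelFun a (adjPoly a (conjPoly S)) z + I * modelFun a (conjPoly S) z) with hn₂
  have hd₁ : Decaying n₁ := (h.decaying_modelFun (degree_adjPoly_lt hS)).add
    ((h.decaying_modelFun hS).const_mul I)
  have hd₂ : Decaying n₂ := (h.decaying_modelFun (degree_adjPoly_lt hS')).add
    ((h.decaying_modelFun hS').const_mul I)
  have hi₁ := integrable_mul_of_decaying hd₁ decaying_inv_add_I
  have hi₂ : Integrable fun x : ℝ => starRingEnd ℂ (n₂ x * ((x : ℂ) + I)⁻¹) :=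
    Complex.conjCLE.toContinuousLinearMap.integrable_comp
      (integrable_mul_of_decaying hd₂ decaying_inv_add_I)
  have hi₃ : Integrable fun x : ℝ => -2 * I * c * ((1 + x ^ 2)⁻¹ : ℝ) :=
    integrable_inv_one_add_sq.ofReal.const_mul _
  have e : ∀ x : ℝ, starRingEnd ℂ (1 - ψ x) * modelFun a S x = n₁ x * ((x : ℂ) + I)⁻¹
      - starRingEnd ℂ (n₂ x * ((x : ℂ) + I)⁻¹) + -2 * I * c * ((1 + x ^ 2)⁻¹ : ℝ) := by
    intro x
    have hx := ofReal_mem_closed x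
    have h1 := h.modelFun_eq_inv_add_I S hx
    have h2 := congrArg (starRingEnd ℂ) (h.modelFun_eq_inv_add_I (conjPoly S) hx)
    have h3 := congrArg (starRingEnd ℂ) (h.modelFun_conjPoly S x)
    have h4 : (conjPoly S).coeff (m - 1) = starRingEnd ℂ c := by
      rw [conjPoly, Polynomial.coeff_map]
    rw [map_mul, Complex.conj_conj] at h3
    have h5 : (x : ℂ) + I ≠ 0 := add_I_ne_zero hx
    have h6 : (x : ℂ) - I ≠ 0 := ofReal_sub_ne_zero (by simp) x
    have h7 : ((1 + x ^ 2 : ℝ) : ℂ) = ((x : ℂ) + I) * (x - I) := by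
      push_cast
      ring_nf
      rw [I_sq]
      ring
    have h8 : -2 * I * c * ((1 + x ^ 2)⁻¹ : ℝ) = c * ((x : ℂ) + I)⁻¹ - c * ((x : ℂ) - I)⁻¹ := by
      rw [ofReal_inv, h7]
      field_simp
      ring
    rw [h4, map_add, map_mul, Complex.conj_conj, map_inv₀, map_add, Complex.conj_ofReal, conj_I,
      ← sub_eq_add_neg] at h2
    rw [h8, map_sub, map_one]
    linear_combination h1 - h2 + h3
  have h0 : oneSub ψ = bv fun z => 1 - ψ z := rfl
  rw [h0, inner_bv h.decaying_oneSub (h.decaying_modelFun hS)]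
  simp only [e]
  have hi₁₂ : Integrable fun x : ℝ => n₁ x * ((x : ℂ) + I)⁻¹
      - starRingEnd ℂ (n₂ x * ((x : ℂ) + I)⁻¹) := hi₁.sub hi₂
  rw [integral_add hi₁₂ hi₃, integral_sub hi₁ hi₂, integral_conj,
    integral_mul_eq_zero hd₁ decaying_inv_add_I, integral_mul_eq_zero hd₂ decaying_inv_add_I,
    integral_const_mul, integral_complex_ofReal, integral_univ_inv_one_add_sq, map_zero]
  ring

lemma norm_oneSub_sq (h : IsBlaschke a ψ) : ((‖oneSub ψ‖ ^ 2 : ℝ) : ℂ)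
    = -(2 * Real.pi * I) * (polePoly a - rootPoly a).coeff (m - 1) := by
  rw [← h.inner_oneSub degree_oneSub_lt, ← h.oneSub_eq]
  push_cast
  exact (inner_self_eq_norm_sq_to_K (𝕜 := ℂ) (oneSub ψ)).symm

lemma coeff_oneSub (h : IsBlaschke a ψ) : (polePoly a - rootPoly a).coeff (m - 1)
    = 2 * I * ((‖oneSub ψ‖ ^ 2 / (4 * Real.pi) : ℝ) : ℂ) := by
  have h1 := h.norm_oneSub_sq
  have h2 : (Real.pi : ℂ) ≠ 0 := by exact_mod_cast Real.pi_ne_zero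
  rw [ofReal_div, h1]
  push_cast
  field_simp
  linear_combination (4 * (polePoly a - rootPoly a).coeff (m - 1)) * I_sq

/-- On numerators `A f = x f - c ψ` and `A* f = x f - c`, so `A - A*` sends `1 - ψ` to a multiple of
itself given by its leading coefficient. This fixes the imaginary part of the quadratic form, and
only the real part remains as a parameter. -/
lemma inner_adj_oneSub (h : IsBlaschke a ψ) :
    inner ℂ (oneSub ψ) (bv (modelFun a (adjPoly a (polePoly a - rootPoly a))))
      = (((inner ℂ (oneSub ψ) (generator ψ (oneSub ψ)) : ℂ).re : ℝ) : ℂ)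
        - I * ((‖oneSub ψ‖ ^ 2 / (4 * Real.pi) : ℝ) : ℂ) * ((‖oneSub ψ‖ ^ 2 : ℝ) : ℂ) := by
  have hd := degree_oneSub_lt (a := a)
  set D := polePoly a - rootPoly a with hD
  set α := D.coeff (m - 1) with hα
  have hB := h.decaying_modelFun (degree_adjPoly_lt (a := a) hd)
  have hfd := h.decaying_modelFun hd
  have hG : generator ψ (oneSub ψ) = bv (modelFun a (genPoly a D)) := by
    rw [h.oneSub_eq, h.generator_modelFun hd]
  have h1 : bv (modelFun a (genPoly a D)) = bv (modelFun a (adjPoly a D)) + α • oneSub ψ := by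
    rw [h.oneSub_eq, ← hD, ← bv_const_mul α hfd, ← bv_add hB (hfd.const_mul α)]
    refine bv_congr fun x => ?_
    have hx := ofReal_mem_closed x
    rw [h.modelFun_genPoly _ hx, h.modelFun_adjPoly _ hx, hD, h.modelFun_oneSub hx]
    ring
  set G : ℂ := inner ℂ (oneSub ψ) (generator ψ (oneSub ψ)) with hGdef
  set B : ℂ := inner ℂ (oneSub ψ) (bv (modelFun a (adjPoly a D))) with hBdef
  have h2 : B = starRingEnd ℂ G := by
    rw [hGdef, hG, hBdef, ← inner_conj_symm, h.oneSub_eq, h.inner_adjPoly hd hd]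
  have h3 : G = B + α * ((‖oneSub ψ‖ ^ 2 : ℝ) : ℂ) := by
    rw [hGdef, hG, h1, inner_add_right, inner_smul_right]
    congr 2
    push_cast
    exact inner_self_eq_norm_sq_to_K (𝕜 := ℂ) (oneSub ψ)
  have h4 : G + starRingEnd ℂ G = 2 * (G.re : ℂ) := by
    rw [Complex.add_conj]
    push_cast
    ring
  have h5 := h.coeff_oneSub
  rw [← hD, ← hα] at h5
  rw [h5] at h3
  linear_combination (1 / 2 : ℂ) * h4 + (1 / 2 : ℂ) * h2 - (1 / 2 : ℂ) * h3

end IsBlaschke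

/-! ### Finite Blaschke products -/

lemma IsBlaschke.tendsto_one {m : ℕ} {a : Fin m → ℂ} {ψ : ℂ → ℂ} (h : IsBlaschke a ψ) :
    Tendsto ψ atInfty (𝓝 1) := by
  have h1 := h.decaying_oneSub.tendsto_zero.const_sub 1
  simpa using h1

lemma isBlaschke_div {m : ℕ} {a : Fin m → ℂ} (ha : ∀ j, 0 < (a j).im) :
    IsBlaschke a fun z => (rootPoly a).eval z / (polePoly a).eval z := ⟨ha, fun _ _ => rfl⟩

lemma rootPoly_div_polePoly {m : ℕ} (a : Fin m → ℂ) (z : ℂ) :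
    (rootPoly a).eval z / (polePoly a).eval z = ∏ j, (z - a j) / (z - starRingEnd ℂ (a j)) := by
  rw [rootPoly, polePoly, Polynomial.eval_prod, Polynomial.eval_prod, Finset.prod_div_distrib]
  simp

lemma IsFiniteBlaschke.exists_isBlaschke {m : ℕ} {ψ : ℂ → ℂ} (h : IsFiniteBlaschke m ψ)
    (hn : IsNormalised ψ) : ∃ a : Fin m → ℂ, IsBlaschke a ψ := by
  obtain ⟨c, a, hc, ha, he⟩ := h
  have hB := isBlaschke_div ha
  have h1 : Tendsto ψ atInfty (𝓝 (c * 1)) := by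
    refine (hB.tendsto_one.const_mul c).congr' ?_
    filter_upwards [eventually_atInfty_mem] with z hz
    rw [he z hz, rootPoly_div_polePoly]
  have h2 : c * 1 = 1 := tendsto_nhds_unique h1 hn
  rw [mul_one] at h2
  exact ⟨a, ha, fun z hz => by rw [he z hz, h2, one_mul, rootPoly_div_polePoly]⟩

lemma IsFiniteBlaschke.exists_normalised {m : ℕ} {ψ : ℂ → ℂ} (h : IsFiniteBlaschke m ψ) :
    ∃ (c : ℂ) (ψ' : ℂ → ℂ), c ≠ 0 ∧ IsFiniteBlaschke m ψ' ∧ IsNormalised ψ' ∧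
      ∀ z ∈ closedUpperHalf, ψ z = c * ψ' z := by
  obtain ⟨c, a, hc, ha, he⟩ := h
  refine ⟨c, fun z => (rootPoly a).eval z / (polePoly a).eval z, ?_,
    ⟨1, a, norm_one, ha, fun z _ => by
      rw [one_mul]
      exact rootPoly_div_polePoly a z⟩,
    (isBlaschke_div ha).tendsto_one, fun z hz => by
      rw [he z hz]
      exact congrArg _ (rootPoly_div_polePoly a z).symm⟩
  rintro rfl
  simp at hc

/-- The model space is not changed by a constant factor. -/
lemma model_eq_of_const_mul {ψ ψ' : ℂ → ℂ} {c : ℂ} (hc : c ≠ 0) (hψ' : BddHol ψ')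
    (he : ∀ z ∈ closedUpperHalf, ψ z = c * ψ' z) : model ψ = model ψ' := by
  have hψ : BddHol ψ := ((bddHol_const c).mul hψ').congr he
  have e : ∀ g : L2, mulL2 (fun x : ℝ => ψ x) g = c • mulL2 (fun x : ℝ => ψ' x) g := by
    intro g
    refine Lp.ext ?_
    filter_upwards [mulL2_coeFn hψ.memLp_real g, mulL2_coeFn hψ'.memLp_real g,
      Lp.coeFn_smul c (mulL2 (fun x : ℝ => ψ' x) g)] with x h1 h2 h3
    rw [h1, h3, Pi.smul_apply, h2, he x (ofReal_mem_closed x), smul_eq_mul, mul_assoc]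
  ext f
  rw [mem_model_iff, mem_model_iff]
  simp only [e, inner_smul_left, mul_eq_zero, map_eq_zero, hc, false_or]

/-- A rational function without poles in the closed upper half-plane which is unimodular on
the real line is a finite Blaschke product. -/
lemma IsRat.isFiniteBlaschke {θ : ℂ → ℂ} (h : IsRat θ) (h1 : ∀ x : ℝ, ‖θ x‖ = 1) :
    ∃ m, IsFiniteBlaschke m θ := by
  obtain ⟨P₀, R₀, hPR₀⟩ := h
  have hR₀ : R₀ ≠ 0 := by
    rintro rfl
    exact (hPR₀ 0 (by simp [closedUpperHalf])).1 Polynomial.eval_zero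
  -- The given fraction may have common factors. Reducing it is essential for the divisibility
  -- argument below.
  obtain ⟨P, R, hcop, hP, hR⟩ : ∃ P R : Polynomial ℂ, IsCoprime P R ∧
      P₀ = P * EuclideanDomain.gcd P₀ R₀ ∧ R₀ = R * EuclideanDomain.gcd P₀ R₀ := by
    obtain ⟨P, hP⟩ := EuclideanDomain.gcd_dvd_left P₀ R₀
    obtain ⟨R, hR⟩ := EuclideanDomain.gcd_dvd_right P₀ R₀
    have hg : EuclideanDomain.gcd P₀ R₀ ≠ 0 := fun h0 => hR₀ (by
      rw [h0, zero_mul] at hR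
      exact hR)
    refine ⟨P, R, ?_, by rw [mul_comm]; exact hP, by rw [mul_comm]; exact hR⟩
    refine ⟨EuclideanDomain.gcdA P₀ R₀, EuclideanDomain.gcdB P₀ R₀, ?_⟩
    have h2 := EuclideanDomain.gcd_eq_gcd_ab P₀ R₀
    refine mul_left_cancel₀ hg ?_
    rw [mul_one]
    linear_combination (-EuclideanDomain.gcdA P₀ R₀) * hP - (EuclideanDomain.gcdB P₀ R₀) * hR - h2
  set D := EuclideanDomain.gcd P₀ R₀ with hD
  have hPR : ∀ z ∈ closedUpperHalf, R.eval z ≠ 0 ∧ θ z = P.eval z / R.eval z := by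
    intro z hz
    obtain ⟨h2, h3⟩ := hPR₀ z hz
    rw [hR, Polynomial.eval_mul] at h2
    have hRz := left_ne_zero_of_mul h2
    have hDz := right_ne_zero_of_mul h2
    refine ⟨hRz, ?_⟩
    rw [h3, hP, hR, Polynomial.eval_mul, Polynomial.eval_mul, mul_div_mul_right _ _ hDz]
  have hid : P * conjPoly P = R * conjPoly R := by
    refine Polynomial.eq_of_infinite_eval_eq _ _ ?_
    refine (Set.infinite_range_of_injective Complex.ofReal_injective).mono ?_
    rintro _ ⟨x, rfl⟩
    obtain ⟨h2, h3⟩ := hPR x (ofReal_mem_closed x)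
    have h4 := h1 x
    rw [h3, norm_div, div_eq_one_iff_eq (norm_ne_zero_iff.2 h2)] at h4
    simp only [Set.mem_ofPred_eq, Polynomial.eval_mul, conjPoly_eval_real]
    rw [RCLike.mul_conj, RCLike.mul_conj, h4]
  have hRne : R ≠ 0 := fun h0 => hR₀ (by rw [hR, h0, zero_mul])
  -- Unimodularity on the line says `P P^# = R R^#`, where `#` conjugates coefficients. By
  -- coprimality `R` divides `P^#`, and the quotient `T` satisfies `T T^# = 1`. Hence `T` is
  -- constant and `P` is a constant times `R^#`, whose zeros reflect the poles.
  obtain ⟨T, hT⟩ : R ∣ conjPoly P := by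
    refine hcop.symm.dvd_of_dvd_mul_left ?_
    exact ⟨conjPoly R, hid⟩
  have hPT : P = conjPoly R * conjPoly T := by
    rw [← conjPoly_conjPoly P, hT, conjPoly, Polynomial.map_mul]
    rfl
  have hunit : T * conjPoly T = 1 := by
    have h2 : (R * conjPoly R) * (T * conjPoly T) = (R * conjPoly R) * 1 := by
      rw [mul_one]
      linear_combination hid + (-conjPoly P) * hPT - (conjPoly R * conjPoly T) * hT
    refine mul_left_cancel₀ (mul_ne_zero hRne ?_) h2
    intro h0
    apply hRne
    rw [← conjPoly_conjPoly R, h0, conjPoly, Polynomial.map_zero]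
  obtain ⟨t, ht⟩ := Polynomial.isUnit_iff.1 (IsUnit.of_mul_eq_one _ hunit)
  have hPt : P = Polynomial.C (starRingEnd ℂ t) * conjPoly R := by
    rw [hPT, ← ht.2, conjPoly, conjPoly, Polynomial.map_C, mul_comm]
  have hroots := IsAlgClosed.splits R
  have hRprod := hroots.eq_prod_roots
  set l := R.roots.toList with hl
  have hRl : R = Polynomial.C R.leadingCoeff
      * ∏ j : Fin l.length, (Polynomial.X - Polynomial.C (l.get j)) := by
    conv_lhs => rw [hRprod]
    congr 1
    rw [← Multiset.coe_toList R.roots, ← hl, Multiset.map_coe, Multiset.prod_coe,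
      ← List.prod_ofFn]
    congr 1
    exact List.ext_get (by simp) (by simp)
  have him : ∀ j, (l.get j).im < 0 := by
    intro j
    by_contra hge
    refine (hPR (l.get j) (not_lt.1 hge)).1 ?_
    have : l.get j ∈ R.roots := by
      rw [← Multiset.mem_toList]
      exact List.get_mem _ _
    exact (Polynomial.mem_roots'.1 this).2
  have hlc : R.leadingCoeff ≠ 0 := Polynomial.leadingCoeff_ne_zero.2 hRne
  refine ⟨l.length, starRingEnd ℂ t * starRingEnd ℂ R.leadingCoeff / R.leadingCoeff,
    fun j => starRingEnd ℂ (l.get j), ?_, fun j => ?_, fun z hz => ?_⟩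
  · have h2 := congrArg (Polynomial.eval 0) hunit
    rw [← ht.2, conjPoly, Polynomial.map_C, ← Polynomial.C_mul, Polynomial.eval_C,
      Polynomial.eval_one] at h2
    have h3 := congrArg norm h2
    rw [norm_mul, RCLike.norm_conj, norm_one, ← sq] at h3
    have h4 := (pow_eq_one_iff_of_nonneg (norm_nonneg t) two_ne_zero).1 h3
    rw [norm_div, norm_mul, RCLike.norm_conj, RCLike.norm_conj, h4, one_mul,
      div_self (norm_ne_zero_iff.2 hlc)]
  · rw [conj_im]
    have := him j
    linarith
  · obtain ⟨h2, h3⟩ := hPR z hz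
    have h4 : R.eval z = R.leadingCoeff * ∏ j : Fin l.length, (z - l.get j) := by
      conv_lhs => rw [hRl]
      simp [Polynomial.eval_prod]
    have h5 : (conjPoly R).eval z = starRingEnd ℂ R.leadingCoeff
        * ∏ j : Fin l.length, (z - starRingEnd ℂ (l.get j)) := by
      conv_lhs => rw [← Complex.conj_conj z, conjPoly_eval, hRl]
      rw [Polynomial.eval_mul, Polynomial.eval_C, Polynomial.eval_prod, map_mul, map_prod]
      congr 1
      refine Finset.prod_congr rfl fun j _ => ?_
      rw [Polynomial.eval_sub, Polynomial.eval_X, Polynomial.eval_C, map_sub, Complex.conj_conj]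
    rw [h3, hPt, Polynomial.eval_mul, Polynomial.eval_C, h4, h5, Finset.prod_div_distrib]
    simp only [Complex.conj_conj]
    ring

/-! ### A dissipative matrix and its kernel -/

section Kernel

variable {N : ℕ} {A : Matrix (Fin N) (Fin N) ℂ} {s t : Fin N → ℂ} {c r n : Fin N → ℝ}

/-- The function `g = i c (1 + t) + r (1 - t)`. -/
def cayley (c r : ℝ) (t : ℂ) : ℂ := I * c * (1 + t) + r * (1 - t)

/-- The equation for the left kernel of the matrix `D(1 - t) A* - D(g / n)`. -/
def IsLeftKernel (A : Matrix (Fin N) (Fin N) ℂ) (t : Fin N → ℂ) (c r n : Fin N → ℝ)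
    (v : Fin N → ℂ) : Prop :=
  ∀ j, ∑ k, v k * (1 - t k) * starRingEnd ℂ (A j k) = v j * (cayley (c j) (r j) (t j) / n j)

/-- This is the source of positivity: the imaginary part of `g conj(1 - t)` is `c (1 - |t|²)`. -/
lemma cayley_mul_conj_sub (c r : ℝ) (t : ℂ) :
    cayley c r t * starRingEnd ℂ (1 - t) - starRingEnd ℂ (cayley c r t * starRingEnd ℂ (1 - t))
      = 2 * I * c * (1 - t * starRingEnd ℂ t) := by
  simp only [cayley, map_mul, map_add, map_sub, map_one, conj_I, Complex.conj_ofReal,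
    Complex.conj_conj]
  ring

lemma mul_conj_cayley (c r : ℝ) {t : ℂ} (ht : starRingEnd ℂ t * t = 1) :
    t * starRingEnd ℂ (cayley c r t) = -cayley c r t := by
  simp only [cayley, map_mul, map_add, map_sub, map_one, conj_I, Complex.conj_ofReal]
  linear_combination (-I * c - r) * ht

lemma sum_sum_sub_conj {κ : ℂ} (hA : ∀ k j, A k j - starRingEnd ℂ (A j k) = κ)
    (x : Fin N → ℂ) :
    ∑ j, starRingEnd ℂ (x j) * ∑ k, A j k * x k
      - starRingEnd ℂ (∑ j, starRingEnd ℂ (x j) * ∑ k, A j k * x k)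
      = κ * (starRingEnd ℂ (∑ j, x j) * ∑ j, x j) := by
  have h : starRingEnd ℂ (∑ j, starRingEnd ℂ (x j) * ∑ k, A j k * x k)
      = ∑ j, starRingEnd ℂ (x j) * ∑ k, starRingEnd ℂ (A k j) * x k := by
    simp only [map_sum, map_mul, Complex.conj_conj, Finset.mul_sum]
    rw [Finset.sum_comm]
    refine Finset.sum_congr rfl fun j _ => Finset.sum_congr rfl fun k _ => ?_
    ring
  rw [h, ← Finset.sum_sub_distrib, map_sum, Finset.sum_mul, Finset.mul_sum]
  refine Finset.sum_congr rfl fun j _ => ?_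
  rw [← mul_sub, ← Finset.sum_sub_distrib]
  simp only [← sub_mul, hA]
  rw [← Finset.mul_sum]
  ring

/-- Pairing the kernel equation with `x_j = v_j (1 - t_j)` and taking imaginary parts gives `∑ (2
c_j / n_j) |v_j|² (1 - |t_j|²) + (1/2π) |∑ x_j|² = 0`. Every term is non-negative. -/
lemma IsLeftKernel.dissipative {v : Fin N → ℂ} (h : IsLeftKernel A t c r n v)
    (hA : ∀ k j, A k j - starRingEnd ℂ (A j k) = I / (2 * Real.pi))
    (hc : ∀ j, 0 < c j) (hn : ∀ j, 0 < n j) (ht : ∀ j, ‖t j‖ ≤ 1) :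
    ∑ j, v j * (1 - t j) = 0 ∧ ∀ j, ‖v j‖ ^ 2 * (1 - ‖t j‖ ^ 2) = 0 := by
  have h1 := sum_sum_sub_conj (A := A.map (starRingEnd ℂ)) (κ := -(I / (2 * Real.pi)))
    (fun k j => by
      rw [Matrix.map_apply, Matrix.map_apply, Complex.conj_conj, ← hA j k]
      ring) (fun j => v j * (1 - t j))
  have h2 : ∀ j, ∑ k, (A.map (starRingEnd ℂ)) j k * (v k * (1 - t k))
      = v j * (cayley (c j) (r j) (t j) / n j) := fun j => by
    rw [← h j]
    exact Finset.sum_congr rfl fun k _ => by rw [Matrix.map_apply, mul_comm]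
  simp only [h2] at h1
  rw [map_sum, ← Finset.sum_sub_distrib, Complex.conj_mul'] at h1
  have h3 : ∀ j, starRingEnd ℂ (v j * (1 - t j)) * (v j * (cayley (c j) (r j) (t j) / n j))
      - starRingEnd ℂ (starRingEnd ℂ (v j * (1 - t j)) * (v j * (cayley (c j) (r j) (t j) / n j)))
      = I * ((2 * c j / n j * (‖v j‖ ^ 2 * (1 - ‖t j‖ ^ 2)) : ℝ) : ℂ) := fun j => by
    have e := cayley_mul_conj_sub (c j) (r j) (t j)
    push_cast
    rw [← Complex.conj_mul' (v j), ← Complex.conj_mul' (t j)]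
    simp only [map_mul, map_div₀, Complex.conj_ofReal, Complex.conj_conj] at e ⊢
    linear_combination (starRingEnd ℂ (v j) * v j / n j) * e
  simp only [h3] at h1
  have h4 : ∑ j, 2 * c j / n j * (‖v j‖ ^ 2 * (1 - ‖t j‖ ^ 2))
      + 1 / (2 * Real.pi) * ‖∑ j, v j * (1 - t j)‖ ^ 2 = 0 := by
    have : I * ((∑ j, 2 * c j / n j * (‖v j‖ ^ 2 * (1 - ‖t j‖ ^ 2))
      + 1 / (2 * Real.pi) * ‖∑ j, v j * (1 - t j)‖ ^ 2 : ℝ) : ℂ) = 0 := by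
      rw [Complex.ofReal_add, Complex.ofReal_sum, mul_add, Finset.mul_sum, h1]
      push_cast
      ring
    exact_mod_cast (mul_eq_zero.mp this).resolve_left I_ne_zero
  have h5 : ∀ j, 0 ≤ 2 * c j / n j * (‖v j‖ ^ 2 * (1 - ‖t j‖ ^ 2)) := fun j => by
    have := hc j
    have := hn j
    have := pow_le_one₀ (n := 2) (norm_nonneg _) (ht j)
    exact mul_nonneg (by positivity) (mul_nonneg (by positivity) (by linarith))
  have h6 := Finset.sum_nonneg fun j (_ : j ∈ Finset.univ) => h5 j
  have h7 : 0 ≤ 1 / (2 * Real.pi) * ‖∑ j, v j * (1 - t j)‖ ^ 2 := by positivity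
  constructor
  · have : 1 / (2 * Real.pi) * ‖∑ j, v j * (1 - t j)‖ ^ 2 = 0 := by linarith
    simpa [Real.pi_ne_zero] using this
  · intro j
    have h8 : ∑ j, 2 * c j / n j * (‖v j‖ ^ 2 * (1 - ‖t j‖ ^ 2)) = 0 := by linarith
    have h9 := (Finset.sum_eq_zero_iff_of_nonneg fun j _ => h5 j).mp h8 j (Finset.mem_univ j)
    have := hc j
    have := hn j
    exact (mul_eq_zero.mp h9).resolve_left (by positivity)

/-- The second relation moves `s` through the matrix at the cost of a multiple of `σ = ∑ s_k v_k (1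
- t_k)`. Taking the imaginary part of the pairing with `s_j v_j (1 - t_j)` yields `2|σ|² = |σ|²`,
because the `g`-terms are real when `|t_j| = 1`. So `σ = 0`. Conjugating what remains gives the
kernel equation again, since `conj(t) (1 - t) = -conj(1 - t)` and `conj(t) g = -conj(g)` on the
circle. -/
lemma IsLeftKernel.step {v : Fin N → ℂ} (h : IsLeftKernel A t c r n v)
    (hA : ∀ k j, A k j - starRingEnd ℂ (A j k) = I / (2 * Real.pi))
    (hA' : ∀ k j, A k j * s j - s k * starRingEnd ℂ (A k j) = I / (2 * Real.pi) * s j)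
    (ht : ∀ j, starRingEnd ℂ (t j) * t j = 1) :
    IsLeftKernel A t c r n fun j => starRingEnd ℂ (s j * v j * t j) := by
  set σ : ℂ := ∑ k, s k * (v k * (1 - t k)) with hσ
  have h1 : ∀ j, ∑ k, A j k * (s k * (v k * (1 - t k)))
      = s j * v j * (cayley (c j) (r j) (t j) / n j) + I / (2 * Real.pi) * σ := fun j => by
    rw [mul_assoc, ← h j, hσ, Finset.mul_sum, Finset.mul_sum, ← Finset.sum_add_distrib]
    exact Finset.sum_congr rfl fun k _ => by linear_combination (v k * (1 - t k)) * hA' j k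
  have h2 := sum_sum_sub_conj hA fun j => s j * (v j * (1 - t j))
  simp only [h1] at h2
  simp only [mul_add, Finset.sum_add_distrib, ← Finset.sum_mul, ← map_sum] at h2
  rw [← hσ] at h2
  set X : ℂ := ∑ j, starRingEnd ℂ (s j * (v j * (1 - t j)))
        * (s j * v j * (cayley (c j) (r j) (t j) / n j)) with hX
  have h3 : X - starRingEnd ℂ X = 0 := by
    rw [hX, map_sum, ← Finset.sum_sub_distrib]
    refine Finset.sum_eq_zero fun j _ => ?_
    have e := cayley_mul_conj_sub (c j) (r j) (t j)
    have e' := ht j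
    simp only [map_mul, map_div₀, Complex.conj_ofReal, Complex.conj_conj] at e ⊢
    linear_combination (starRingEnd ℂ (v j) * v j * starRingEnd ℂ (s j) * s j / n j)
      * (e - 2 * I * c j * e')
  have h4 : starRingEnd ℂ σ * σ = 0 := by
    have h5 : I / (2 * Real.pi) * (starRingEnd ℂ σ * σ) = 0 := by
      rw [map_add, map_mul, map_mul, map_div₀, map_mul, conj_I, Complex.conj_ofReal,
        Complex.conj_conj, map_ofNat] at h2
      linear_combination h2 - h3
    exact (mul_eq_zero.mp h5).resolve_left (by simp [Real.pi_ne_zero, I_ne_zero])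
  have h5 : σ = 0 := by simpa using h4
  intro j
  have h6 := congrArg (starRingEnd ℂ) (h1 j)
  have h7 := mul_conj_cayley (c j) (r j) (ht j)
  have e' := ht j
  rw [h5, mul_zero, add_zero] at h6
  have h8 : starRingEnd ℂ (t j) * cayley (c j) (r j) (t j)
      = -starRingEnd ℂ (cayley (c j) (r j) (t j)) := by
    simpa using congrArg (starRingEnd ℂ) h7
  simp only [map_sum, map_mul, map_div₀, Complex.conj_ofReal, map_sub, map_one] at h6 ⊢
  have h9 : ∀ k, starRingEnd ℂ (s k) * starRingEnd ℂ (v k) * starRingEnd ℂ (t k) * (1 - t k)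
      * starRingEnd ℂ (A j k) = -(starRingEnd ℂ (A j k) *
      (starRingEnd ℂ (s k) * (starRingEnd ℂ (v k) * (1 - starRingEnd ℂ (t k))))) := fun k => by
    linear_combination (-(starRingEnd ℂ (s k) * starRingEnd ℂ (v k) * starRingEnd ℂ (A j k)))
      * ht k
  rw [Finset.sum_congr rfl fun k _ => h9 k, Finset.sum_neg_distrib, h6]
  linear_combination (-(starRingEnd ℂ (s j) * starRingEnd ℂ (v j) / n j)) * h8

/-- The matrix `D(1 - t) A* - D(g / n)` has trivial left kernel, both when all `|t j| < 1` and
when all `|t j| = 1`. -/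
lemma IsLeftKernel.eq_zero {v : Fin N → ℂ} (h : IsLeftKernel A t c r n v)
    (hA : ∀ k j, A k j - starRingEnd ℂ (A j k) = I / (2 * Real.pi))
    (hA' : ∀ k j, A k j * s j - s k * starRingEnd ℂ (A k j) = I / (2 * Real.pi) * s j)
    (hs : Function.Injective fun j => ‖s j‖ ^ 2)
    (hc : ∀ j, 0 < c j) (hn : ∀ j, 0 < n j)
    (ht : (∀ j, ‖t j‖ < 1) ∨ ∀ j, starRingEnd ℂ (t j) * t j = 1) : v = 0 := by
  rcases ht with ht | ht
  · funext j
    have h1 := (h.dissipative hA hc hn fun j => (ht j).le).2 j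
    have h2 : ‖t j‖ ^ 2 < 1 := pow_lt_one₀ (norm_nonneg _) (ht j) (by norm_num)
    rcases mul_eq_zero.mp h1 with h3 | h3
    · simpa using h3
    · linarith
  · have ht' : ∀ j, ‖t j‖ ≤ 1 := fun j => by
      have h1 := ht j
      rw [Complex.conj_mul'] at h1
      have h2 : ‖t j‖ ^ 2 = 1 := by exact_mod_cast h1
      nlinarith [norm_nonneg (t j)]
    -- Two applications of the antilinear map multiply `v_j` by `|s_j|²`.
    have h1 : ∀ i : ℕ, IsLeftKernel A t c r n fun j => ((‖s j‖ ^ 2 : ℝ) : ℂ) ^ i * v j := by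
      intro i
      induction i with
      | zero => simpa using h
      | succ i ih =>
        convert (ih.step hA hA' ht).step hA hA' ht using 2 with j
        have e := ht j
        push_cast
        rw [← Complex.conj_mul' (s j)]
        simp only [map_mul, map_pow, Complex.conj_conj]
        linear_combination (-(starRingEnd ℂ (s j) * s j *
          (starRingEnd ℂ (s j) * s j) ^ i * v j)) * e
    -- All moments `∑ |s_j|^{2i} v_j (1 - t_j)` vanish and the nodes `|s_j|²` are distinct:
    -- Vandermonde.
    have h2 : (fun j => v j * (1 - t j)) = 0 := by
      refine Matrix.eq_zero_of_forall_pow_sum_mul_pow_eq_zero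
        (f := fun j => ((‖s j‖ ^ 2 : ℝ) : ℂ)) ?_ fun i => ?_
      · exact fun a b hab => hs (Complex.ofReal_injective hab)
      · rw [← ((h1 i).dissipative hA hc hn ht').1]
        exact Finset.sum_congr rfl fun j _ => by ring
    funext j
    have h3 : v j * (1 - t j) = 0 := congrFun h2 j
    have h4 : v j * (cayley (c j) (r j) (t j) / n j) = 0 := by
      rw [← h j]
      refine Finset.sum_eq_zero fun k _ => ?_
      rw [show v k * (1 - t k) = 0 from congrFun h2 k, zero_mul]
    by_contra hv
    replace hv : v j ≠ 0 := hv
    -- A non-zero `v_j` would force `t_j = 1`, but then `g_j = 2 i c_j` is not zero.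
    have h5 : t j = 1 := by
      rcases mul_eq_zero.mp h3 with h | h
      · exact absurd h hv
      · exact (sub_eq_zero.mp h).symm
    have h6 := (mul_eq_zero.mp h4).resolve_left hv
    rw [h5] at h6
    have hc' : (c j : ℂ) ≠ 0 := by exact_mod_cast (hc j).ne'
    have hn' : (n j : ℂ) ≠ 0 := by exact_mod_cast (hn j).ne'
    simp [cayley, hc', hn', I_ne_zero] at h6

end Kernel

/-! ### The matrix `M(z)` and its rows -/

lemma IsBlaschke.norm_oneSub_pos {m : ℕ} {a : Fin m → ℂ} {ψ : ℂ → ℂ} (h : IsBlaschke a ψ)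
    (hm : 0 < m) : 0 < ‖oneSub ψ‖ := by
  rw [norm_pos_iff]
  intro h0
  have hI : (I : ℂ) ∈ upperHalf := by simp [upperHalf]
  have h1 : bv (fun z => 1 - ψ z) = bv fun _ => 0 := by
    rw [show bv (fun z => 1 - ψ z) = oneSub ψ from rfl, h0]
    exact (toL2_eq_of_ae (Lp.coeFn_zero ℂ 2 volume).symm).symm
  have h2 := eqOn_of_bv_eq h.decaying_oneSub decaying_zero h1 I hI
  have h3 := h.norm_lt_one hm hI
  rw [← sub_eq_zero.mp h2] at h3
  simp at h3

/-- The data entering the explicit formula: a matrix with the two commutation relations, the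
numbers `s j = λ_j e^{-iφ_j}`, the weights `n j = ν_j²` and normalised Blaschke products. -/
structure SpectralSystem (N : ℕ) where
  A : Matrix (Fin N) (Fin N) ℂ
  s : Fin N → ℂ
  n : Fin N → ℝ
  m : Fin N → ℕ
  a : ∀ j, Fin (m j) → ℂ
  ψ : Fin N → ℂ → ℂ
  blaschke : ∀ j, IsBlaschke (a j) (ψ j)
  m_pos : ∀ j, 0 < m j
  n_pos : ∀ j, 0 < n j
  sub_conj : ∀ k j, A k j - starRingEnd ℂ (A j k) = I / (2 * Real.pi)
  mul_sub_mul_conj : ∀ k j, A k j * s j - s k * starRingEnd ℂ (A k j) = I / (2 * Real.pi) * s j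
  s_injective : Function.Injective fun j => ‖s j‖ ^ 2
  s_ne : ∀ j, s j ≠ 0

namespace SpectralSystem

variable {N : ℕ} (D : SpectralSystem N)

/-- `c_j = ‖1 - ψ_j‖² / 4π`. -/
def c (j : Fin N) : ℝ := ‖oneSub (D.ψ j)‖ ^ 2 / (4 * Real.pi)

/-- `r_j = Re ⟨A(1 - ψ_j), 1 - ψ_j⟩ / ‖1 - ψ_j‖²`. -/
def r (j : Fin N) : ℝ :=
  (inner ℂ (oneSub (D.ψ j)) (generator (D.ψ j) (oneSub (D.ψ j))) : ℂ).re / ‖oneSub (D.ψ j)‖ ^ 2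

lemma c_pos (j : Fin N) : 0 < D.c j := by
  have := (D.blaschke j).norm_oneSub_pos (D.m_pos j)
  have := Real.pi_pos
  unfold c
  positivity

/-- The function `g_j = i c_j (1 + ψ_j) + r_j (1 - ψ_j)`. -/
def g (j : Fin N) (z : ℂ) : ℂ := cayley (D.c j) (D.r j) (D.ψ j z)

/-- The matrix `D(1 - ψ) A* - D(g / n)`. -/
def M (z : ℂ) : Matrix (Fin N) (Fin N) ℂ :=
  Matrix.of fun k j => (1 - D.ψ k z) * starRingEnd ℂ (D.A j k)
    - if k = j then D.g j z / D.n j else 0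

lemma vecMul_M (v : Fin N → ℂ) (z : ℂ) (j : Fin N) : (v ᵥ* D.M z) j
    = ∑ k, v k * (1 - D.ψ k z) * starRingEnd ℂ (D.A j k) - v j * (D.g j z / D.n j) := by
  simp only [Matrix.vecMul, dotProduct, M, Matrix.of_apply, mul_sub, Finset.sum_sub_distrib,
    mul_ite, mul_zero, Finset.sum_ite_eq', Finset.mem_univ, if_true]
  simp only [← mul_sub, mul_assoc]

lemma det_M_ne_zero {z : ℂ} (hz : z ∈ closedUpperHalf) : (D.M z).det ≠ 0 := by
  rw [Ne, ← Matrix.exists_vecMul_eq_zero_iff]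
  rintro ⟨v, hv, h0⟩
  refine hv (IsLeftKernel.eq_zero (s := D.s) (A := D.A) (t := fun j => D.ψ j z) (c := D.c)
    (r := D.r) (n := D.n) (fun j => ?_) D.sub_conj D.mul_sub_mul_conj D.s_injective D.c_pos
    D.n_pos ?_)
  · have := congrFun h0 j
    rw [vecMul_M] at this
    exact sub_eq_zero.mp this
  · rcases (show 0 ≤ z.im from hz).lt_or_eq with h | h
    · exact Or.inl fun j => (D.blaschke j).norm_lt_one (D.m_pos j) h
    · have e : z = (z.re : ℂ) := Complex.ext rfl (by simp [← h])
      refine Or.inr fun j => ?_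
      rw [e]
      exact (D.blaschke j).conj_mul_self_real _

/-- The row vector `-(i / 2π) b M(z)⁻¹`. -/
def row (b : Fin N → ℂ) (j : Fin N) (z : ℂ) : ℂ :=
  -(I / (2 * Real.pi)) * (b ᵥ* (D.M z)⁻¹) j

lemma row_mul_g (b : Fin N → ℂ) (j : Fin N) {z : ℂ} (hz : z ∈ closedUpperHalf) :
    D.row b j z * (D.g j z / D.n j)
      = ∑ k, D.row b k z * (1 - D.ψ k z) * starRingEnd ℂ (D.A j k)
        + I / (2 * Real.pi) * b j := by
  have h : (fun k => D.row b k z) ᵥ* D.M z = -(I / (2 * Real.pi)) • b := by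
    rw [show (fun k => D.row b k z) = -(I / (2 * Real.pi)) • (b ᵥ* (D.M z)⁻¹) from rfl,
      Matrix.smul_vecMul, Matrix.vecMul_vecMul,
      Matrix.nonsing_inv_mul _ (isUnit_iff_ne_zero.mpr (D.det_M_ne_zero hz)), Matrix.vecMul_one]
  have h1 := congrFun h j
  rw [vecMul_M, Pi.smul_apply, smul_eq_mul] at h1
  linear_combination -h1

/-- Uniqueness for the row equation, used to recognise a boundary expression involving conjugates as
an analytic row. -/
lemma eq_row {b v : Fin N → ℂ} {z : ℂ} (hz : z ∈ closedUpperHalf)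
    (h : ∀ j, v j * (D.g j z / D.n j)
      = ∑ k, v k * (1 - D.ψ k z) * starRingEnd ℂ (D.A j k) + I / (2 * Real.pi) * b j)
    (j : Fin N) : v j = D.row b j z := by
  have h1 : v ᵥ* D.M z = -(I / (2 * Real.pi)) • b := by
    funext j
    rw [vecMul_M, h j, Pi.smul_apply, smul_eq_mul]
    ring
  have h2 : v = -(I / (2 * Real.pi)) • (b ᵥ* (D.M z)⁻¹) := by
    rw [← Matrix.smul_vecMul, ← h1, Matrix.vecMul_vecMul,
      Matrix.mul_nonsing_inv _ (isUnit_iff_ne_zero.mpr (D.det_M_ne_zero hz)), Matrix.vecMul_one]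
  rw [h2]
  rfl

lemma isRat_g (j : Fin N) : IsRat (D.g j) := by
  have h := (D.blaschke j).isRat
  exact (((isRat_const 1).add h).const_mul (I * D.c j)).add
    (((isRat_const 1).sub h).const_mul (D.r j))

lemma tendsto_g (j : Fin N) : Tendsto (D.g j) atInfty (𝓝 (2 * I * D.c j)) := by
  have h := (D.blaschke j).tendsto_one
  have h1 := (((tendsto_const_nhds (x := (1 : ℂ))).add h).const_mul (I * (D.c j : ℂ))).add
    (((tendsto_const_nhds (x := (1 : ℂ))).sub h).const_mul (D.r j : ℂ))
  rw [show (2 * I * D.c j : ℂ) = I * D.c j * (1 + 1) + D.r j * (1 - 1) by ring]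
  exact h1

lemma isRat_row (b : Fin N → ℂ) (j : Fin N) : IsRat (D.row b j) := by
  have h : ∀ k j, IsRat fun z => D.M z k j := fun k j => by
    refine IsRat.sub ?_ ?_
    · exact ((isRat_const 1).sub (D.blaschke k).isRat).mul (isRat_const _)
    · split_ifs
      · exact (D.isRat_g j).mul (isRat_const (D.n j : ℂ)⁻¹)
      · exact isRat_const 0
  exact (IsRat.sum fun k _ => (IsRat.inv_matrix h (fun z hz => D.det_M_ne_zero hz) k
    j).const_mul (b k)).const_mul _

/-- `κ_j² = ν_j² / ‖1 - ψ_j‖²`. -/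
def kappaSq (j : Fin N) : ℝ := D.n j / ‖oneSub (D.ψ j)‖ ^ 2

lemma kappaSq_pos (j : Fin N) : 0 < D.kappaSq j := by
  have := (D.blaschke j).norm_oneSub_pos (D.m_pos j)
  have := D.n_pos j
  unfold kappaSq
  positivity

lemma kappaSq_mul (j : Fin N) : D.kappaSq j * (4 * Real.pi * D.c j) = D.n j := by
  have := (D.blaschke j).norm_oneSub_pos (D.m_pos j)
  have := Real.pi_pos
  unfold kappaSq c
  field_simp

lemma tendsto_M : Tendsto D.M atInfty
    (𝓝 (Matrix.diagonal fun j => -(2 * I * D.c j / D.n j))) := by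
  refine tendsto_pi_nhds.mpr fun k => tendsto_pi_nhds.mpr fun j => ?_
  have h1 := ((tendsto_const_nhds (x := (1 : ℂ))).sub (D.blaschke k).tendsto_one).mul
    (tendsto_const_nhds (x := starRingEnd ℂ (D.A j k)))
  by_cases hkj : k = j
  · have h2 := h1.sub ((D.tendsto_g j).div_const (D.n j : ℂ))
    rw [hkj, Matrix.diagonal_apply_eq]
    rw [hkj] at h2
    refine (h2.congr fun z => ?_).trans_eq ?_
    · simp [M]
    · simp
  · rw [Matrix.diagonal_apply_ne _ hkj]
    refine (h1.congr fun z => ?_).trans_eq ?_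
    · simp [M, hkj]
    · simp

/-- At infinity every `ψ_k` equals `1`, so the `A*` part of `M` drops out and the limit is an
invertible diagonal matrix. Besides boundedness of the rows, this shows that `P_j` is non-zero high
up on the imaginary axis. -/
lemma tendsto_row (b : Fin N → ℂ) (j : Fin N) :
    Tendsto (D.row b j) atInfty (𝓝 (b j * D.kappaSq j)) := by
  have hd : ∀ j, -(2 * I * (D.c j : ℂ) / D.n j) ≠ 0 := fun j => by
    have h1 : (D.c j : ℂ) ≠ 0 := by exact_mod_cast (D.c_pos j).ne'
    have h2 : (D.n j : ℂ) ≠ 0 := by exact_mod_cast (D.n_pos j).ne'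
    simp [h1, h2, I_ne_zero]
  set L : Matrix (Fin N) (Fin N) ℂ := Matrix.diagonal fun j => -(2 * I * D.c j / D.n j) with hL
  have hdet : L.det ≠ 0 := by
    rw [hL, Matrix.det_diagonal]
    exact Finset.prod_ne_zero_iff.mpr fun j _ => hd j
  have h1 : Tendsto (fun z => (D.M z)⁻¹) atInfty (𝓝 L⁻¹) := by
    have h2 := ((continuous_id.matrix_det.tendsto L).comp D.tendsto_M).inv₀ hdet
    have h3 := (continuous_id.matrix_adjugate.tendsto L).comp D.tendsto_M
    have h4 := h2.smul h3
    rw [Matrix.inv_def, Ring.inverse_eq_inv']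
    refine h4.congr fun z => ?_
    rw [Matrix.inv_def, Ring.inverse_eq_inv']
    rfl
  have h2 : Tendsto (fun z => (b ᵥ* (D.M z)⁻¹) j) atInfty (𝓝 ((b ᵥ* L⁻¹) j)) := by
    simp only [Matrix.vecMul, dotProduct]
    exact tendsto_finsetSum _ fun k _ => ((tendsto_pi_nhds.mp (tendsto_pi_nhds.mp h1 k)) j).const_mul _
  have h3 : (b ᵥ* L⁻¹) j = b j * (-(2 * I * D.c j / D.n j))⁻¹ := by
    have h4 : L⁻¹ = Matrix.diagonal fun j => (-(2 * I * D.c j / D.n j))⁻¹ := by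
      refine Matrix.inv_eq_left_inv ?_
      rw [hL, Matrix.diagonal_mul_diagonal, ← Matrix.diagonal_one]
      congr 1
      funext j
      exact inv_mul_cancel₀ (hd j)
    rw [h4, Matrix.vecMul_diagonal]
  rw [h3] at h2
  refine (h2.const_mul (-(I / (2 * Real.pi)))).trans_eq ?_
  congr 1
  have h4 : (D.c j : ℂ) ≠ 0 := by exact_mod_cast (D.c_pos j).ne'
  have h5 : (D.n j : ℂ) ≠ 0 := by exact_mod_cast (D.n_pos j).ne'
  have h6 : (Real.pi : ℂ) ≠ 0 := by exact_mod_cast Real.pi_ne_zero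
  have h7 := I_ne_zero
  have h8 : (D.kappaSq j : ℂ) * (4 * Real.pi * D.c j) = D.n j := by exact_mod_cast D.kappaSq_mul j
  field_simp
  linear_combination (-b j) * h8

lemma bddHol_row (b : Fin N → ℂ) (j : Fin N) : BddHol (D.row b j) :=
  (D.isRat_row b j).bddHol (D.tendsto_row b j)

lemma decaying_row_mul (b : Fin N → ℂ) (j : Fin N) :
    Decaying fun z => D.row b j z * (1 - D.ψ j z) :=
  (D.bddHol_row b j).mul_decaying (D.blaschke j).decaying_oneSub

/-! ### The multipliers, the symbol and the inner function of a system -/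

/-- The unnormalised multiplier `P_j = κ_j p_j`. -/
def P (j : Fin N) : ℂ → ℂ := D.row (fun _ => 1) j

/-- The function `q_j = P_j (1 - ψ_j)`. -/
def q (j : Fin N) (z : ℂ) : ℂ := D.P j z * (1 - D.ψ j z)

/-- The symbol `u = ∑ s_j q_j`. -/
def u (z : ℂ) : ℂ := ∑ j, D.s j * D.q j z

/-- The inner function `θ = 1 - ∑ q_j`. -/
def θ (z : ℂ) : ℂ := 1 - ∑ j, D.q j z

lemma decaying_q (j : Fin N) : Decaying (D.q j) := D.decaying_row_mul _ j

lemma bddHol_P (j : Fin N) : BddHol (D.P j) := D.bddHol_row _ j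

lemma decaying_u : Decaying D.u := Decaying.sum fun j _ => (D.decaying_q j).const_mul _

lemma isRat_q (j : Fin N) : IsRat (D.q j) :=
  (D.isRat_row _ j).mul ((isRat_const 1).sub (D.blaschke j).isRat)

lemma isRationalSymbol_u : IsRationalSymbol D.u :=
  (IsRat.sum fun j _ => (D.isRat_q j).const_mul _).isRationalSymbol D.decaying_u.tendsto_zero

lemma isRat_θ : IsRat D.θ := (isRat_const 1).sub (IsRat.sum fun j _ => D.isRat_q j)

lemma isNormalised_θ : IsNormalised D.θ := by
  have h := (tendsto_const_nhds (x := (1 : ℂ))).sub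
    (Decaying.sum (s := Finset.univ) fun j _ => D.decaying_q j).tendsto_zero
  rw [sub_zero] at h
  exact h

lemma P_mul_g (j : Fin N) {z : ℂ} (hz : z ∈ closedUpperHalf) :
    D.P j z * (D.g j z / D.n j)
      = ∑ k, D.q k z * starRingEnd ℂ (D.A j k) + I / (2 * Real.pi) := by
  have := D.row_mul_g (fun _ => 1) j hz
  rwa [mul_one] at this

/-- The kernel identity. -/
lemma sum_kernel {z w : ℂ} (hz : z ∈ closedUpperHalf) (hw : w ∈ closedUpperHalf) :
    ∑ j, (D.kappaSq j : ℂ)⁻¹ * (D.P j z * starRingEnd ℂ (D.P j w)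
        * (1 - D.ψ j z * starRingEnd ℂ (D.ψ j w)))
      = 1 - D.θ z * starRingEnd ℂ (D.θ w) := by
  -- Take the row equation at `z` times `conj q_j(w)` and subtract the conjugate equation at `w`
  -- times `q_j(z)`. The `g`-terms combine to `2 i c_j (1 - ψ_j(z) conj ψ_j(w))`.
  have h1 : ∀ j, I / (2 * Real.pi) * ((D.kappaSq j : ℂ)⁻¹ * (D.P j z * starRingEnd ℂ (D.P j w)
        * (1 - D.ψ j z * starRingEnd ℂ (D.ψ j w))))
      = ∑ k, (D.q k z * starRingEnd ℂ (D.q j w) * starRingEnd ℂ (D.A j k))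
        - ∑ k, (D.q j z * starRingEnd ℂ (D.q k w) * D.A j k)
        + I / (2 * Real.pi) * (starRingEnd ℂ (D.q j w) + D.q j z) := fun j => by
    have e1 := D.P_mul_g j hz
    have e2 := congrArg (starRingEnd ℂ) (D.P_mul_g j hw)
    have e3 : (D.kappaSq j : ℂ) * (4 * Real.pi * D.c j) = D.n j := by
      exact_mod_cast D.kappaSq_mul j
    have h2 : (D.kappaSq j : ℂ) ≠ 0 := by exact_mod_cast (D.kappaSq_pos j).ne'
    have h3 : (D.c j : ℂ) ≠ 0 := by exact_mod_cast (D.c_pos j).ne'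
    have h4 : (Real.pi : ℂ) ≠ 0 := by exact_mod_cast Real.pi_ne_zero
    have e4 : I / (2 * Real.pi) * (D.kappaSq j : ℂ)⁻¹ = 2 * I * D.c j / D.n j := by
      rw [← e3]
      field_simp
      ring
    have e5 : D.g j z * starRingEnd ℂ (1 - D.ψ j w) - (1 - D.ψ j z) * starRingEnd ℂ (D.g j w)
        = 2 * I * D.c j * (1 - D.ψ j z * starRingEnd ℂ (D.ψ j w)) := by
      simp only [g, cayley, map_mul, map_add, map_sub, map_one, conj_I, Complex.conj_ofReal]
      ring
    have e6 : ∑ k, (D.q k z * starRingEnd ℂ (D.q j w) * starRingEnd ℂ (D.A j k))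
        = starRingEnd ℂ (D.q j w) * ∑ k, D.q k z * starRingEnd ℂ (D.A j k) := by
      rw [Finset.mul_sum]
      exact Finset.sum_congr rfl fun k _ => by ring
    have e7 : ∑ k, (D.q j z * starRingEnd ℂ (D.q k w) * D.A j k)
        = D.q j z * ∑ k, starRingEnd ℂ (D.q k w) * D.A j k := by
      rw [Finset.mul_sum]
      exact Finset.sum_congr rfl fun k _ => by ring
    simp only [map_mul, map_div₀, map_add, map_sum, conj_I, Complex.conj_ofReal,
      Complex.conj_conj, map_ofNat] at e2
    rw [← mul_assoc, e4, e6, e7]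
    have e8 : D.q j z = D.P j z * (1 - D.ψ j z) := rfl
    have e9 : starRingEnd ℂ (D.q j w) = starRingEnd ℂ (D.P j w) * starRingEnd ℂ (1 - D.ψ j w) := by
      rw [← map_mul]
      rfl
    linear_combination (starRingEnd ℂ (D.q j w)) * e1 - D.q j z * e2
      - (D.P j z * starRingEnd ℂ (D.P j w) / D.n j) * e5
      - (D.P j z * D.g j z / D.n j) * e9
      + (starRingEnd ℂ (D.P j w) * starRingEnd ℂ (D.g j w) / D.n j) * e8
  have h2 : I / (2 * Real.pi) * ∑ j, (D.kappaSq j : ℂ)⁻¹ * (D.P j z * starRingEnd ℂ (D.P j w)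
        * (1 - D.ψ j z * starRingEnd ℂ (D.ψ j w)))
      = I / (2 * Real.pi) * (1 - D.θ z * starRingEnd ℂ (D.θ w)) := by
    rw [Finset.mul_sum, Finset.sum_congr rfl fun j _ => h1 j, Finset.sum_add_distrib,
      Finset.sum_sub_distrib, Finset.sum_comm, ← Finset.sum_sub_distrib]
    -- After transposing one double sum only `A* - A` survives. It has constant entries, so the sum
    -- collapses to a product of `∑ q` and `∑ conj q`.
    have h3 : ∀ j, ∑ k, D.q j z * starRingEnd ℂ (D.q k w) * starRingEnd ℂ (D.A k j)
        - ∑ k, D.q j z * starRingEnd ℂ (D.q k w) * D.A j k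
        = -(I / (2 * Real.pi)) * (D.q j z * ∑ k, starRingEnd ℂ (D.q k w)) := fun j => by
      rw [← Finset.sum_sub_distrib, Finset.mul_sum, Finset.mul_sum]
      refine Finset.sum_congr rfl fun k _ => ?_
      rw [← D.sub_conj j k]
      ring
    rw [Finset.sum_congr rfl fun j _ => h3 j, ← Finset.mul_sum, ← Finset.mul_sum,
      ← Finset.sum_mul, Finset.sum_add_distrib]
    simp only [θ, map_sub, map_one, map_sum]
    ring
  exact mul_left_cancel₀ (by simp [Real.pi_ne_zero, I_ne_zero]) h2

lemma norm_θ_real (x : ℝ) : ‖D.θ x‖ = 1 := by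
  have h := D.sum_kernel (ofReal_mem_closed x) (ofReal_mem_closed x)
  rw [Finset.sum_eq_zero fun j _ => ?_, mul_comm, Complex.conj_mul'] at h
  · have h1 : ‖D.θ x‖ ^ 2 = 1 := by exact_mod_cast (sub_eq_zero.mp h.symm).symm
    nlinarith [norm_nonneg (D.θ x)]
  · rw [mul_comm (D.ψ j x), (D.blaschke j).conj_mul_self_real]
    ring

lemma exists_isBlaschke_θ : ∃ (m : ℕ) (b : Fin m → ℂ), IsFiniteBlaschke m D.θ ∧
    IsBlaschke b D.θ := by
  obtain ⟨m, hm⟩ := D.isRat_θ.isFiniteBlaschke D.norm_θ_real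
  obtain ⟨b, hb⟩ := hm.exists_isBlaschke D.isNormalised_θ
  exact ⟨m, b, hm, hb⟩

/-- The row vector `-(i / 2π) s* M(z)⁻¹`. -/
def R (j : Fin N) : ℂ → ℂ := D.row (fun k => starRingEnd ℂ (D.s k)) j

/-- The left side solves the row equation with right-hand side `conj s`. To see this, combine the
equation for `P` times `conj u` with its conjugate times `conj s_j`, use `|ψ_j| = 1`, and absorb the
mismatch of the `A`-terms by the second relation. Hence the co-analytic part of `conj(u) P_j` is
explicit. -/
lemma conj_u_mul_P (j : Fin N) (x : ℝ) :
    starRingEnd ℂ (D.u x) * D.P j x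
      + starRingEnd ℂ (D.s j * D.P j x * D.ψ j x) = D.R j x := by
  refine D.eq_row (b := fun k => starRingEnd ℂ (D.s k)) (v := fun j =>
    starRingEnd ℂ (D.u x) * D.P j x + starRingEnd ℂ (D.s j * D.P j x * D.ψ j x))
    (ofReal_mem_closed x) (fun j => ?_) j
  have e0 : ∀ k, starRingEnd ℂ (D.ψ k x) * D.ψ k x = 1 := fun k =>
    (D.blaschke k).conj_mul_self_real x
  have h1 : ∀ k, (starRingEnd ℂ (D.u x) * D.P k x + starRingEnd ℂ (D.s k * D.P k x * D.ψ k x))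
      * (1 - D.ψ k x) = starRingEnd ℂ (D.u x) * D.q k x
        - starRingEnd ℂ (D.s k) * starRingEnd ℂ (D.q k x) := fun k => by
    simp only [q, map_mul, map_sub, map_one]
    linear_combination (-(starRingEnd ℂ (D.s k) * starRingEnd ℂ (D.P k x))) * e0 k
  simp only [h1]
  have e1 := D.P_mul_g j (ofReal_mem_closed x)
  have e2 := congrArg (starRingEnd ℂ) e1
  have e3 : starRingEnd ℂ (D.ψ j x) * D.g j x = -starRingEnd ℂ (D.g j x) := by
    simpa [g] using congrArg (starRingEnd ℂ) (mul_conj_cayley (D.c j) (D.r j) (e0 j))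
  have h2 : ∑ k, (starRingEnd ℂ (D.u x) * D.q k x
        - starRingEnd ℂ (D.s k) * starRingEnd ℂ (D.q k x)) * starRingEnd ℂ (D.A j k)
      = starRingEnd ℂ (D.u x) * ∑ k, D.q k x * starRingEnd ℂ (D.A j k)
        - starRingEnd ℂ (D.s j) * ∑ k, starRingEnd ℂ (D.q k x) * D.A j k
        + I / (2 * Real.pi) * starRingEnd ℂ (D.u x) := by
    simp only [u, map_sum, map_mul, Finset.mul_sum]
    rw [← Finset.sum_sub_distrib, ← Finset.sum_add_distrib]
    refine Finset.sum_congr rfl fun k _ => ?_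
    have e4 := congrArg (starRingEnd ℂ) (D.mul_sub_mul_conj j k)
    simp only [map_mul, map_sub, map_div₀, conj_I, Complex.conj_ofReal, Complex.conj_conj,
      map_ofNat] at e4
    linear_combination (-(starRingEnd ℂ (D.q k x))) * e4
  rw [h2]
  simp only [map_mul, map_div₀, map_add, map_sum, conj_I, Complex.conj_ofReal,
      Complex.conj_conj, map_ofNat] at e2 ⊢
  linear_combination (starRingEnd ℂ (D.u x)) * e1 - starRingEnd ℂ (D.s j) * e2
    + (starRingEnd ℂ (D.s j) * starRingEnd ℂ (D.P j x) / D.n j) * e3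

/-- Summing the previous identity against `1 - ψ_j` produces `conj(u) ∑ q_j - conj(u)`. So
multiplication by `θ` turns `conj u` into the boundary value of an analytic function. -/
lemma conj_u_mul_θ (x : ℝ) :
    starRingEnd ℂ (D.u x) * D.θ x = -∑ j, D.R j x * (1 - D.ψ j x) := by
  have h1 : ∀ j, D.R j x * (1 - D.ψ j x) = starRingEnd ℂ (D.u x) * D.q j x
        - starRingEnd ℂ (D.s j * D.q j x) := fun j => by
    have e0 := (D.blaschke j).conj_mul_self_real x
    rw [← D.conj_u_mul_P]
    simp only [q, map_mul, map_sub, map_one]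
    linear_combination (-(starRingEnd ℂ (D.s j) * starRingEnd ℂ (D.P j x))) * e0
  rw [Finset.sum_congr rfl fun j _ => h1 j, Finset.sum_sub_distrib, ← Finset.mul_sum,
    ← map_sum]
  simp only [θ]
  rw [show ∑ j, D.s j * D.q j x = D.u x from rfl]
  ring

end SpectralSystem

/-! ### The Hankel operator with symbol `u` -/

namespace SpectralSystem

variable {N : ℕ} (D : SpectralSystem N)

/-- The Hankel operator with symbol `u`. -/
def H (f : L2) : L2 := hankel (fun x : ℝ => D.u x) f

/-- The subspace `p_j K_{ψ_j}`. -/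
def E (j : Fin N) : Submodule ℂ L2 :=
  (model (D.ψ j)).map (mulL2 fun x : ℝ => D.P j x).toLinearMap

/-- The boundary value of `P_j S / R_j`, where `R_j` is the denominator of `ψ_j`. -/
def el (j : Fin N) (S : Polynomial ℂ) : L2 := bv fun z => D.P j z * modelFun (D.a j) S z

lemma decaying_el (j : Fin N) {S : Polynomial ℂ} (hS : S.degree < D.m j) :
    Decaying fun z => D.P j z * modelFun (D.a j) S z :=
  (D.bddHol_P j).mul_decaying ((D.blaschke j).decaying_modelFun hS)

lemma mulL2_P (j : Fin N) {S : Polynomial ℂ} (hS : S.degree < D.m j) :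
    mulL2 (fun x : ℝ => D.P j x) (bv (modelFun (D.a j) S)) = D.el j S :=
  mulL2_bv (D.bddHol_P j) ((D.blaschke j).decaying_modelFun hS)

lemma mem_E_iff (j : Fin N) (f : L2) :
    f ∈ D.E j ↔ ∃ S : Polynomial ℂ, S.degree < D.m j ∧ f = D.el j S := by
  constructor
  · rintro ⟨g, hg, rfl⟩
    obtain ⟨S, hS, rfl⟩ := (D.blaschke j).exists_modelFun hg
    exact ⟨S, hS, D.mulL2_P j hS⟩
  · rintro ⟨S, hS, rfl⟩
    exact ⟨_, (D.blaschke j).bv_modelFun_mem hS, D.mulL2_P j hS⟩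

lemma el_mem (j : Fin N) {S : Polynomial ℂ} (hS : S.degree < D.m j) : D.el j S ∈ D.E j :=
  (D.mem_E_iff j _).mpr ⟨S, hS, rfl⟩

lemma E_le_hardy (j : Fin N) : D.E j ≤ hardy := by
  intro f hf
  obtain ⟨S, hS, rfl⟩ := (D.mem_E_iff j f).mp hf
  exact (D.decaying_el j hS).bv_mem

lemma finiteDimensional_E (j : Fin N) : FiniteDimensional ℂ (D.E j) := by
  have := (D.blaschke j).finiteDimensional_model
  exact Module.Finite.map _ _

/-- For `f` in the model space, `u conj(P_j f) = -s_j P_j (ψ_j conj f) + conj(R_j f)`, and the last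
term is co-analytic. -/
lemma H_el (j : Fin N) {S : Polynomial ℂ} (hS : S.degree < D.m j) :
    D.H (D.el j S) = -D.s j • D.el j (conjPoly S) := by
  have hS' : (conjPoly S).degree < D.m j := by rwa [conjPoly_degree]
  have hk : Decaying fun z => D.R j z * modelFun (D.a j) S z :=
    (D.bddHol_row _ j).mul_decaying ((D.blaschke j).decaying_modelFun hS)
  rw [el, el, ← bv_const_mul _ (D.decaying_el j hS')]
  refine hankel_eq_of_mem ((D.decaying_el j hS').const_mul _).bv_mem hk.bv_mem ?_
  rw [bv, bv, bv, star_toL2 (D.decaying_el j hS).memLp, star_toL2 hk.memLp,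
    mulL2_toL2 D.decaying_u.bddHol.memLp_real (memLp_conj (D.decaying_el j hS).memLp),
    ← toL2_add ((D.decaying_el j hS').const_mul _).memLp (memLp_conj hk.memLp)]
  congr 1
  funext x
  rw [(D.blaschke j).modelFun_conjPoly S x, ← D.conj_u_mul_P j x]
  simp only [map_mul, map_add, Complex.conj_conj]
  ring

lemma H_smul (c : ℂ) (f : L2) : D.H (c • f) = starRingEnd ℂ c • D.H f := hankel_smul _ c f

lemma H_H (j : Fin N) {f : L2} (hf : f ∈ D.E j) :
    D.H (D.H f) = ((‖D.s j‖ : ℂ) ^ 2) • f := by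
  obtain ⟨S, hS, rfl⟩ := (D.mem_E_iff j f).mp hf
  rw [D.H_el j hS, H_smul, D.H_el j (by rwa [conjPoly_degree]), conjPoly_conjPoly, smul_smul,
    map_neg, neg_mul_neg, Complex.conj_mul']

lemma inner_H_comm {f g : L2} (hf : f ∈ hardy) (hg : g ∈ hardy) :
    (inner ℂ f (D.H g) : ℂ) = inner ℂ g (D.H f) :=
  inner_hankel_comm D.decaying_u.bddHol.memLp_real hf hg

lemma H_mem_hardy (f : L2) : D.H f ∈ hardy := hankel_mem_hardy _ f

/-- These spaces consist of eigenvectors of `H_u²` for distinct eigenvalues, and symmetry of `H_u`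
makes `H_u²` self-adjoint. -/
lemma inner_E {j k : Fin N} (hjk : j ≠ k) {f g : L2} (hf : f ∈ D.E j) (hg : g ∈ D.E k) :
    (inner ℂ f g : ℂ) = 0 := by
  have hf' := D.E_le_hardy j hf
  have hg' := D.E_le_hardy k hg
  have h1 : (inner ℂ f (D.H (D.H g)) : ℂ) = inner ℂ (D.H g) (D.H f) :=
    D.inner_H_comm hf' (D.H_mem_hardy g)
  have h2 : (inner ℂ g (D.H (D.H f)) : ℂ) = inner ℂ (D.H f) (D.H g) :=
    D.inner_H_comm hg' (D.H_mem_hardy f)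
  rw [D.H_H k hg, inner_smul_right] at h1
  rw [D.H_H j hf, inner_smul_right] at h2
  have h3 := congrArg (starRingEnd ℂ) h2
  rw [inner_conj_symm, map_mul, inner_conj_symm, ← h1, map_pow, Complex.conj_ofReal] at h3
  have h4 : ((‖D.s j‖ : ℂ) ^ 2 - (‖D.s k‖ : ℂ) ^ 2) * inner ℂ f g = 0 := by
    linear_combination h3
  refine (mul_eq_zero.mp h4).resolve_left fun h5 => hjk (D.s_injective ?_)
  exact_mod_cast sub_eq_zero.mp h5

/-- Pairing `H_u h` with `θ g` gives, up to conjugation, `∫ (conj(u) θ) g h`. This vanishes because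
`conj(u) θ` is bounded and analytic. -/
lemma H_mem_model (h : L2) (hh : h ∈ hardy) : D.H h ∈ model D.θ := by
  have hθ : BddHol D.θ := D.isRat_θ.bddHol D.isNormalised_θ
  have hY : BddHol fun z => -∑ j, D.R j z * (1 - D.ψ j z) :=
    ((Decaying.sum (s := Finset.univ) fun j _ =>
      D.decaying_row_mul (fun k => starRingEnd ℂ (D.s k)) j).bddHol.mul (bddHol_const (-1))).congr
      fun z _ => by
        simp only [R]
        ring
  refine (mem_model_iff _).mpr ⟨D.H_mem_hardy h, fun g hg => ?_⟩
  have h1 := inner_star_eq_zero (bddHol_mul_mem_hardy hY hg) hh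
  rw [H, hankel, inner_proj _ (bddHol_mul_mem_hardy hθ hg), inner_eq_integral]
  rw [inner_star_eq_integral] at h1
  have h2 := congrArg (starRingEnd ℂ) h1
  rw [← integral_conj, map_zero] at h2
  rw [← h2]
  refine integral_congr_ae ?_
  filter_upwards [mulL2_coeFn hθ.memLp_real g, mulL2_coeFn hY.memLp_real g,
    mulL2_coeFn D.decaying_u.bddHol.memLp_real (star h), star_coeFn h] with x h1 h2 h3 h4
  rw [h1, h2, h3, h4, ← D.conj_u_mul_θ x]
  simp only [map_mul, Complex.conj_conj]
  ring

lemma exists_H_eq (j : Fin N) {f : L2} (hf : f ∈ D.E j) : ∃ h ∈ hardy, D.H h = f := by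
  have h1 : (‖D.s j‖ : ℂ) ^ 2 ≠ 0 := by simpa using D.s_ne j
  refine ⟨((‖D.s j‖ : ℂ) ^ 2)⁻¹ • D.H f, hardy.smul_mem _ (D.H_mem_hardy f), ?_⟩
  rw [H_smul, D.H_H j hf, smul_smul, map_inv₀, map_pow, Complex.conj_ofReal,
    inv_mul_cancel₀ h1, one_smul]

lemma decaying_modelKernel_mul (j : Fin N) {w : ℂ} (hw : w ∈ upperHalf) :
    Decaying fun z => D.P j z * modelKernel (D.ψ j) w z :=
  (D.bddHol_P j).mul_decaying ((D.blaschke j).decaying_modelKernel hw)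

lemma mulL2_P_modelKernel (j : Fin N) {w : ℂ} (hw : w ∈ upperHalf) :
    mulL2 (fun x : ℝ => D.P j x) (bv (modelKernel (D.ψ j) w))
      = bv fun z => D.P j z * modelKernel (D.ψ j) w z :=
  mulL2_bv (D.bddHol_P j) ((D.blaschke j).decaying_modelKernel hw)

lemma modelKernel_mul_mem (j : Fin N) {w : ℂ} (hw : w ∈ upperHalf) :
    (bv fun z => D.P j z * modelKernel (D.ψ j) w z) ∈ D.E j :=
  ⟨_, (D.blaschke j).modelKernel_mem hw, D.mulL2_P_modelKernel j hw⟩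

lemma bv_modelKernel_θ {w : ℂ} (hw : w ∈ upperHalf) : bv (modelKernel D.θ w)
    = ∑ j, ((D.kappaSq j : ℂ)⁻¹ * starRingEnd ℂ (D.P j w)) •
        bv fun z => D.P j z * modelKernel (D.ψ j) w z := by
  have h1 : ∀ j, ((D.kappaSq j : ℂ)⁻¹ * starRingEnd ℂ (D.P j w)) •
        (bv fun z => D.P j z * modelKernel (D.ψ j) w z)
      = bv fun z => ((D.kappaSq j : ℂ)⁻¹ * starRingEnd ℂ (D.P j w)) *
        (D.P j z * modelKernel (D.ψ j) w z) := fun j =>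
    (bv_const_mul _ (D.decaying_modelKernel_mul j hw)).symm
  rw [Finset.sum_congr rfl fun j _ => h1 j,
    ← bv_sum fun j _ => (D.decaying_modelKernel_mul j hw).const_mul _]
  refine bv_congr fun x => ?_
  simp only [modelKernel]
  rw [← D.sum_kernel (ofReal_mem_closed x) (upperHalf_subset_closed hw), Finset.sum_mul]
  exact Finset.sum_congr rfl fun j _ => by ring

/-- Dividing the kernel identity by `z - conj w` writes each reproducing kernel of `K_θ` as a
combination of elements of the spaces `E j`. -/
lemma model_le_iSup : model D.θ ≤ ⨆ j, D.E j := by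
  obtain ⟨m, b, -, hb⟩ := D.exists_isBlaschke_θ
  have := D.finiteDimensional_E
  have : FiniteDimensional ℂ (⨆ j, D.E j : Submodule ℂ L2) :=
    Submodule.finiteDimensional_iSup _
  refine hb.model_le_of_kernels fun w hw => ?_
  rw [D.bv_modelKernel_θ hw]
  exact Submodule.sum_mem _ fun j _ => Submodule.smul_mem _ _
    (Submodule.mem_iSup_of_mem j (D.modelKernel_mul_mem j hw))

lemma exists_sum_eq {f : L2} (hf : f ∈ model D.θ) :
    ∃ e : Fin N → L2, (∀ j, e j ∈ D.E j) ∧ f = ∑ j, e j := by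
  obtain ⟨μ, hμ⟩ := (Submodule.mem_iSup_iff_exists_finsupp _ _).mp (D.model_le_iSup hf)
  refine ⟨μ, hμ.1, ?_⟩
  rw [← hμ.2, Finsupp.sum_fintype _ _ fun _ => rfl]

lemma range_H : hankel (fun x : ℝ => D.u x) '' (hardy : Set L2) = (model D.θ : Set L2) := by
  refine Set.Subset.antisymm ?_ fun f hf => ?_
  · rintro _ ⟨h, hh, rfl⟩
    exact D.H_mem_model h hh
  · obtain ⟨e, he, rfl⟩ := D.exists_sum_eq hf
    choose k hk hk' using fun j => D.exists_H_eq j (he j)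
    refine ⟨∑ j, k j, hardy.sum_mem fun j _ => hk j, ?_⟩
    rw [hankel_sum]
    exact Finset.sum_congr rfl fun j _ => hk' j

lemma E_le_model (j : Fin N) : D.E j ≤ model D.θ := fun f hf => by
  obtain ⟨h, hh, rfl⟩ := D.exists_H_eq j hf
  exact D.H_mem_model h hh

/-- Since `f = s⁻² H_u² f` lies in the range of `H_u`, it lies in `K_θ` and splits into components.
By orthogonality the eigenvalue equation holds componentwise. -/
lemma exists_sum_of_mem_schmidt {s : ℝ} (hs : 0 < s) {f : L2}
    (hf : f ∈ schmidt (fun x : ℝ => D.u x) s) :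
    ∃ e : Fin N → L2, (∀ j, e j ∈ D.E j) ∧ f = ∑ j, e j ∧ ∀ j, e j = 0 ∨ ‖D.s j‖ = s := by
  have hs' : (s : ℂ) ^ 2 ≠ 0 := by simpa using hs.ne'
  have h1 : D.H (D.H f) = ((s : ℂ) ^ 2) • f := hf.2
  have h2 : f ∈ model D.θ := by
    have h3 := (model D.θ).smul_mem ((s : ℂ) ^ 2)⁻¹ (D.H_mem_model _ (D.H_mem_hardy f))
    rwa [h1, smul_smul, inv_mul_cancel₀ hs', one_smul] at h3
  obtain ⟨e, he, rfl⟩ := D.exists_sum_eq h2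
  refine ⟨e, he, rfl, fun j => ?_⟩
  have h4 : ∑ k, ((‖D.s k‖ : ℂ) ^ 2) • e k = ∑ k, ((s : ℂ) ^ 2) • e k := by
    rw [← Finset.smul_sum, ← h1]
    rw [H, H, hankel_sum, hankel_sum]
    exact Finset.sum_congr rfl fun k _ => (D.H_H k (he k)).symm
  have h5 := congrArg (inner ℂ (e j)) h4
  rw [inner_sum, inner_sum, Finset.sum_eq_single j, Finset.sum_eq_single j, inner_smul_right,
    inner_smul_right] at h5
  · by_cases h6 : e j = 0
    · exact Or.inl h6
    · right
      have h7 : (inner ℂ (e j) (e j) : ℂ) ≠ 0 := inner_self_ne_zero.mpr h6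
      have h8 := mul_right_cancel₀ h7 h5
      have h9 : ‖D.s j‖ ^ 2 = s ^ 2 := by exact_mod_cast h8
      exact (pow_left_inj₀ (norm_nonneg _) hs.le (by norm_num)).mp h9
  · intro k _ hk
    rw [inner_smul_right, D.inner_E hk.symm (he j) (he k), mul_zero]
  · simp
  · intro k _ hk
    rw [inner_smul_right, D.inner_E hk.symm (he j) (he k), mul_zero]
  · simp

lemma schmidt_eq (j : Fin N) : schmidt (fun x : ℝ => D.u x) ‖D.s j‖ = D.E j := by
  refine le_antisymm (fun f hf => ?_) fun f hf => ⟨D.E_le_hardy j hf, D.H_H j hf⟩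
  obtain ⟨e, he, rfl, h⟩ := D.exists_sum_of_mem_schmidt (norm_pos_iff.mpr (D.s_ne j)) hf
  refine Submodule.sum_mem _ fun k _ => ?_
  rcases h k with h | h
  · rw [h]
    exact Submodule.zero_mem _
  · have : k = j := D.s_injective (by simp only [h])
    exact this ▸ he k

lemma schmidt_eq_bot {s : ℝ} (hs : 0 < s) (h : ∀ j, ‖D.s j‖ ≠ s) :
    schmidt (fun x : ℝ => D.u x) s = ⊥ := by
  refine (Submodule.eq_bot_iff _).mpr fun f hf => ?_
  obtain ⟨e, he, rfl, h'⟩ := D.exists_sum_of_mem_schmidt hs hf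
  exact Finset.sum_eq_zero fun k _ => (h' k).resolve_right (h k)

lemma exists_P_ne_zero (j : Fin N) : ∃ Y : ℝ, 0 < Y ∧ ∀ y : ℝ, Y ≤ y → D.P j (y * I) ≠ 0 := by
  have h1 : (1 : ℂ) * D.kappaSq j ≠ 0 := by
    rw [one_mul]
    exact_mod_cast (D.kappaSq_pos j).ne'
  have h2 := ((D.tendsto_row (fun _ => 1) j).comp tendsto_mul_I_atInfty).eventually_ne h1
  obtain ⟨Y, hY⟩ := eventually_atTop.mp h2
  exact ⟨max Y 1, by positivity, fun y hy => hY y ((le_max_left _ _).trans hy)⟩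

/-- The kernel of `K_θ` at `w` evaluates `P_j f` at `w`. Only the `j`-th term of its expansion is
not orthogonal to `P_j f`, and the common factor `P_j(w)` is divided out. -/
lemma inner_kernel_mul (j : Fin N) {S : Polynomial ℂ} (hS : S.degree < D.m j) {w : ℂ}
    (hw : w ∈ upperHalf) (hP : D.P j w ≠ 0) :
    inner ℂ (bv fun z => D.P j z * modelKernel (D.ψ j) w z) (D.el j S)
      = D.kappaSq j * (2 * Real.pi * I * modelFun (D.a j) S w) := by
  obtain ⟨m, b, -, hb⟩ := D.exists_isBlaschke_θ
  have h1 := hb.inner_modelKernel (D.E_le_model j (D.el_mem j hS))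
    (D.decaying_el j hS).hasBoundaryValue hw
  rw [D.bv_modelKernel_θ hw, sum_inner, Finset.sum_eq_single j, inner_smul_left, map_mul,
    map_inv₀, Complex.conj_ofReal, Complex.conj_conj] at h1
  · have h2 : (D.kappaSq j : ℂ) ≠ 0 := by exact_mod_cast (D.kappaSq_pos j).ne'
    refine mul_left_cancel₀ (mul_ne_zero (inv_ne_zero h2) hP) (h1.trans ?_)
    field_simp
  · intro k _ hk
    rw [inner_smul_left, D.inner_E hk (D.modelKernel_mul_mem k hw) (D.el_mem j hS), mul_zero]
  · simp

/-- `P_j / κ_j` is an isometric multiplier. -/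
lemma inner_el (j : Fin N) {S T : Polynomial ℂ} (hS : S.degree < D.m j) (hT : T.degree < D.m j) :
    inner ℂ (D.el j T) (D.el j S)
      = D.kappaSq j * inner ℂ (bv (modelFun (D.a j) T)) (bv (modelFun (D.a j) S)) := by
  have hB := D.blaschke j
  set m : ℝ → ℂ := fun x => D.P j x
  have := hB.finiteDimensional_model
  have hcl : (model (D.ψ j)).topologicalClosure = model (D.ψ j) :=
    (Submodule.closed_of_finiteDimensional _).submodule_topologicalClosure_eq
  set x : L2 := proj (model (D.ψ j)) (ContinuousLinearMap.adjoint (mulL2 m) (D.el j S)) with hx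
  have hxm : x ∈ model (D.ψ j) := by
    rw [← hcl]
    exact Submodule.starProjection_apply_mem _ _
  have hxi : ∀ f ∈ model (D.ψ j), inner ℂ f x = (inner ℂ (mulL2 m f) (D.el j S) : ℂ) :=
    fun f hf => by rw [hx, inner_proj _ hf, ContinuousLinearMap.adjoint_inner_right]
  obtain ⟨U, hU, hxU⟩ := hB.exists_modelFun hxm
  -- Here `x` is the model-space projection of the adjoint multiplier applied to `P_j f`. Testing
  -- against kernels shows `x = κ_j² f` wherever `P_j ≠ 0`, in particular on a vertical ray.
  -- Infinitely many points determine the numerator.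
  have h1 : U - (D.kappaSq j : ℂ) • S = 0 := by
    obtain ⟨Y, hY, hY'⟩ := D.exists_P_ne_zero j
    refine Polynomial.eq_zero_of_infinite_isRoot _ (Set.Infinite.mono (s := (fun y : ℝ => (y * I : ℂ)) '' Set.Ici Y) ?_ ?_)
    · rintro _ ⟨y, hy, rfl⟩
      have hw : (y * I : ℂ) ∈ upperHalf := by
        simpa [upperHalf] using hY.trans_le hy
      have h2 := hxi _ (hB.modelKernel_mem hw)
      rw [D.mulL2_P_modelKernel j hw, D.inner_kernel_mul j hS hw (hY' y hy),
        hB.inner_modelKernel hxm (F := modelFun (D.a j) U)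
          (hxU ▸ (hB.decaying_modelFun hU).hasBoundaryValue) hw] at h2
      have h3 : modelFun (D.a j) U (y * I) = D.kappaSq j * modelFun (D.a j) S (y * I) := by
        refine mul_left_cancel₀ (a := 2 * Real.pi * I) (by simp [Real.pi_ne_zero, I_ne_zero]) ?_
        rw [h2]
        ring
      rw [modelFun, modelFun] at h3
      have h4 := hB.eval_pole_ne (upperHalf_subset_closed hw)
      rw [div_eq_iff h4, mul_assoc, div_mul_cancel₀ _ h4] at h3
      simp [Polynomial.IsRoot, h3]
    · refine (Set.Ici_infinite Y).image fun y _ y' _ h => ?_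
      have := mul_right_cancel₀ I_ne_zero h
      exact_mod_cast this
  have h2 := hxi _ (hB.bv_modelFun_mem hT)
  rw [D.mulL2_P j hT, hxU, sub_eq_zero.mp h1, hB.bv_modelFun_smul _ hS, inner_smul_right] at h2
  exact h2.symm

end SpectralSystem

/-! ### Spectral data of the Hankel operator with symbol `u` -/

lemma inner_self_eq (f : L2) : inner ℂ f f = ((‖f‖ ^ 2 : ℝ) : ℂ) := by
  rw [inner_self_eq_norm_sq_to_K]
  push_cast
  rfl

namespace SpectralSystem

variable {N : ℕ} (D : SpectralSystem N)

/-- The isometric multiplier `p_j = P_j / κ_j`. -/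
def p (j : Fin N) (z : ℂ) : ℂ := ((Real.sqrt (D.kappaSq j))⁻¹ : ℝ) * D.P j z

lemma bddHol_p (j : Fin N) : BddHol (D.p j) := (bddHol_const _).mul (D.bddHol_P j)

lemma mulL2_p (j : Fin N) {S : Polynomial ℂ} (hS : S.degree < D.m j) :
    mulL2 (fun x : ℝ => D.p j x) (bv (modelFun (D.a j) S))
      = (((Real.sqrt (D.kappaSq j))⁻¹ : ℝ) : ℂ) • D.el j S := by
  rw [mulL2_bv (D.bddHol_p j) ((D.blaschke j).decaying_modelFun hS), el,
    ← bv_const_mul _ (D.decaying_el j hS)]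
  exact bv_congr fun x => by simp only [p, mul_assoc]

lemma norm_mulL2_p (j : Fin N) {S : Polynomial ℂ} (hS : S.degree < D.m j) :
    ‖mulL2 (fun x : ℝ => D.p j x) (bv (modelFun (D.a j) S))‖ = ‖bv (modelFun (D.a j) S)‖ := by
  have h1 := D.inner_el j hS hS
  rw [inner_self_eq, inner_self_eq] at h1
  have h2 : ‖D.el j S‖ ^ 2 = D.kappaSq j * ‖bv (modelFun (D.a j) S)‖ ^ 2 := by exact_mod_cast h1
  rw [D.mulL2_p j hS, norm_smul, Complex.norm_real, Real.norm_eq_abs, abs_inv,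
    abs_of_nonneg (Real.sqrt_nonneg _), ← pow_left_inj₀ (by positivity) (norm_nonneg _) two_ne_zero,
    mul_pow, h2, inv_pow, Real.sq_sqrt (D.kappaSq_pos j).le, ← mul_assoc,
    inv_mul_cancel₀ (D.kappaSq_pos j).ne', one_mul]

lemma isIsometricMultiplier_p (j : Fin N) : IsIsometricMultiplier (D.p j) (D.ψ j) := by
  refine ⟨(D.bddHol_p j).diff, fun f hf F hF => ⟨_, hF.bddHol_mul (D.bddHol_p j), ?_⟩⟩
  obtain ⟨S, hS, rfl⟩ := (D.blaschke j).exists_modelFun hf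
  exact D.norm_mulL2_p j hS

lemma E_eq_multModel (j : Fin N) : (D.E j : Set L2) = multModel (D.p j) (D.ψ j) := by
  have hκ : (Real.sqrt (D.kappaSq j) : ℂ) ≠ 0 := by
    exact_mod_cast (Real.sqrt_pos.mpr (D.kappaSq_pos j)).ne'
  refine Set.Subset.antisymm (fun g hg => ?_) ?_
  · obtain ⟨S, hS, rfl⟩ := (D.mem_E_iff j g).mp hg
    refine ⟨(Real.sqrt (D.kappaSq j) : ℂ) • bv (modelFun (D.a j) S),
      Submodule.smul_mem _ _ ((D.blaschke j).bv_modelFun_mem hS), _,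
      ((D.blaschke j).decaying_modelFun hS).hasBoundaryValue.smul _,
      (D.decaying_el j hS).hasBoundaryValue.congr fun z _ => ?_⟩
    simp only [p, Pi.smul_apply, smul_eq_mul]
    push_cast
    field_simp
  · rintro g ⟨f, hf, F, hF, hg⟩
    have h1 := hg.unique (hF.bddHol_mul (D.bddHol_p j)) fun _ _ => rfl
    obtain ⟨S, hS, rfl⟩ := (D.blaschke j).exists_modelFun hf
    rw [h1, D.mulL2_p j hS]
    exact Submodule.smul_mem _ _ (D.el_mem j hS)

lemma bv_q (j : Fin N) :
    bv (D.q j) = D.el j (polePoly (D.a j) - rootPoly (D.a j)) :=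
  bv_congr fun x => by
    rw [(D.blaschke j).modelFun_oneSub (ofReal_mem_closed x)]
    rfl

lemma bv_q_mem (j : Fin N) : bv (D.q j) ∈ D.E j := by
  rw [bv_q]
  exact D.el_mem j IsBlaschke.degree_oneSub_lt

lemma inner_q_self (j : Fin N) : inner ℂ (bv (D.q j)) (bv (D.q j)) = (D.n j : ℂ) := by
  have hB := D.blaschke j
  rw [bv_q, D.inner_el j IsBlaschke.degree_oneSub_lt IsBlaschke.degree_oneSub_lt, ← hB.oneSub_eq,
    inner_self_eq]
  have h1 := hB.norm_oneSub_pos (D.m_pos j)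
  have h2 : D.kappaSq j * ‖oneSub (D.ψ j)‖ ^ 2 = D.n j := by
    unfold kappaSq
    field_simp
  exact_mod_cast h2

lemma bv_q_ne_zero (j : Fin N) : bv (D.q j) ≠ 0 := by
  intro h
  have h1 := D.inner_q_self j
  rw [h, inner_zero_left] at h1
  exact (D.n_pos j).ne' (by exact_mod_cast h1.symm)

/-- The conjugation of the model space sends `1 - ψ_j` to its negative, which cancels the sign in
`H_el`. -/
lemma H_q (j : Fin N) : D.H (bv (D.q j)) = D.s j • bv (D.q j) := by
  rw [bv_q, D.H_el j IsBlaschke.degree_oneSub_lt]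
  have h1 : conjPoly (polePoly (D.a j) - rootPoly (D.a j))
      = -(polePoly (D.a j) - rootPoly (D.a j)) := by
    rw [neg_sub, conjPoly, Polynomial.map_sub]
    exact congrArg₂ _ conjPoly_polePoly conjPoly_rootPoly
  have h2 : D.el j (-(polePoly (D.a j) - rootPoly (D.a j)))
      = (-1 : ℂ) • D.el j (polePoly (D.a j) - rootPoly (D.a j)) := by
    rw [el, el, ← bv_const_mul _ (D.decaying_el j IsBlaschke.degree_oneSub_lt)]
    refine bv_congr fun x => ?_
    simp only [modelFun, Polynomial.eval_neg]
    ring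
  rw [h1, h2, smul_smul, neg_mul_neg, mul_one]

lemma bv_u : bv D.u = ∑ j, D.s j • bv (D.q j) := by
  rw [Finset.sum_congr rfl fun j _ => (bv_const_mul (D.s j) (D.decaying_q j)).symm,
    ← bv_sum fun j _ => (D.decaying_q j).const_mul _]
  rfl

lemma symbolProj_eq (j : Fin N) :
    symbolProj (fun x : ℝ => D.u x) ‖D.s j‖ = D.s j • bv (D.q j) := by
  rw [symbolProj, D.schmidt_eq]
  refine proj_eq_of_mem (Submodule.smul_mem _ _ (D.bv_q_mem j)) fun f hf => ?_
  rw [show toL2 (fun x : ℝ => D.u x) = bv D.u from rfl, bv_u,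
    ← Finset.add_sum_erase _ _ (Finset.mem_univ j), add_sub_cancel_left, inner_sum]
  refine Finset.sum_eq_zero fun k hk => ?_
  rw [inner_smul_right, D.inner_E (Finset.ne_of_mem_erase hk).symm hf (D.bv_q_mem k), mul_zero]

lemma hankel_symbolProj (j : Fin N) :
    hankel (fun x : ℝ => D.u x) (symbolProj (fun x : ℝ => D.u x) ‖D.s j‖)
      = starRingEnd ℂ (D.s j) • symbolProj (fun x : ℝ => D.u x) ‖D.s j‖ := by
  have h := D.H_smul (D.s j) (bv (D.q j))
  rw [D.H_q] at h
  rw [symbolProj_eq]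
  exact h

/-- The remainder polynomial of the identity `x q_j = const + P_j L_j + ν_j² ∑ q_k conj(A j k)`. -/
def remPoly (j : Fin N) : Polynomial ℂ :=
  adjPoly (D.a j) (polePoly (D.a j) - rootPoly (D.a j))
    + (I * D.c j - D.r j) • (polePoly (D.a j) - rootPoly (D.a j))

lemma degree_remPoly_lt (j : Fin N) : (D.remPoly j).degree < D.m j :=
  (Polynomial.degree_add_le _ _).trans_lt (max_lt (degree_adjPoly_lt IsBlaschke.degree_oneSub_lt)
    ((Polynomial.degree_smul_le _ _).trans_lt IsBlaschke.degree_oneSub_lt))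

/-- The parameter `r_j` is chosen for this: `⟨A*(1 - ψ_j), 1 - ψ_j⟩ = (r_j - i c_j) ‖1 - ψ_j‖²`, so
the correction in `remPoly` removes exactly the component along `1 - ψ_j`. Multiplication by `P_j`
scales inner products and preserves orthogonality. -/
lemma inner_q_remPoly (j : Fin N) : inner ℂ (bv (D.q j)) (D.el j (D.remPoly j)) = 0 := by
  have hB := D.blaschke j
  have h1 := hB.norm_oneSub_pos (D.m_pos j)
  have hd : ((I * D.c j - D.r j : ℂ) • (polePoly (D.a j) - rootPoly (D.a j))).degree < D.m j :=
    (Polynomial.degree_smul_le _ _).trans_lt IsBlaschke.degree_oneSub_lt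
  have h2 : D.r j * ‖oneSub (D.ψ j)‖ ^ 2
      = (inner ℂ (oneSub (D.ψ j)) (generator (D.ψ j) (oneSub (D.ψ j))) : ℂ).re := by
    unfold r
    field_simp
  rw [bv_q, D.inner_el j (D.degree_remPoly_lt j) IsBlaschke.degree_oneSub_lt, remPoly,
    hB.bv_modelFun_add (degree_adjPoly_lt IsBlaschke.degree_oneSub_lt) hd,
    hB.bv_modelFun_smul _ IsBlaschke.degree_oneSub_lt, ← hB.oneSub_eq, inner_add_right,
    hB.inner_adj_oneSub, ← h2, inner_smul_right, inner_self_eq]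
  rw [show ‖oneSub (D.ψ j)‖ ^ 2 / (4 * Real.pi) = D.c j from rfl]
  push_cast
  ring

lemma mul_q (j : Fin N) {z : ℂ} (hz : z ∈ closedUpperHalf) : z * D.q j z
    = D.P j z * modelFun (D.a j) (D.remPoly j) z
      + D.n j * ∑ k, D.q k z * starRingEnd ℂ (D.A j k) + D.n j * (I / (2 * Real.pi)) := by
  have hB := D.blaschke j
  have h0 : (D.n j : ℂ) ≠ 0 := by exact_mod_cast (D.n_pos j).ne'
  have h1 : modelFun (D.a j) (D.remPoly j) z
      = z * (1 - D.ψ j z) - 2 * I * D.c j + (I * D.c j - D.r j) * (1 - D.ψ j z) := by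
    have e : modelFun (D.a j) (D.remPoly j) z
        = modelFun (D.a j) (adjPoly (D.a j) (polePoly (D.a j) - rootPoly (D.a j))) z
          + (I * D.c j - D.r j) * modelFun (D.a j) (polePoly (D.a j) - rootPoly (D.a j)) z := by
      simp only [modelFun, remPoly, Polynomial.eval_add, Polynomial.eval_smul, smul_eq_mul]
      ring
    rw [e, hB.modelFun_adjPoly _ hz, hB.coeff_oneSub, hB.modelFun_oneSub hz]
    rfl
  have h2 := D.P_mul_g j hz
  rw [← mul_div_assoc, div_eq_iff h0] at h2
  have h3 : D.g j z = I * D.c j * (1 + D.ψ j z) + D.r j * (1 - D.ψ j z) := rfl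
  rw [h3] at h2
  rw [h1, q]
  linear_combination h2

/-- By `mul_q`, the adjoint generator maps `q_j` to `P_j L_j + ν_j² ∑ conj(A_jk) q_k`. Pairing with
`q_j` leaves only the term `k = j`, because `P_j L_j` and the other `q_k` are orthogonal to it.
Passing to the adjoint removes the conjugate. -/
lemma inner_generator (j : Fin N) :
    inner ℂ (bv (D.q j)) (generator D.θ (D.s j • bv (D.q j)))
      = D.s j * ((D.n j : ℂ) ^ 2 * D.A j j) := by
  obtain ⟨m, b, -, hb⟩ := D.exists_isBlaschke_θ
  obtain ⟨S, hS, hSq⟩ := hb.exists_modelFun (D.E_le_model j (D.bv_q_mem j))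
  have hsS : (D.s j • S).degree < m := (Polynomial.degree_smul_le _ _).trans_lt hS
  have hd1 := D.decaying_el j (D.degree_remPoly_lt j)
  have hd2 : ∀ k, Decaying fun z => D.n j * starRingEnd ℂ (D.A j k) * D.q k z :=
    fun k => (D.decaying_q k).const_mul _
  have hd3 := Decaying.sum (s := Finset.univ) fun k _ => hd2 k
  have hd4 := hb.decaying_modelFun (degree_adjPoly_lt (a := b) hS)
  have hd5 := hb.decaying_modelFun hS
  have heq : ∀ z ∈ closedUpperHalf, modelFun b S z = D.q j z :=
    eqOn_closed_of_eqOn hd5.cont (D.decaying_q j).cont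
      (eqOn_of_bv_eq hd5 (D.decaying_q j) hSq.symm)
  have h1 : ∀ z ∈ closedUpperHalf, modelFun b (adjPoly b S) z
      = (D.P j z * modelFun (D.a j) (D.remPoly j) z
        + ∑ k, D.n j * starRingEnd ℂ (D.A j k) * D.q k z)
        + (D.n j * (I / (2 * Real.pi)) - S.coeff (m - 1)) := fun z hz => by
    have e : ∑ k, D.n j * starRingEnd ℂ (D.A j k) * D.q k z
        = D.n j * ∑ k, D.q k z * starRingEnd ℂ (D.A j k) := by
      rw [Finset.mul_sum]
      exact Finset.sum_congr rfl fun k _ => by ring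
    rw [hb.modelFun_adjPoly S hz, heq z hz, D.mul_q j hz, e]
    ring
  -- Everything else in the preceding identity tends to zero at infinity, so the constant term must
  -- vanish.
  have h2 : (D.n j * (I / (2 * Real.pi)) - S.coeff (m - 1) : ℂ) = 0 := by
    refine tendsto_nhds_unique (f := fun _ : ℂ => (D.n j * (I / (2 * Real.pi)) - S.coeff (m - 1) : ℂ))
      (l := atInfty) tendsto_const_nhds ((hd4.sub (hd1.add hd3)).tendsto_zero.congr' ?_)
    filter_upwards [eventually_atInfty_mem] with z hz
    rw [h1 z hz, add_sub_cancel_left]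
  have h3 : bv (modelFun b (adjPoly b S)) = D.el j (D.remPoly j)
      + ∑ k, (D.n j * starRingEnd ℂ (D.A j k)) • bv (D.q k) := by
    rw [Finset.sum_congr rfl fun k _ => (bv_const_mul _ (D.decaying_q k)).symm,
      ← bv_sum fun k _ => hd2 k, el, ← bv_add hd1 hd3]
    refine bv_congr fun x => ?_
    rw [h1 x (ofReal_mem_closed x), h2, add_zero]
  have h4 : inner ℂ (bv (D.q j)) (bv (modelFun b (adjPoly b S)))
      = (D.n j : ℂ) ^ 2 * starRingEnd ℂ (D.A j j) := by
    rw [h3, inner_add_right, D.inner_q_remPoly, inner_sum, Finset.sum_eq_single j,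
      inner_smul_right, D.inner_q_self]
    · ring
    · intro k _ hk
      rw [inner_smul_right, D.inner_E hk.symm (D.bv_q_mem j) (D.bv_q_mem k), mul_zero]
    · simp
  rw [hSq, ← hb.bv_modelFun_smul _ hS, hb.generator_modelFun hsS, ← hb.inner_adjPoly hsS hS,
    hb.bv_modelFun_smul _ hS, inner_smul_right, ← inner_conj_symm, ← hSq, h4, map_mul, map_pow,
    Complex.conj_ofReal, Complex.conj_conj]

/-- The Hankel operator with symbol `u` has the spectral data encoded in the system. -/
theorem hasSpectralData {lam φ : Fin N → ℝ} {ω : Fin N → ℂ} (hlam : ∀ j, 0 < lam j)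
    (hs : ∀ j, D.s j = lam j * exp (-(I * φ j)))
    (hω : ∀ j, (lam j : ℂ) ^ 2 * (D.n j : ℂ) ^ 2 * D.A j j = ω j) :
    HasSpectralData (fun x : ℝ => D.u x) lam D.ψ φ ω := by
  have hns : ∀ j, ‖D.s j‖ = lam j := fun j => by
    rw [hs, norm_mul, Complex.norm_real, Real.norm_of_nonneg (hlam j).le,
      show -(I * (φ j : ℂ)) = ((-φ j : ℝ) : ℂ) * I by push_cast; ring, Complex.norm_exp_ofReal_mul_I,
      mul_one]
  have hconj : ∀ j, starRingEnd ℂ (D.s j) = lam j * exp (I * φ j) := fun j => by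
    rw [hs, map_mul, Complex.conj_ofReal, ← Complex.exp_conj]
    simp
  refine ⟨fun s hs0 => ⟨fun h => ?_, ?_⟩, fun n => ⟨D.p n, D.isIsometricMultiplier_p n, ?_⟩,
    fun n => ⟨?_, ?_⟩, ?_⟩
  · by_contra! hne
    exact h (D.schmidt_eq_bot hs0 fun j => by rw [hns]; exact hne j)
  · rintro ⟨n, rfl⟩
    rw [← hns, D.schmidt_eq]
    intro h
    have := D.bv_q_mem n
    rw [h, Submodule.mem_bot] at this
    exact D.bv_q_ne_zero n this
  · rw [← hns, D.schmidt_eq, D.E_eq_multModel]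
  · rw [← hns, D.symbolProj_eq]
    exact smul_ne_zero (D.s_ne n) (D.bv_q_ne_zero n)
  · rw [← hconj, ← hns]
    exact D.hankel_symbolProj n
  · obtain ⟨m, b, hm, hb⟩ := D.exists_isBlaschke_θ
    refine ⟨m, D.θ, hm, D.isNormalised_θ, D.range_H, hb.isGenerator, fun n => ?_⟩
    rw [← hns, D.symbolProj_eq, inner_smul_left, D.inner_generator, ← hω, ← mul_assoc,
      Complex.conj_mul', hns, mul_assoc]

end SpectralSystem

/-! ### The concrete matrices -/

section Concrete

variable {N : ℕ} {lam φ : Fin N → ℝ} {ω : Fin N → ℂ}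

lemma sq_sub_sq_ne_zero (hlam : ∀ j, 0 < lam j) (hinj : Function.Injective lam) {j k : Fin N}
    (hjk : j ≠ k) : (lam j : ℂ) ^ 2 - (lam k : ℂ) ^ 2 ≠ 0 := by
  intro h
  refine hjk (hinj ?_)
  have h1 : lam j ^ 2 = lam k ^ 2 := by exact_mod_cast sub_eq_zero.mp h
  exact (pow_left_inj₀ (hlam j).le (hlam k).le two_ne_zero).mp h1

lemma matA_diag (j : Fin N) : matA lam φ ω j j = ω j / (4 * Real.pi * (ω j).im) := by
  simp [matA]

lemma matA_offDiag {k j : Fin N} (h : k ≠ j) : matA lam φ ω k j = I / (2 * Real.pi) *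
      (((lam j : ℂ) ^ 2 - lam j * lam k * exp (I * (φ j - φ k))) /
        ((lam j : ℂ) ^ 2 - (lam k : ℂ) ^ 2)) := by
  simp [matA, h]

lemma conj_matA_offDiag {k j : Fin N} (h : k ≠ j) :
    starRingEnd ℂ (matA lam φ ω k j) = -(I / (2 * Real.pi) *
      (((lam j : ℂ) ^ 2 - lam j * lam k * exp (I * (φ k - φ j))) /
        ((lam j : ℂ) ^ 2 - (lam k : ℂ) ^ 2))) := by
  rw [matA_offDiag h]
  simp only [map_mul, map_div₀, map_sub, map_pow, conj_I, Complex.conj_ofReal, map_ofNat,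
    ← Complex.exp_conj]
  rw [show -I * ((φ j : ℂ) - φ k) = I * (φ k - φ j) by ring]
  ring

lemma matA_diag_sub_conj (hω : ∀ j, 0 < (ω j).im) (j : Fin N) :
    matA lam φ ω j j - starRingEnd ℂ (matA lam φ ω j j) = I / (2 * Real.pi) := by
  have h1 : ((ω j).im : ℂ) ≠ 0 := by exact_mod_cast (hω j).ne'
  have h2 : (Real.pi : ℂ) ≠ 0 := by exact_mod_cast Real.pi_ne_zero
  have h3 := Complex.sub_conj (ω j)
  rw [matA_diag]
  simp only [map_mul, map_div₀, Complex.conj_ofReal, map_ofNat]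
  rw [← sub_div, h3]
  push_cast
  field_simp
  norm_num

lemma matA_sub_conj (hlam : ∀ j, 0 < lam j) (hinj : Function.Injective lam)
    (hω : ∀ j, 0 < (ω j).im) (k j : Fin N) :
    matA lam φ ω k j - starRingEnd ℂ (matA lam φ ω j k) = I / (2 * Real.pi) := by
  by_cases h : k = j
  · rw [h]
    exact matA_diag_sub_conj hω j
  · rw [matA_offDiag h, conj_matA_offDiag (Ne.symm h)]
    have h1 := sq_sub_sq_ne_zero hlam hinj h
    have h2 := sq_sub_sq_ne_zero hlam hinj (Ne.symm h)
    have h3 : (Real.pi : ℂ) ≠ 0 := by exact_mod_cast Real.pi_ne_zero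
    rw [← neg_sub ((lam j : ℂ) ^ 2) ((lam k : ℂ) ^ 2)]
    field_simp
    ring

/-- For `k ≠ j` this real-linear equation determines the entry, because `|s_j| ≠ |s_k|`; the
off-diagonal entries of `matA` are its solution. On the diagonal it reduces to the condition on the
imaginary part. -/
lemma matA_mul_sub (hlam : ∀ j, 0 < lam j) (hinj : Function.Injective lam)
    (hω : ∀ j, 0 < (ω j).im) (k j : Fin N) :
    matA lam φ ω k j * (lam j * exp (-(I * φ j)))
        - lam k * exp (-(I * φ k)) * starRingEnd ℂ (matA lam φ ω k j)
      = I / (2 * Real.pi) * (lam j * exp (-(I * φ j))) := by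
  by_cases h : k = j
  · rw [h, ← matA_diag_sub_conj (lam := lam) (φ := φ) hω j]
    ring
  · rw [conj_matA_offDiag h, matA_offDiag h]
    have h2 := sq_sub_sq_ne_zero hlam hinj (Ne.symm h)
    have h3 : (Real.pi : ℂ) ≠ 0 := by exact_mod_cast Real.pi_ne_zero
    have h4 : exp (I * ((φ j : ℂ) - φ k)) * exp (-(I * φ j)) = exp (-(I * φ k)) := by
      rw [← Complex.exp_add]
      congr 1
      ring
    have h5 : exp (-(I * (φ k : ℂ))) * exp (I * ((φ k : ℂ) - φ j)) = exp (-(I * φ j)) := by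
      rw [← Complex.exp_add]
      congr 1
      ring
    field_simp
    linear_combination (-(lam j : ℂ) ^ 2 * lam k) * h4 - (lam j : ℂ) * (lam k : ℂ) ^ 2 * h5

lemma nuSq_pos (hlam : ∀ j, 0 < lam j) (hω : ∀ j, 0 < (ω j).im) (j : Fin N) :
    0 < nuSq lam ω j :=
  div_pos (Real.sqrt_pos.mpr (by have := hω j; have := Real.pi_pos; positivity)) (hlam j)

lemma sq_mul_nuSq_sq (hlam : ∀ j, 0 < lam j) (hω : ∀ j, 0 < (ω j).im) (j : Fin N) :
    lam j ^ 2 * nuSq lam ω j ^ 2 = 4 * Real.pi * (ω j).im := by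
  have h1 := (hlam j).ne'
  have h2 : 0 ≤ 4 * Real.pi * (ω j).im := by have := hω j; have := Real.pi_pos; positivity
  rw [nuSq, div_pow, Real.sq_sqrt h2]
  field_simp

variable {m : Fin N → ℕ} {a : ∀ j, Fin (m j) → ℂ} {ψ : Fin N → ℂ → ℂ}

/-- The system attached to given spectral data with normalised Blaschke products. -/
def spectralSystem (hlam : ∀ j, 0 < lam j) (hinj : Function.Injective lam)
    (hm : ∀ j, 0 < m j) (hψ : ∀ j, IsBlaschke (a j) (ψ j)) (φ : Fin N → ℝ)
    (hω : ∀ j, 0 < (ω j).im) : SpectralSystem N where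
  A := matA lam φ ω
  s := fun j => lam j * exp (-(I * φ j))
  n := nuSq lam ω
  m := m
  a := a
  ψ := ψ
  blaschke := hψ
  m_pos := hm
  n_pos := nuSq_pos hlam hω
  sub_conj := matA_sub_conj hlam hinj hω
  mul_sub_mul_conj := matA_mul_sub hlam hinj hω
  s_injective := fun j k h => by
    have e : ∀ j, ‖(lam j : ℂ) * exp (-(I * φ j))‖ = lam j := fun j => by
      rw [norm_mul, Complex.norm_real, Real.norm_of_nonneg (hlam j).le,
        show -(I * (φ j : ℂ)) = ((-φ j : ℝ) : ℂ) * I by push_cast; ring,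
        Complex.norm_exp_ofReal_mul_I, mul_one]
    simp only [e] at h
    exact hinj ((pow_left_inj₀ (hlam j).le (hlam k).le two_ne_zero).mp h)
  s_ne := fun j => mul_ne_zero (by exact_mod_cast (hlam j).ne') (Complex.exp_ne_zero _)

/-- The term `x / ν²` cancels against the one in `bFun`. The factor `1 - ψ_k`, non-zero in the open
half-plane, clears the denominator of the Cayley transform, which may vanish on the real line. -/
lemma M_eq_diagonal_mul_matQ (hlam : ∀ j, 0 < lam j) (hinj : Function.Injective lam)
    (hm : ∀ j, 0 < m j) (hψ : ∀ j, IsBlaschke (a j) (ψ j)) (hω : ∀ j, 0 < (ω j).im)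
    {z : ℂ} (hz : z ∈ upperHalf) :
    (spectralSystem hlam hinj hm hψ φ hω).M z
      = Matrix.diagonal (fun k => 1 - ψ k z) * matQ lam ψ φ ω z := by
  ext k j
  have h1 : ∀ k, 1 - ψ k z ≠ 0 := fun k h => by
    have := (hψ k).norm_lt_one (hm k) hz
    rw [← sub_eq_zero.mp h] at this
    simp at this
  have h2 : (nuSq lam ω k : ℂ) ≠ 0 := by exact_mod_cast (nuSq_pos hlam hω k).ne'
  rw [Matrix.diagonal_mul]
  by_cases hkj : k = j
  · subst hkj
    simp only [SpectralSystem.M, SpectralSystem.g, spectralSystem, matQ, Matrix.of_apply,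
      Matrix.sub_apply, Matrix.smul_apply, Matrix.diagonal_apply_eq, Matrix.conjTranspose_apply,
      if_true, SpectralSystem.c, SpectralSystem.r, cayley, bFun, smul_eq_mul, RCLike.star_def]
    have := h1 k
    field_simp
    ring
  · simp [SpectralSystem.M, spectralSystem, matQ, hkj]

lemma isUnit_det_matQ (hlam : ∀ j, 0 < lam j) (hinj : Function.Injective lam)
    (hm : ∀ j, 0 < m j) (hψ : ∀ j, IsBlaschke (a j) (ψ j)) (hω : ∀ j, 0 < (ω j).im)
    (φ : Fin N → ℝ) {z : ℂ} (hz : z ∈ upperHalf) :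
    IsUnit (matQ lam ψ φ ω z).det := by
  have h := (spectralSystem hlam hinj hm hψ φ hω).det_M_ne_zero (upperHalf_subset_closed hz)
  rw [M_eq_diagonal_mul_matQ hlam hinj hm hψ hω hz, Matrix.det_mul] at h
  exact isUnit_iff_ne_zero.mpr (right_ne_zero_of_mul h)

/-- The row `q` equals `-(i/2π) 𝟙ᵀ Q⁻¹`, so `u = q · s` is the bilinear expression of the formula,
with `-(i/2π) = 1/(2πi)`. -/
lemma u_eq_symbolFormula (hlam : ∀ j, 0 < lam j) (hinj : Function.Injective lam)
    (hm : ∀ j, 0 < m j) (hψ : ∀ j, IsBlaschke (a j) (ψ j)) (hω : ∀ j, 0 < (ω j).im)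
    (φ : Fin N → ℝ) {z : ℂ} (hz : z ∈ upperHalf) :
    (spectralSystem hlam hinj hm hψ φ hω).u z = symbolFormula lam ψ φ ω z := by
  set D := spectralSystem hlam hinj hm hψ φ hω with hD
  have hQ := isUnit_det_matQ hlam hinj hm hψ hω φ hz
  have h1 : (fun k => D.q k z) ᵥ* matQ lam ψ φ ω z = fun _ => -(I / (2 * Real.pi)) := by
    have e : (fun k => D.q k z) = (fun k => D.P k z) ᵥ* Matrix.diagonal (fun k => 1 - ψ k z) := by
      funext k
      rw [Matrix.vecMul_diagonal]
      rfl
    rw [e, Matrix.vecMul_vecMul, ← M_eq_diagonal_mul_matQ hlam hinj hm hψ hω hz]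
    funext j
    rw [D.vecMul_M, D.P_mul_g j (upperHalf_subset_closed hz)]
    simp only [SpectralSystem.q]
    ring
  have h2 : (fun k => D.q k z) = -(I / (2 * Real.pi)) • ((fun _ => 1) ᵥ* (matQ lam ψ φ ω z)⁻¹) := by
    rw [← Matrix.smul_vecMul, ← Matrix.vecMul_one fun k => D.q k z, ← Matrix.mul_nonsing_inv _ hQ,
      ← Matrix.vecMul_vecMul, h1]
    congr 1
    funext j
    simp
  have h3 : D.u z = (fun k => D.q k z) ⬝ᵥ D.s := by
    simp only [SpectralSystem.u, dotProduct]
    exact Finset.sum_congr rfl fun k _ => mul_comm _ _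
  have h4 : -(I / (2 * Real.pi)) = 1 / (2 * Real.pi * I) := by
    have : (Real.pi : ℂ) ≠ 0 := by exact_mod_cast Real.pi_ne_zero
    have := I_ne_zero
    field_simp
    simp
  rw [h3, h2, smul_dotProduct, ← Matrix.dotProduct_mulVec, symbolFormula, h4]
  simp [dotProduct, hD, spectralSystem]

lemma hasSpectralData_spectralSystem (hlam : ∀ j, 0 < lam j) (hinj : Function.Injective lam)
    (hm : ∀ j, 0 < m j) (hψ : ∀ j, IsBlaschke (a j) (ψ j)) (hω : ∀ j, 0 < (ω j).im)
    (φ : Fin N → ℝ) :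
    HasSpectralData (fun x : ℝ => (spectralSystem hlam hinj hm hψ φ hω).u x) lam ψ φ ω := by
  refine SpectralSystem.hasSpectralData (spectralSystem hlam hinj hm hψ φ hω) hlam
    (fun _ => rfl) fun j => ?_
  have h1 : (lam j : ℂ) ^ 2 * (nuSq lam ω j : ℂ) ^ 2 = 4 * Real.pi * (ω j).im := by
    exact_mod_cast sq_mul_nuSq_sq hlam hω j
  have h2 : (4 * Real.pi * (ω j).im : ℂ) ≠ 0 := by
    have := (hω j).ne'
    have := Real.pi_ne_zero
    simp [*]
  change (lam j : ℂ) ^ 2 * (nuSq lam ω j : ℂ) ^ 2 * matA lam φ ω j j = ω j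
  rw [matA_diag, h1, mul_div_cancel₀ _ h2]

end Concrete

/-- The functions `ψ_n` enter the spectral data only through their model spaces, which is what
allows the normalisation at infinity to be dropped. -/
lemma HasSpectralData.congr_model {N : ℕ} {u : ℝ → ℂ} {lam φ : Fin N → ℝ} {ω : Fin N → ℂ}
    {ψ ψ' : Fin N → ℂ → ℂ} (h : HasSpectralData u lam ψ' φ ω)
    (he : ∀ n, model (ψ n) = model (ψ' n)) : HasSpectralData u lam ψ φ ω := by
  refine ⟨h.singular_values, fun n => ?_, h.hankel_proj, h.generator_proj⟩
  obtain ⟨p, hp⟩ := h.schmidt_eq n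
  refine ⟨p, ?_⟩
  simpa only [IsIsometricMultiplier, multModel, he n] using hp

end SzegoHankel

end

/-- Inverse spectral theorem for finite rank Hankel operators on `H²(ℂ₊)`: the symbol given by
the explicit formula has the prescribed spectral data, and the spectral map is surjective. -/
theorem theorem6p2 (N : ℕ) (lam : Fin N → ℝ) (hlam_pos : ∀ j, 0 < lam j)
    (hlam : StrictAnti lam)
    (m : Fin N → ℕ) (hm : ∀ j, 0 < m j)
    (ψ : Fin N → ℂ → ℂ) (hψ : ∀ j, SzegoHankel.IsFiniteBlaschke (m j) (ψ j))
    (φ : Fin N → ℝ) (ω : Fin N → ℂ) (hω : ∀ j, 0 < (ω j).im) :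
    ((∀ j, SzegoHankel.IsNormalised (ψ j)) →
      (∀ j, SzegoHankel.IsGenerator (ψ j) (SzegoHankel.generator (ψ j))) ∧
      (∀ x ∈ SzegoHankel.upperHalf, IsUnit (SzegoHankel.matQ lam ψ φ ω x).det) ∧
      ∃ u : ℂ → ℂ, SzegoHankel.IsRationalSymbol u ∧
        (∀ x ∈ SzegoHankel.upperHalf, u x = SzegoHankel.symbolFormula lam ψ φ ω x) ∧
        SzegoHankel.HasSpectralData (fun x : ℝ => u x) lam ψ φ ω) ∧
    ∃ u : ℂ → ℂ, SzegoHankel.IsRationalSymbol u ∧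
      SzegoHankel.HasSpectralData (fun x : ℝ => u x) lam ψ φ ω := by
  have key : ∀ ψ' : Fin N → ℂ → ℂ, (∀ j, SzegoHankel.IsFiniteBlaschke (m j) (ψ' j)) →
      (∀ j, SzegoHankel.IsNormalised (ψ' j)) →
      (∀ j, SzegoHankel.IsGenerator (ψ' j) (SzegoHankel.generator (ψ' j))) ∧
      (∀ x ∈ SzegoHankel.upperHalf, IsUnit (SzegoHankel.matQ lam ψ' φ ω x).det) ∧
      ∃ u : ℂ → ℂ, SzegoHankel.IsRationalSymbol u ∧
        (∀ x ∈ SzegoHankel.upperHalf, u x = SzegoHankel.symbolFormula lam ψ' φ ω x) ∧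
        SzegoHankel.HasSpectralData (fun x : ℝ => u x) lam ψ' φ ω := by
    intro ψ' hψ' hn
    choose a ha using fun j => (hψ' j).exists_isBlaschke (hn j)
    refine ⟨fun j => (ha j).isGenerator, fun x hx =>
      SzegoHankel.isUnit_det_matQ hlam_pos hlam.injective hm ha hω φ hx,
      (SzegoHankel.spectralSystem hlam_pos hlam.injective hm ha φ hω).u,
      SzegoHankel.SpectralSystem.isRationalSymbol_u _, fun x hx =>
      SzegoHankel.u_eq_symbolFormula hlam_pos hlam.injective hm ha hω φ hx,
      SzegoHankel.hasSpectralData_spectralSystem hlam_pos hlam.injective hm ha hω φ⟩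
  refine ⟨key ψ hψ, ?_⟩
  -- Each `ψ_j` is a constant multiple of a normalised Blaschke product with the same model space.
  choose c ψ' hc hψ' hn he using fun j => (hψ j).exists_normalised
  obtain ⟨-, -, u, hu, -, hd⟩ := key ψ' hψ' hn
  refine ⟨u, hu, hd.congr_model fun n => ?_⟩
  obtain ⟨a, ha⟩ := (hψ' n).exists_isBlaschke (hn n)
  exact SzegoHankel.model_eq_of_const_mul (hc n) ha.bddHol (he n)
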